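/- **Theorem.** Exactly-Double Threading is polynomially equivalent to the Traveling Salesperson problem (TSP). *Definitions.* Let $G=(V,E)$ be a finite simple connected graph of minimum degree at least $2$. A turn at $v$ is an unordered pair of distinct edges incident to $v$; turn costs are a function $\alpha$ from the turns to the nonnegative numbers. The junction graph $J(v)$ of a closed walk is the multigraph whose vertices are the edges of $G$ incident to $v$, with one edge $\{e,f\}$ for each time that the walk visits $v$ immediately between traversing $e$ and $f$ (the last and the first edge of the walk count as consecutive). A threading is a closed walk that traverses every edge at least once, has connected junction graphs, and never traverses the same edge twice in sequence (cyclically); it is exactly-double if it traverses every edge exactly twice. Its turn cost is the sum of the costs of its turns, cyclically. A TSP instance consists of $n\ge 1$ cities with symmetric nonnegative distances $d(i,j)$ (and $d(i,i)=0$); a tour visits each city exactly once and returns to its start. On two cities the tour is the doubled edge, and this is also called a Hamiltonian cycle below. 1. *(Decomposition; real costs.)* For every exactly-double threading of $G$, each $J(v)$ is a Hamiltonian cycle on the edges incident to $v$, and the turn cost of the threading is the sum over $v$ of the costs of these cycles. Conversely, for every choice of a Hamiltonian cycle $C_v$ on the edges incident to $v$, for each $v\in V$, there is an exactly-double threading with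 $J(v)=C_v$ for all $v$, and its cost is the sum of the costs of the $C_v$. Hence the minimum cost of an exactly-double threading exists and equals $\sum_{v\in V}\tau_v$, where $\tau_v$ is the minimum length of a tour in the TSP instance whose cities are the edges $e$ incident to $v$, with distances $d(e,f)=\alpha(e,f)$. 2. *(Star of arms; real costs.)* Let $n\ge 2$ and let $d$ be symmetric nonnegative distances on $n$ cities. Let $G$ consist of a central vertex $c$ and $n$ arms $a_1,\dots,a_n$, each a triangle joined to $c$ by a bridge at one of its vertices; let the turn at $c$ between the bridges of $a_i$ and $a_j$ cost $d(i,j)$, and let all other turns cost $1$. Then $G$ is connected of minimum degree at least $2$, and for every $C\ge 0$ there is a tour of length at most $C$ if and only if $G$ has an exactly-double threading of turn cost at most $C+7n$. 3. *(Decision versions, nonnegative rational costs in binary.)* The problem "is there a tour of length at most $C$?" is polynomial-time many-one reducible to the problem "is there an exactly-double threading of turn cost at most $c$?", and the latter is polynomial-time Turing reducible to the former. 4. *(Optimization versions, nonnegative rational costs in binary.)* The problem of finding a tour of minimum length and the problem of finding an exactly-double threading of minimum turn cost are polynomial-time Turing reducible to each other. -/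

import Mathlib

open scoped NNReal NNRat

namespace Threading

/-! ## Tours -/

/-- A tour of the set `S` of cities: a cyclic order `l` in which every city of `S` occurs exactly
once. After its last entry the tour returns to the first one. -/
def IsTour {X : Type*} (S : Set X) (l : List X) : Prop :=
  l.Nodup ∧ ∀ x, x ∈ l ↔ x ∈ S

/-- The length of a closed tour, including the way back from the last city to the first. -/
def tourLength {X R : Type*} [AddCommMonoid R] (d : X → X → R) (l : List X) : R :=
  (List.zipWith d l (l.rotate 1)).sum

/-- The edges of the cycle that runs through `l` in cyclic order, with multiplicity. On two
vertices this is the cycle of length two, a doubled edge. -/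
def cycleEdges {X : Type*} (l : List X) : Multiset (Sym2 X) :=
  ((List.zipWith (fun x y => s(x, y)) l (l.rotate 1) : List (Sym2 X)) : Multiset (Sym2 X))

/-! ## Threadings -/

/-- Turn costs. A turn at `v` is an unordered pair of distinct edges `uv`, `vw`; its cost is
`cost u v w`. Only the values at turns are ever relevant. -/
structure TurnCosts (V R : Type*) where
  cost : V → V → V → R
  symm : ∀ u v w, cost u v w = cost w v u

section Walks

variable {V : Type*} {G : SimpleGraph V}

/-- The turns of a closed walk in cyclic order: `(x, v, y)` stands for a visit of `v` between the
traversal of the edge `xv` and the traversal of the edge `vy`. The pair formed by the last and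
the first edge of the walk is included. -/
def turns {u : V} (W : G.Walk u u) : List (V × V × V) :=
  List.zipWith (fun d e => (d.fst, d.snd, e.snd)) W.darts (W.darts.rotate 1)

/-- The turn cost of a closed walk. -/
def TurnCosts.walkCost {R : Type*} [AddCommMonoid R] (α : TurnCosts V R) {u : V}
    (W : G.Walk u u) : R :=
  ((turns W).map fun t => α.cost t.1 t.2.1 t.2.2).sum

/-- The edges, with multiplicity, of the junction graph at `v` of a closed walk. An edge `vx` of `G`
incident to `v` is named by its other end `x`, so the vertices of the junction graph
are the neighbours of `v`. -/
def junction [DecidableEq V] {u : V} (W : G.Walk u u) (v : V) : Multiset (Sym2 V) :=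
  (((turns W).filter fun t => t.2.1 = v).map fun t => s(t.1, t.2.2) : List (Sym2 V))

/-- The simple graph underlying the junction graph at `v`. -/
def junctionGraph [DecidableEq V] {u : V} (W : G.Walk u u) (v : V) :
    SimpleGraph (G.neighborSet v) where
  Adj a b := a ≠ b ∧ s((a : V), (b : V)) ∈ junction W v
  symm := ⟨fun _ _ h => ⟨h.1.symm, by rw [Sym2.eq_swap]; exact h.2⟩⟩
  loopless := ⟨fun _ h => h.1 rfl⟩

/-- A threading: a closed walk that visits every edge, induces connected junction graphs and
has no U-turn (not even between its last and its first edge). -/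
structure IsThreading [DecidableEq V] {u : V} (W : G.Walk u u) : Prop where
  covers : ∀ e ∈ G.edgeSet, e ∈ W.edges
  connected : ∀ v, (junctionGraph W v).Connected
  noUTurn : ∀ t ∈ turns W, t.1 ≠ t.2.2

/-- A threading that traverses every edge exactly twice. -/
structure IsExactlyDoubleThreading [DecidableEq V] {u : V} (W : G.Walk u u) : Prop
    extends IsThreading W where
  twice : ∀ e ∈ G.edgeSet, W.edges.count e = 2

end Walks

/-- The standing assumption on graphs: connected and of minimum degree at least two. -/
structure Admissible {V : Type*} (G : SimpleGraph V) : Prop where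
  connected : G.Connected
  two_le_degree : ∀ v, 2 ≤ (G.neighborSet v).ncard

/-! ## The star of arms -/

/-- The star of `n` arms. The vertex `none` is the centre; the arm `i` is the triangle on
`(i, 0)`, `(i, 1)`, `(i, 2)` together with the bridge from `(i, 0)` to the centre. -/
def starGraph (n : ℕ) : SimpleGraph (Option (Fin n × Fin 3)) :=
  SimpleGraph.fromRel fun a b =>
    match a, b with
    | none, some (_, k) => k = 0
    | some (i, _), some (j, _) => i = j
    | _, _ => False

/-- Turn costs on the star of arms: turning at the centre from arm `i` to arm `j` costs `d i j`,
every other turn costs `1`. -/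
def starCosts {R : Type*} [One R] {n : ℕ} (d : Fin n → Fin n → R) (hd : ∀ i j, d i j = d j i) :
    TurnCosts (Option (Fin n × Fin 3)) R where
  cost u v w :=
    match u, v, w with
    | some (i, _), none, some (j, _) => d i j
    | _, _, _ => 1
  symm u v w := by
    rcases u with _ | ⟨i, _⟩ <;> rcases v with _ | _ <;> rcases w with _ | ⟨j, _⟩ <;>
      first | rfl | exact hd i j

/-! ## Polynomial time

The model of computation is a small sequential programming language on finite binary trees whose
leaves are natural numbers in binary, with logarithmic cost: every basic operation is charged the
number of bits that it reads and writes. All data that occur in a computation of cost `t` have size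
at most `t`, and every basic operation is feasible on a Turing machine in time polynomial in its
charge, so polynomial time in this model is the usual polynomial time. -/

/-- The data of the programming language. -/
inductive Val : Type
  | num (n : ℕ)
  | pair (a b : Val)

/-- The size of a datum: one for every node, and the binary length for every number. -/
def Val.size : Val → ℕ
  | num n => 1 + Nat.size n
  | pair a b => 1 + a.size + b.size

/-- The basic operations. -/
inductive Prim : Type
  | id
  | const (v : Val)
  | fst
  | snd
  | isPair
  | add
  | sub
  | mul
  | div

/-- A binary arithmetical operation acts on a pair of numbers; other arguments give `0`. -/
def Val.arith (f : ℕ → ℕ → ℕ) : Val → Val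
  | pair (num a) (num b) => num (f a b)
  | _ => num 0

/-- The effect of a basic operation. Subtraction is truncated, division is rounded down. -/
def Prim.apply : Prim → Val → Val
  | id, x => x
  | const v, _ => v
  | fst, .pair a _ => a
  | fst, .num _ => .num 0
  | snd, .pair _ b => b
  | snd, .num _ => .num 0
  | isPair, .pair _ _ => .num 1
  | isPair, .num _ => .num 0
  | add, x => x.arith (· + ·)
  | sub, x => x.arith (· - ·)
  | mul, x => x.arith (· * ·)
  | div, x => x.arith (· / ·)

/-- Programs. A program transforms a datum; `loop c f` is `while c do f`, `oracle` replaces the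
current datum by the answer of the oracle to it. -/
inductive Code : Type
  | prim (p : Prim)
  | oracle
  | pair (f g : Code)
  | comp (f g : Code)
  | cond (c f g : Code)
  | loop (c f : Code)

/-- `Runs O c x y t`: with the oracle `O`, the program `c` on input `x` halts with output `y`
after computation of cost `t`. In tests, `num 0` means false and everything else means true. -/
inductive Runs (O : Val → Val) : Code → Val → Val → ℕ → Prop
  | prim (p : Prim) (x : Val) : Runs O (.prim p) x (p.apply x) (x.size + (p.apply x).size)
  | oracle (x : Val) : Runs O .oracle x (O x) (x.size + (O x).size)
  | pair {f g : Code} {x y z : Val} {s t : ℕ} (hf : Runs O f x y s) (hg : Runs O g x z t) :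
      Runs O (.pair f g) x (.pair y z) (s + t + 1)
  | comp {f g : Code} {x y z : Val} {s t : ℕ} (hg : Runs O g x y s) (hf : Runs O f y z t) :
      Runs O (.comp f g) x z (s + t + 1)
  | condTrue {c f g : Code} {x b y : Val} {s t : ℕ} (hc : Runs O c x b s) (hb : b ≠ .num 0)
      (hf : Runs O f x y t) : Runs O (.cond c f g) x y (s + t + 1)
  | condFalse {c f g : Code} {x y : Val} {s t : ℕ} (hc : Runs O c x (.num 0) s)
      (hg : Runs O g x y t) : Runs O (.cond c f g) x y (s + t + 1)
  | loopDone {c f : Code} {x : Val} {s : ℕ} (hc : Runs O c x (.num 0) s) :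
      Runs O (.loop c f) x x (s + 1)
  | loopStep {c f : Code} {x b x' y : Val} {s t r : ℕ} (hc : Runs O c x b s) (hb : b ≠ .num 0)
      (hf : Runs O f x x' t) (hl : Runs O (.loop c f) x' y r) :
      Runs O (.loop c f) x y (s + t + r + 1)

/-- A search problem: instances with an encoding, and the admissible answers to an instance. -/
structure Problem where
  Inst : Type
  enc : Inst → Val
  Sol : Inst → Val → Prop

/-- A decision problem. -/
structure DecisionProblem where
  Inst : Type
  enc : Inst → Val
  Yes : Inst → Prop

/-- A decision problem as a problem whose answers are `1` for yes and `0` for no. -/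
def DecisionProblem.toProblem (P : DecisionProblem) : Problem where
  Inst := P.Inst
  enc := P.enc
  Sol x y := (P.Yes x ∧ y = .num 1) ∨ (¬ P.Yes x ∧ y = .num 0)

/-- Polynomial-time Turing reducibility: one program solves every instance of `P` in polynomial
time with the help of any oracle that answers every instance of `Q` correctly. -/
def TuringReducible (P Q : Problem) : Prop :=
  ∃ (c : Code) (p : Polynomial ℕ), ∀ O : Val → Val, (∀ q, Q.Sol q (O (Q.enc q))) →
    ∀ x, ∃ y t, Runs O c (P.enc x) y t ∧ t ≤ p.eval (P.enc x).size ∧ P.Sol x y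

/-- Polynomial-time many-one (Karp) reducibility. The constant oracle is of no use. -/
def KarpReducible (P Q : DecisionProblem) : Prop :=
  ∃ (c : Code) (p : Polynomial ℕ), ∀ x, ∃ x' t,
    Runs (fun _ => .num 0) c (P.enc x) (Q.enc x') t ∧ t ≤ p.eval (P.enc x).size ∧
      (P.Yes x ↔ Q.Yes x')

/-! ## The computational problems -/

/-- A list as a datum, with `num 0` as the empty list. -/
def encList (l : List Val) : Val := l.foldr .pair (.num 0)

/-- A table `f 0, …, f (n - 1)` as a datum. -/
def encFn {n : ℕ} (f : Fin n → Val) : Val := encList (List.ofFn f)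

/-- A nonnegative rational number as numerator and denominator in lowest terms. -/
def encRat (q : ℚ≥0) : Val := .pair (.num q.num) (.num q.den)

/-- A list of vertices or of cities as a datum. -/
def encFins {n : ℕ} (l : List (Fin n)) : Val := encList (l.map fun i => .num i)

/-- A finite set of cities with symmetric nonnegative rational distances. -/
structure Cities where
  n : ℕ
  pos : 0 < n
  d : Fin n → Fin n → ℚ≥0
  symm : ∀ i j, d i j = d j i
  diag : ∀ i, d i i = 0

/-- The encoding of `Cities`: their number and the distance matrix. -/
def Cities.enc (X : Cities) : Val :=
  .pair (.num X.n) (encFn fun i => encFn fun j => encRat (X.d i j))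

/-- The tour `l` visits every city exactly once and has minimum length. -/
def Cities.IsOptimal (X : Cities) (l : List (Fin X.n)) : Prop :=
  IsTour Set.univ l ∧ ∀ l', IsTour Set.univ l' → tourLength X.d l ≤ tourLength X.d l'

/-- A graph, connected and of minimum degree at least two, with nonnegative rational turn costs. -/
structure CostGraph where
  n : ℕ
  G : SimpleGraph (Fin n)
  admissible : Admissible G
  α : TurnCosts (Fin n) ℚ≥0

open Classical in
/-- The encoding of a `CostGraph`: the number of vertices, the adjacency matrix, and for every
vertex `v` the matrix of the costs of the turns at `v` (with `0` where there is no turn). -/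
noncomputable def CostGraph.enc (X : CostGraph) : Val :=
  .pair (.num X.n) (.pair
    (encFn fun u => encFn fun v => .num (if X.G.Adj u v then 1 else 0))
    (encFn fun v => encFn fun u => encFn fun w =>
      encRat (if X.G.Adj v u ∧ X.G.Adj v w ∧ u ≠ w then X.α.cost u v w else 0)))

/-- The closed walk `W` is an exactly-double threading of minimum turn cost. -/
def CostGraph.IsOptimal (X : CostGraph) {u : Fin X.n} (W : X.G.Walk u u) : Prop :=
  IsExactlyDoubleThreading W ∧ ∀ (u' : Fin X.n) (W' : X.G.Walk u' u'),
    IsExactlyDoubleThreading W' → X.α.walkCost W ≤ X.α.walkCost W'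

/-- The travelling salesperson problem: is there a tour of length at most `C`? -/
def tspDecision : DecisionProblem where
  Inst := Cities × ℚ≥0
  enc x := .pair x.1.enc (encRat x.2)
  Yes x := ∃ l, IsTour Set.univ l ∧ tourLength x.1.d l ≤ x.2

/-- The optimization version: find a tour of minimum length. -/
def tspOptimization : Problem where
  Inst := Cities
  enc x := x.enc
  Sol x y := ∃ l, x.IsOptimal l ∧ y = encFins l

/-- Is there an exactly-double threading of turn cost at most `c`? -/
noncomputable def edtDecision : DecisionProblem where
  Inst := CostGraph × ℚ≥0
  enc x := .pair x.1.enc (encRat x.2)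
  Yes x := ∃ (u : Fin x.1.n) (W : x.1.G.Walk u u),
    IsExactlyDoubleThreading W ∧ x.1.α.walkCost W ≤ x.2

/-- Find an exactly-double threading of minimum turn cost, as the list `v₁, …, v_ℓ` of the vertices
that the closed walk traverses. -/
noncomputable def edtOptimization : Problem where
  Inst := CostGraph
  enc x := x.enc
  Sol x y := ∃ (u : Fin x.n) (W : x.G.Walk u u), x.IsOptimal W ∧ y = encFins W.support.tail

end Threading

namespace Threading

/-! ## Polynomial-time computable families

A family `y : ι → Val` is computed from the inputs `Γ.inp : ι → Val` of a context `Γ`; the cost is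
measured against `Γ.size`. Iterations are handled by enlarging the index set of the context. -/

/-! In an exactly-double threading every edge at `v` has degree two in the junction graph at `v`
(`multiDegree_junction`), and the ban on U-turns excludes loops. A connected loopless multigraph
with all degrees two is a Hamiltonian cycle (`exists_tour_of_multiDegree`). Grouping the turns by
their vertex splits the cost accordingly (`walkCost_eq_sum_tourLength`).

The converse is the substantial direction. Prescribed cycles at the vertices form a rotation system:
each edge is doubled into two strands, and each turn of the cycle at `v` joins two strands. Whether
the strands of an edge run parallel or cross is a free choice, the twist `ε`. For every `ε` the
strands close up to a family of closed walks, and up to direction each turn belongs to exactly one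
of them. If the two strands of an edge lie on different walks, twisting that edge merges these
walks, and nothing is ever separated (`IsTwist.twist`). So one pass over all edges puts both strands
of each edge on a common walk. Because each rotation is a single cycle and `G` is connected, only
one walk is left (`joined_of_adj`), and it makes every prescribed turn once
(`exists_threading_of_good`). Hence the tours at the vertices can be minimised independently
(`isLeast_threading`). If all turns away from one vertex cost the same, only the tour at that vertex
matters, which embeds the travelling salesperson problem (`exists_threading_le_iff`).

For the reduction between decision problems the minima at the vertices must be added, although the
oracle only answers yes or no. Scaled by a common denominator these minima are integers, and
bisection finds them with polynomially many queries (`PolyTime.bisect`,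
`exists_optimal_length_of_oracle`). For the optimization problems the merging argument is itself a
polynomial-time algorithm (`exists_threading_of_tables`), and a tour is recovered from a threading
of the star by recording the arms in the order in which they are entered
(`IsExactlyDoubleThreading.arm_tour`).

Running times are handled by closure properties of `PolyTime`. A loop enlarges the index set of the
family, so a bound for its body is automatically uniform over all passes. -/

theorem Runs.size_le {O : Val → Val} {c : Code} {x y : Val} {t : ℕ} (h : Runs O c x y t) :
    x.size ≤ t ∧ y.size ≤ t := by
  induction h <;> (try simp only [Val.size] at *) <;> omega

/-- `f` is bounded by a polynomial in `s`. -/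
def PolyBdd {ι : Type*} (s f : ι → ℕ) : Prop := ∃ p : Polynomial ℕ, ∀ i, f i ≤ p.eval (s i)

namespace PolyBdd

variable {ι κ : Type*} {s f g : ι → ℕ}

theorem const (s : ι → ℕ) (n : ℕ) : PolyBdd s fun _ => n := ⟨.C n, fun i => by simp⟩

theorem self (s : ι → ℕ) : PolyBdd s s := ⟨.X, fun i => by simp⟩

theorem add (hf : PolyBdd s f) (hg : PolyBdd s g) : PolyBdd s fun i => f i + g i := by
  obtain ⟨p, hp⟩ := hf
  obtain ⟨q, hq⟩ := hg
  exact ⟨p + q, fun i => by simpa using Nat.add_le_add (hp i) (hq i)⟩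

theorem mul (hf : PolyBdd s f) (hg : PolyBdd s g) : PolyBdd s fun i => f i * g i := by
  obtain ⟨p, hp⟩ := hf
  obtain ⟨q, hq⟩ := hg
  exact ⟨p * q, fun i => by simpa using Nat.mul_le_mul (hp i) (hq i)⟩

theorem mono (hg : PolyBdd s g) (h : ∀ i, f i ≤ g i) : PolyBdd s f := by
  obtain ⟨p, hp⟩ := hg
  exact ⟨p, fun i => (h i).trans (hp i)⟩

theorem reindex (hf : PolyBdd s f) (e : κ → ι) : PolyBdd (fun k => s (e k)) fun k => f (e k) := by
  obtain ⟨p, hp⟩ := hf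
  exact ⟨p, fun i => hp _⟩

end PolyBdd

/-- A family of inputs, with oracles and sizes. -/
structure Ctx (ι : Type*) where
  oracle : ι → Val → Val
  size : ι → ℕ
  inp : ι → Val

namespace Ctx

variable {ι κ : Type*}

/-- Change of the index set. -/
def reindex (Γ : Ctx ι) (e : κ → ι) : Ctx κ where
  oracle k := Γ.oracle (e k)
  size k := Γ.size (e k)
  inp k := Γ.inp (e k)

/-- A further input. -/
def push (Γ : Ctx ι) (z : ι → Val) : Ctx ι where
  oracle := Γ.oracle
  size := Γ.size
  inp i := .pair (z i) (Γ.inp i)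

/-- A further input that runs through the numbers below `n`. -/
def loop (Γ : Ctx ι) (n : ι → ℕ) : Ctx (Σ i, Fin (n i)) :=
  (Γ.reindex Sigma.fst).push fun q => .num q.2

end Ctx

/-- The family `y` is computed by one program from the inputs in time polynomial in the sizes. -/
def PolyTime {ι : Type*} (Γ : Ctx ι) (y : ι → Val) : Prop :=
  ∃ (c : Code) (T : ι → ℕ), PolyBdd Γ.size T ∧
    ∀ i, ∃ t ≤ T i, Runs (Γ.oracle i) c (Γ.inp i) (y i) t

namespace PolyTime

variable {ι κ : Type*} {Γ : Ctx ι} {y z : ι → Val}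

theorem congr (h : PolyTime Γ y) (e : ∀ i, y i = z i) : PolyTime Γ z := by
  rwa [← show y = z from funext e]

/-- Since reading and writing are charged, the output is no longer than the running time. Size
bounds for computed data therefore come for free. -/
theorem bdd (h : PolyTime Γ y) : PolyBdd Γ.size fun i => (y i).size := by
  obtain ⟨c, T, hT, h⟩ := h
  refine hT.mono fun i => ?_
  obtain ⟨t, ht, hr⟩ := h i
  exact hr.size_le.2.trans ht

theorem bdd_inp (h : PolyTime Γ y) : PolyBdd Γ.size fun i => (Γ.inp i).size := by
  obtain ⟨c, T, hT, h⟩ := h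
  refine hT.mono fun i => ?_
  obtain ⟨t, ht, hr⟩ := h i
  exact hr.size_le.1.trans ht

theorem reindex (h : PolyTime Γ y) (e : κ → ι) : PolyTime (Γ.reindex e) fun k => y (e k) := by
  obtain ⟨c, T, hT, h⟩ := h
  exact ⟨c, _, hT.reindex e, fun k => h (e k)⟩

theorem prim (p : Prim) (h₁ : PolyBdd Γ.size fun i => (Γ.inp i).size)
    (h₂ : PolyBdd Γ.size fun i => (p.apply (Γ.inp i)).size) :
    PolyTime Γ fun i => p.apply (Γ.inp i) :=
  ⟨.prim p, _, h₁.add h₂, fun _ => ⟨_, le_rfl, .prim _ _⟩⟩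

theorem inp (h : PolyBdd Γ.size fun i => (Γ.inp i).size) : PolyTime Γ Γ.inp := prim .id h h

theorem const' (h : PolyBdd Γ.size fun i => (Γ.inp i).size) (v : Val) : PolyTime Γ fun _ => v :=
  prim (.const v) h (.const _ v.size)

theorem const (h : PolyTime Γ y) (v : Val) : PolyTime Γ fun _ => v := const' h.bdd_inp v

/-- Composition: what can be computed from a computed intermediate result can be computed. -/
theorem trans {Δ : Ctx ι} (h : PolyTime Γ Δ.inp) (h' : PolyTime Δ y)
    (ho : Δ.oracle = Γ.oracle) (hs : Δ.size = Γ.size) : PolyTime Γ y := by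
  obtain ⟨c, T, hT, h⟩ := h
  obtain ⟨c', T', hT', h'⟩ := h'
  rw [hs] at hT'
  refine ⟨.comp c' c, _, (hT.add hT').add (.const _ 1), fun i => ?_⟩
  obtain ⟨t, ht, hr⟩ := h i
  obtain ⟨t', ht', hr'⟩ := h' i
  rw [ho] at hr'
  exact ⟨_, by gcongr, .comp hr hr'⟩

theorem pair (h : PolyTime Γ y) (h' : PolyTime Γ z) : PolyTime Γ fun i => .pair (y i) (z i) := by
  obtain ⟨c, T, hT, h⟩ := h
  obtain ⟨c', T', hT', h'⟩ := h'
  refine ⟨.pair c c', _, (hT.add hT').add (.const _ 1), fun i => ?_⟩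
  obtain ⟨t, ht, hr⟩ := h i
  obtain ⟨t', ht', hr'⟩ := h' i
  exact ⟨_, by gcongr, .pair hr hr'⟩

/-- The application of a basic operation to a computed datum. -/
theorem apply (h : PolyTime Γ y) (p : Prim) (hp : PolyBdd Γ.size fun i => (p.apply (y i)).size) :
    PolyTime Γ fun i => p.apply (y i) :=
  trans (Δ := { Γ with inp := y }) h (prim (Γ := { Γ with inp := y }) p h.bdd hp) rfl rfl

theorem fst (h : PolyTime Γ fun i => .pair (y i) (z i)) : PolyTime Γ y :=
  h.apply .fst (h.bdd.mono fun i => by simp only [Prim.apply, Val.size]; omega)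

theorem snd (h : PolyTime Γ fun i => .pair (y i) (z i)) : PolyTime Γ z :=
  h.apply .snd (h.bdd.mono fun i => by simp only [Prim.apply, Val.size]; omega)

theorem fst' (h : PolyTime Γ y) : PolyTime Γ fun i => Prim.fst.apply (y i) :=
  h.apply .fst (h.bdd.mono fun i => by
    cases y i <;> simp only [Prim.apply, Val.size, Nat.size_zero] <;> omega)

theorem snd' (h : PolyTime Γ y) : PolyTime Γ fun i => Prim.snd.apply (y i) :=
  h.apply .snd (h.bdd.mono fun i => by
    cases y i <;> simp only [Prim.apply, Val.size, Nat.size_zero] <;> omega)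

theorem isPair (h : PolyTime Γ y) : PolyTime Γ fun i => Prim.isPair.apply (y i) :=
  h.apply .isPair (PolyBdd.mono (.const _ 2) fun i => by cases y i <;> simp [Prim.apply, Val.size])

theorem oracle (h : PolyTime Γ y) (hb : PolyBdd Γ.size fun i => (Γ.oracle i (y i)).size) :
    PolyTime Γ fun i => Γ.oracle i (y i) :=
  trans (Δ := { Γ with inp := y }) h
    ⟨.oracle, _, h.bdd.add hb, fun _ => ⟨_, le_rfl, .oracle _⟩⟩ rfl rfl

/-- `top` and `weaken` are the variable rules for a context stored as nested pairs: the newest input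
is the first component, older computations run on the second. A bound on `z` is required because
`push` leaves the size measure unchanged. -/
theorem top (h : PolyTime Γ y) (hz : PolyBdd Γ.size fun i => (z i).size) : PolyTime (Γ.push z) z :=
  fst (Γ := Γ.push z) (y := z) (z := Γ.inp)
    (inp (((PolyBdd.const _ 1).add hz).add h.bdd_inp))

theorem weaken (h : PolyTime Γ y) (hz : PolyBdd Γ.size fun i => (z i).size) :
    PolyTime (Γ.push z) y :=
  trans (Δ := Γ) (snd (Γ := Γ.push z) (y := z) (z := Γ.inp)
    (inp (((PolyBdd.const _ 1).add hz).add h.bdd_inp))) h rfl rfl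

/-- A computed datum may be used as a further input. -/
theorem bind (hz : PolyTime Γ z) (h : PolyTime (Γ.push z) y) : PolyTime Γ y :=
  trans (Δ := Γ.push z) (hz.pair (inp hz.bdd_inp)) h rfl rfl

/-! ### Arithmetic and case distinctions -/

section Arith

variable {a b : ι → ℕ}

theorem size_num_le (h : PolyTime Γ fun i => .num (a i)) : PolyBdd Γ.size fun i => (a i).size :=
  h.bdd.mono fun i => by simp [Val.size]

theorem _root_.Nat.size_mono {m n : ℕ} (h : m ≤ n) : m.size ≤ n.size := Nat.size_le_size h

theorem _root_.Nat.size_add_le (m n : ℕ) : (m + n).size ≤ m.size + n.size + 1 := by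
  rw [Nat.size_le]
  have hm := Nat.lt_size_self m
  have hn := Nat.lt_size_self n
  have h1 : 2 ^ m.size ≤ 2 ^ (m.size + n.size) := Nat.pow_le_pow_right (by norm_num) (by omega)
  have h2 : 2 ^ n.size ≤ 2 ^ (m.size + n.size) := Nat.pow_le_pow_right (by norm_num) (by omega)
  rw [pow_succ]
  omega

theorem _root_.Nat.size_mul_le (m n : ℕ) : (m * n).size ≤ m.size + n.size := by
  rw [Nat.size_le, pow_add]
  exact Nat.mul_lt_mul'' (Nat.lt_size_self m) (Nat.lt_size_self n)

theorem _root_.Nat.size_le_self (n : ℕ) : n.size ≤ n := by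
  rw [Nat.size_le]; exact Nat.lt_two_pow_self

theorem add (ha : PolyTime Γ fun i => .num (a i)) (hb : PolyTime Γ fun i => .num (b i)) :
    PolyTime Γ fun i => .num (a i + b i) :=
  (ha.pair hb).apply .add (((ha.size_num_le.add hb.size_num_le).add (.const _ 2)).mono fun i => by
    have := Nat.size_add_le (a i) (b i)
    simp only [Prim.apply, Val.arith, Val.size]; omega)

theorem mul (ha : PolyTime Γ fun i => .num (a i)) (hb : PolyTime Γ fun i => .num (b i)) :
    PolyTime Γ fun i => .num (a i * b i) :=
  (ha.pair hb).apply .mul (((ha.size_num_le.add hb.size_num_le).add (.const _ 1)).mono fun i => by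
    have := Nat.size_mul_le (a i) (b i)
    simp only [Prim.apply, Val.arith, Val.size]; omega)

theorem sub (ha : PolyTime Γ fun i => .num (a i)) (hb : PolyTime Γ fun i => .num (b i)) :
    PolyTime Γ fun i => .num (a i - b i) :=
  (ha.pair hb).apply .sub ((ha.size_num_le.add (.const _ 1)).mono fun i => by
    have := Nat.size_mono (Nat.sub_le (a i) (b i))
    simp only [Prim.apply, Val.arith, Val.size]; omega)

theorem div (ha : PolyTime Γ fun i => .num (a i)) (hb : PolyTime Γ fun i => .num (b i)) :
    PolyTime Γ fun i => .num (a i / b i) :=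
  (ha.pair hb).apply .div ((ha.size_num_le.add (.const _ 1)).mono fun i => by
    have := Nat.size_mono (Nat.div_le_self (a i) (b i))
    simp only [Prim.apply, Val.arith, Val.size]; omega)

theorem addC (ha : PolyTime Γ fun i => .num (a i)) (n : ℕ) : PolyTime Γ fun i => .num (a i + n) :=
  ha.add (ha.const _)

theorem subC (ha : PolyTime Γ fun i => .num (a i)) (n : ℕ) : PolyTime Γ fun i => .num (a i - n) :=
  ha.sub (ha.const _)

theorem mulC (ha : PolyTime Γ fun i => .num (a i)) (n : ℕ) : PolyTime Γ fun i => .num (n * a i) :=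
  (ha.const _).mul ha

theorem divC (ha : PolyTime Γ fun i => .num (a i)) (n : ℕ) : PolyTime Γ fun i => .num (a i / n) :=
  ha.div (ha.const _)

theorem mod (ha : PolyTime Γ fun i => .num (a i)) (hb : PolyTime Γ fun i => .num (b i)) :
    PolyTime Γ fun i => .num (a i % b i) :=
  (ha.sub (hb.mul (ha.div hb))).congr fun i => by rw [Nat.mod_eq_sub_mul_div]

theorem modC (ha : PolyTime Γ fun i => .num (a i)) (n : ℕ) : PolyTime Γ fun i => .num (a i % n) :=
  ha.mod (ha.const _)

open Classical in
/-- The condition `c` can be decided. -/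
def _root_.Threading.PolyDec {ι : Type*} (Γ : Ctx ι) (c : ι → Prop) : Prop :=
  PolyTime Γ fun i => .num (if c i then 1 else 0)

theorem ite {c : ι → Prop} [DecidablePred c] (hc : PolyDec Γ c) (hy : PolyTime Γ y)
    (hz : PolyTime Γ z) : PolyTime Γ fun i => if c i then y i else z i := by
  obtain ⟨k, T, hT, h⟩ := hc
  obtain ⟨k₁, T₁, hT₁, h₁⟩ := hy
  obtain ⟨k₂, T₂, hT₂, h₂⟩ := hz
  refine ⟨.cond k k₁ k₂, _, ((hT.add hT₁).add hT₂).add (.const _ 1), fun i => ?_⟩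
  obtain ⟨t, ht, hr⟩ := h i
  obtain ⟨t₁, ht₁, hr₁⟩ := h₁ i
  obtain ⟨t₂, ht₂, hr₂⟩ := h₂ i
  by_cases hi : c i
  · simp only [if_pos hi] at hr ⊢
    exact ⟨_, by omega, .condTrue hr (by simp) hr₁⟩
  · simp only [if_neg hi] at hr ⊢
    exact ⟨_, by omega, .condFalse hr hr₂⟩

theorem ite_num {c : ι → Prop} [DecidablePred c] (hc : PolyDec Γ c)
    (ha : PolyTime Γ fun i => .num (a i)) (hb : PolyTime Γ fun i => .num (b i)) :
    PolyTime Γ fun i => .num (if c i then a i else b i) :=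
  (PolyTime.ite hc ha hb).congr fun i => by split_ifs <;> rfl

end Arith

end PolyTime

namespace PolyDec

open PolyTime

variable {ι κ : Type*} {Γ : Ctx ι} {c d : ι → Prop} {a b : ι → ℕ} {y z : ι → Val}

theorem congr (h : PolyDec Γ c) (e : ∀ i, c i ↔ d i) : PolyDec Γ d := by
  rwa [← show c = d from funext fun i => propext (e i)]

theorem reindex (h : PolyDec Γ c) (e : κ → ι) : PolyDec (Γ.reindex e) fun k => c (e k) :=
  PolyTime.reindex h e

theorem weaken (h : PolyDec Γ c) (hz : PolyBdd Γ.size fun i => (z i).size) :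
    PolyDec (Γ.push z) c :=
  PolyTime.weaken h hz

theorem num [DecidablePred c] (h : PolyDec Γ c) : PolyTime Γ fun i => .num (if c i then 1 else 0) :=
  PolyTime.congr h fun i => by congr

theorem of_num [DecidablePred c] (h : PolyTime Γ fun i => .num (if c i then 1 else 0)) :
    PolyDec Γ c :=
  PolyTime.congr h fun i => by congr

theorem not (h : PolyDec Γ c) : PolyDec Γ fun i => ¬ c i := by
  classical
  exact of_num (((PolyTime.const h (.num 1)).sub h.num).congr fun i => by
    by_cases hi : c i <;> simp [hi])

theorem and (h : PolyDec Γ c) (h' : PolyDec Γ d) : PolyDec Γ fun i => c i ∧ d i := by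
  classical
  exact of_num ((h.num.mul h'.num).congr fun i => by
    by_cases hi : c i <;> by_cases hj : d i <;> simp [hi, hj])

theorem or (h : PolyDec Γ c) (h' : PolyDec Γ d) : PolyDec Γ fun i => c i ∨ d i :=
  (h.not.and h'.not).not.congr fun i => by tauto

/-- Tests for the number `0`. -/
theorem ne_zero (h : PolyTime Γ y) : PolyDec Γ fun i => y i ≠ .num 0 := by
  classical
  obtain ⟨k, T, hT, h⟩ := h
  refine of_num ⟨.cond k (.prim (.const (.num 1))) (.prim (.const (.num 0))), _,
    (hT.add hT).add (.const _ 4), fun i => ?_⟩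
  obtain ⟨t, ht, hr⟩ := h i
  have := hr.size_le.1
  by_cases hi : y i = .num 0
  · rw [hi] at hr
    simp only [hi, ne_eq, not_true_eq_false, if_false]
    exact ⟨_, by simp [Prim.apply, Val.size]; omega, .condFalse hr (.prim _ _)⟩
  · simp only [ne_eq, hi, not_false_eq_true, if_true]
    exact ⟨_, by simp [Prim.apply, Val.size]; omega, .condTrue hr hi (.prim _ _)⟩

/-- Truncated subtraction turns the comparison into a test for zero. -/
theorem lt (ha : PolyTime Γ fun i => .num (a i)) (hb : PolyTime Γ fun i => .num (b i)) :
    PolyDec Γ fun i => a i < b i :=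
  (ne_zero (hb.sub ha)).congr fun i => by simp [Nat.sub_eq_zero_iff_le]

theorem le (ha : PolyTime Γ fun i => .num (a i)) (hb : PolyTime Γ fun i => .num (b i)) :
    PolyDec Γ fun i => a i ≤ b i :=
  (lt hb ha).not.congr fun i => by simp

theorem eq (ha : PolyTime Γ fun i => .num (a i)) (hb : PolyTime Γ fun i => .num (b i)) :
    PolyDec Γ fun i => a i = b i :=
  ((le ha hb).and (le hb ha)).congr fun i => by omega

theorem eqC (ha : PolyTime Γ fun i => .num (a i)) (n : ℕ) : PolyDec Γ fun i => a i = n :=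
  eq ha (ha.const _)

end PolyDec

namespace PolyTime

variable {ι κ : Type*} {Γ : Ctx ι} {y z : ι → Val}

/-! ### Loops -/

/-- A loop that runs through the states `st i 0, …, st i (n i)`. -/
theorem whileLoop {n : ι → ℕ} {st tst : ι → ℕ → Val} (hn : PolyBdd Γ.size n)
    (h0 : PolyTime Γ fun i => st i 0)
    (ht : PolyTime ((Γ.reindex (Sigma.fst : (Σ i, Fin (n i + 1)) → ι)).push
      fun q => st q.1 q.2) fun q => tst q.1 q.2)
    (hb : PolyTime ((Γ.reindex (Sigma.fst : (Σ i, Fin (n i)) → ι)).push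
      fun q => st q.1 q.2) fun q => st q.1 (q.2 + 1))
    (htrue : ∀ i, ∀ k < n i, tst i k ≠ .num 0) (hfalse : ∀ i, tst i (n i) = .num 0) :
    PolyTime Γ fun i => st i (n i) := by
  obtain ⟨c₀, T₀, hT₀, h0⟩ := h0
  obtain ⟨ct, Tt, ⟨pt, hpt⟩, ht⟩ := ht
  obtain ⟨cb, Tb, ⟨pb, hpb⟩, hb⟩ := hb
  -- Induction on the number `j` of passes still to be made. A pass costs one test, the body, and
  -- the copying of the inputs by `snd`. The copying costs at most twice as much as the body, which
  -- has the same pair as its input; hence the factor 3.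
  have key : ∀ i, ∀ j ≤ n i, ∃ t ≤ j * (pt.eval (Γ.size i) + 3 * pb.eval (Γ.size i) + 2) +
      pt.eval (Γ.size i) + 1, Runs (Γ.oracle i) (.loop ct (.pair cb (.prim .snd)))
        (.pair (st i (n i - j)) (Γ.inp i)) (.pair (st i (n i)) (Γ.inp i)) t := by
    intro i j
    induction j with
    | zero =>
      intro _
      obtain ⟨t, htt, hr⟩ := ht ⟨i, ⟨n i, by omega⟩⟩
      have := hpt ⟨i, ⟨n i, by omega⟩⟩
      simp only [Ctx.push, Ctx.reindex] at hr this
      rw [hfalse] at hr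
      exact ⟨_, by omega, .loopDone hr⟩
    | succ j ih =>
      intro hj
      obtain ⟨r, hr, hl⟩ := ih (by omega)
      obtain ⟨t, htt, hrt⟩ := ht ⟨i, ⟨n i - (j + 1), by omega⟩⟩
      obtain ⟨s, hss, hrs⟩ := hb ⟨i, ⟨n i - (j + 1), by omega⟩⟩
      have h1 := hpt ⟨i, ⟨n i - (j + 1), by omega⟩⟩
      have h2 := hpb ⟨i, ⟨n i - (j + 1), by omega⟩⟩
      simp only [Ctx.push, Ctx.reindex] at hrt hrs h1 h2
      rw [show n i - (j + 1) + 1 = n i - j by omega] at hrs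
      have hsz := hrs.size_le.1
      simp only [Val.size] at hsz
      refine ⟨_, ?_, .loopStep hrt (htrue i _ (by omega))
        (.pair hrs (.prim .snd _)) hl⟩
      simp only [Prim.apply, Val.size]
      rw [add_mul]
      omega
  refine ⟨.comp (.prim .fst) (.comp (.loop ct (.pair cb (.prim .snd))) (.pair c₀ (.prim .id))), _,
    ((((hn.mul (PolyBdd.add (PolyBdd.add ⟨pt, fun _ => le_rfl⟩
      (PolyBdd.mul (.const _ 3) ⟨pb, fun _ => le_rfl⟩)) (.const _ 2))).add
      ⟨pt, fun _ => le_rfl⟩).mul (.const _ 3)).add (hT₀.mul (.const _ 3))).add (.const _ 6),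
    fun i => ?_⟩
  obtain ⟨r, hr, hl⟩ := key i (n i) le_rfl
  obtain ⟨t, htt, hrt⟩ := h0 i
  rw [Nat.sub_self] at hl
  have h1 := hrt.size_le.1
  have h2 := hl.size_le.2
  refine ⟨_, ?_, .comp (.comp (.pair hrt (.prim .id _)) hl) (.prim .fst _)⟩
  simp only [Prim.apply, Val.size] at h2 ⊢
  omega

theorem loopVar {n : ι → ℕ} (hn : PolyBdd Γ.size n) (h : PolyTime Γ y) :
    PolyTime (Γ.loop n) fun q => .num q.2 :=
  (h.reindex Sigma.fst).top (((hn.reindex Sigma.fst).add (.const _ 1)).mono fun q => by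
    have := Nat.size_le_self (q.2 : ℕ)
    simp only [Val.size]; omega)

theorem inLoop {n : ι → ℕ} (hn : PolyBdd Γ.size n) (h : PolyTime Γ y) :
    PolyTime (Γ.loop n) fun q => y q.1 :=
  (h.reindex Sigma.fst).weaken (loopVar hn h).bdd

/-- Iteration a computed number of times. -/
theorem iter {n : ι → ℕ} {st : ι → ℕ → Val} (hn : PolyTime Γ fun i => .num (n i))
    (hnb : PolyBdd Γ.size n) (h0 : PolyTime Γ fun i => st i 0)
    (hb : PolyTime ((Γ.loop n).push fun q => st q.1 q.2) fun q => st q.1 (q.2 + 1)) :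
    PolyTime Γ fun i => st i (n i) := by
  -- Each state is the initial one or the output of a single pass, and the cost of a pass is
  -- measured against `Γ.size` rather than against the previous state. So the bound does not
  -- compound with the number of passes.
  have hst : ∃ p : Polynomial ℕ, ∀ i, ∀ k ≤ n i, (st i k).size ≤ p.eval (Γ.size i) := by
    obtain ⟨p, hp⟩ := h0.bdd
    obtain ⟨q, hq⟩ := hb.bdd
    refine ⟨p + q, fun i k hk => ?_⟩
    rw [Polynomial.eval_add]
    cases k with
    | zero => exact (hp i).trans (Nat.le_add_right _ _)
    | succ k => exact (hq ⟨i, ⟨k, hk⟩⟩).trans (Nat.le_add_left _ _)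
  obtain ⟨p, hp⟩ := hst
  -- The loop carries a counter `k`, and the truncated difference `n i - k` serves as the test.
  have hS : PolyTime Γ fun i => Val.pair (.num (n i)) (st i (n i)) := by
    refine PolyTime.whileLoop (n := n) (st := fun i k => .pair (.num k) (st i k))
      (tst := fun i k => .num (n i - k)) hnb ((h0.const _).pair h0) ?_ ?_ ?_ ?_
    · have hz : PolyBdd (fun q : Σ i, Fin (n i + 1) => Γ.size q.1)
          fun q => (Val.pair (.num q.2) (st q.1 q.2)).size :=
        (((hnb.reindex Sigma.fst).add ⟨p, fun _ => le_rfl⟩).add (.const _ 2)).mono fun q => by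
          have h1 := Nat.size_le_self (q.2 : ℕ)
          have h2 := hp q.1 q.2 (by omega)
          have h3 := q.2.2
          simp only [Val.size]; omega
      exact ((hn.reindex _).weaken hz).sub ((hn.reindex _).top hz).fst
    · have hz : PolyBdd (fun q : Σ i, Fin (n i) => Γ.size q.1)
          fun q => (Val.pair (.num q.2) (st q.1 q.2)).size :=
        (((hnb.reindex Sigma.fst).add ⟨p, fun _ => le_rfl⟩).add (.const _ 2)).mono fun q => by
          have h1 := Nat.size_le_self (q.2 : ℕ)
          have h2 := hp q.1 q.2 (by omega)
          have h3 := q.2.2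
          simp only [Val.size]; omega
      have ht := (hn.reindex Sigma.fst).top hz
      have hi := (PolyTime.inp hn.bdd_inp).reindex (Sigma.fst : (Σ i, Fin (n i)) → ι)
      exact (ht.fst.addC 1).pair (trans (Δ := (Γ.loop n).push fun q => st q.1 q.2)
        (ht.snd.pair (ht.fst.pair (hi.weaken hz))) hb rfl rfl)
    · intro i k hk
      simp only [ne_eq, Val.num.injEq]
      omega
    · simp
  exact hS.snd

theorem _root_.Threading.length_le_size_encList (l : List Val) : l.length ≤ (encList l).size := by
  induction l with
  | nil => simp [encList]
  | cons a l ih => simp only [encList, List.foldr_cons, Val.size, List.length_cons] at *; omega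

theorem _root_.Threading.size_encList_le {l : List Val} {B : ℕ} (h : ∀ v ∈ l, v.size ≤ B) :
    (encList l).size ≤ l.length * (B + 1) + 1 := by
  induction l with
  | nil => simp [encList, Val.size]
  | cons a l ih =>
    have h1 := h a (by simp)
    have h2 := ih fun v hv => h v (by simp [hv])
    simp only [encList, List.foldr_cons, Val.size, List.length_cons, add_mul] at *
    omega

theorem length_bdd {L : ι → List Val} (h : PolyTime Γ fun i => encList (L i)) :
    PolyBdd Γ.size fun i => (L i).length :=
  h.bdd.mono fun _ => length_le_size_encList _

theorem encFn_bdd {n : ι → ℕ} {f : ∀ i, Fin (n i) → Val} (h : PolyTime Γ fun i => encFn (f i)) :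
    PolyBdd Γ.size n :=
  (length_bdd h).mono fun i => by simp

theorem drop {L : ι → List Val} {k : ι → ℕ} (h : PolyTime Γ fun i => encList (L i))
    (hk : PolyTime Γ fun i => .num (k i)) (hkl : ∀ i, k i ≤ (L i).length) :
    PolyTime Γ fun i => encList ((L i).drop (k i)) := by
  have hkb := h.length_bdd.mono hkl
  refine PolyTime.iter (st := fun i j => encList ((L i).drop j)) hk hkb (by simpa using h) ?_
  have hz : PolyBdd (Γ.loop k).size fun q => (encList ((L q.1).drop q.2)).size := by
    refine (h.inLoop hkb).bdd.mono fun q => ?_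
    generalize L q.1 = l
    generalize (q.2 : ℕ) = m
    induction m generalizing l with
    | zero => simp
    | succ m ih =>
      cases l with
      | nil => simp
      | cons a l => have := ih l; simp only [encList, List.drop_succ_cons, List.foldr_cons, Val.size] at *; omega
  refine ((h.inLoop hkb).top hz).snd'.congr fun q => ?_
  have hq : (q.2 : ℕ) < (L q.1).length := q.2.2.trans_le (hkl _)
  rw [List.drop_eq_getElem_cons hq]
  rfl

/-- The lookup in a list. -/
theorem get {L : ι → List Val} {k : ι → ℕ} (h : PolyTime Γ fun i => encList (L i))
    (hk : PolyTime Γ fun i => .num (k i)) (hkl : ∀ i, k i < (L i).length) :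
    PolyTime Γ fun i => (L i)[k i]'(hkl i) :=
  (h.drop hk fun i => (hkl i).le).fst'.congr fun i => by
    rw [List.drop_eq_getElem_cons (hkl i)]
    rfl

/-- The lookup in a table. -/
theorem app {n : ι → ℕ} {f : ∀ i, Fin (n i) → Val} {k : ∀ i, Fin (n i)}
    (h : PolyTime Γ fun i => encFn (f i)) (hk : PolyTime Γ fun i => .num (k i)) :
    PolyTime Γ fun i => f i (k i) :=
  (PolyTime.get h hk fun i => by simp).congr fun i => by simp

/-- The length of a list. -/
theorem length {L : ι → List Val} (h : PolyTime Γ fun i => encList (L i)) :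
    PolyTime Γ fun i => .num (L i).length := by
  have hb := h.length_bdd
  have hz : ∀ m : ι → ℕ, (PolyBdd Γ.size m) →
      PolyBdd (Γ.reindex (Sigma.fst : (Σ i, Fin (m i)) → ι)).size
      fun q => (Val.pair (encList ((L q.1).drop q.2)) (.num q.2)).size := by
    intro m hm
    refine ((((h.bdd.mul (.const _ 1)).reindex Sigma.fst).add (hm.reindex Sigma.fst)).add
      (.const _ 2)).mono fun q => ?_
    have h1 := Nat.size_le_self (q.2 : ℕ)
    have h2 := q.2.2
    have h3 : (encList ((L q.1).drop q.2)).size ≤ (encList (L q.1)).size := by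
      generalize L q.1 = l
      generalize (q.2 : ℕ) = m
      induction m generalizing l with
      | zero => simp
      | succ m ih =>
        cases l with
        | nil => simp
        | cons a l =>
          have := ih l
          simp only [encList, List.drop_succ_cons, List.foldr_cons, Val.size] at *
          omega
    simp only [Val.size]; omega
  -- The test `isPair` detects the end, because the empty list is encoded as a number.
  refine (PolyTime.whileLoop (n := fun i => (L i).length)
    (st := fun i j => .pair (encList ((L i).drop j)) (.num j))
    (tst := fun i j => Prim.isPair.apply (encList ((L i).drop j))) hb
    (by simpa using h.pair (h.const _)) ?_ ?_ ?_ ?_).snd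
  · exact ((h.reindex _).top (hz _ (hb.add (.const _ 1)))).fst.isPair
  · have ht := (h.reindex Sigma.fst).top (hz _ hb)
    refine (ht.fst.snd'.pair (ht.snd.addC 1)).congr fun q => ?_
    have hq : (q.2 : ℕ) < (L q.1).length := q.2.2
    rw [List.drop_eq_getElem_cons hq]
    rfl
  · intro i k hk
    rw [List.drop_eq_getElem_cons hk]
    exact fun h => by cases h
  · simp [encList, Prim.apply]

/-- The list of the values of a family at the indices that satisfy a condition. -/
theorem collect {n : ι → ℕ} {g : ∀ i, Fin (n i) → Val} {c : ∀ i, Fin (n i) → Bool}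
    (hn : PolyTime Γ fun i => .num (n i)) (hnb : PolyBdd Γ.size n)
    (hc : PolyDec (Γ.loop n) fun q => c q.1 q.2) (hg : PolyTime (Γ.loop n) fun q => g q.1 q.2) :
    PolyTime Γ fun i => encList (((List.finRange (n i)).filter (c i)).map (g i)) := by
  -- Consing works at the front, so the list is built from its end: after `j` passes the last `j`
  -- indices have been treated.
  have key := PolyTime.iter (Γ := Γ) (n := n)
    (st := fun i j => encList ((((List.finRange (n i)).drop (n i - j)).filter (c i)).map (g i)))
    hn hnb ((hn.const (.num 0)).congr fun i => by
      rw [Nat.sub_zero, List.drop_of_length_le (by simp)]; rfl) ?_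
  · exact key.congr fun i => by simp
  obtain ⟨p, hp⟩ := hg.bdd
  have hz : PolyBdd (Γ.loop n).size fun q => (encList ((((List.finRange (n q.1)).drop
      (n q.1 - q.2)).filter (c q.1)).map (g q.1))).size := by
    refine (((hnb.reindex (Sigma.fst : (Σ i, Fin (n i)) → ι)).mul
      (PolyBdd.add (s := fun q : Σ i, Fin (n i) => Γ.size q.1) ⟨p, fun q => le_rfl⟩
        (.const _ 1))).add (.const _ 1)).mono fun q => ?_
    refine (size_encList_le (B := p.eval (Γ.size q.1)) ?_).trans ?_
    · simp only [List.mem_map]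
      rintro v ⟨a, -, rfl⟩
      exact hp ⟨q.1, a⟩
    · gcongr
      rw [List.length_map]
      exact (List.length_filter_le _ _).trans (by simp)
  let k : ∀ q : Σ i, Fin (n i), Fin (n q.1) := fun q => ⟨n q.1 - 1 - q.2, by have := q.2.2; omega⟩
  have hkk : PolyTime (Γ.loop n) fun q => .num (k q) :=
    ((hn.inLoop hnb).subC 1).sub (loopVar hnb hn)
  -- Substitution of the computed index `k q` for the loop variable: the old loop context, reindexed
  -- along `k`, has as its input exactly the pair of that index with the inputs of `Γ`.
  have hkc : PolyDec (Γ.loop n) fun q => c q.1 (k q) := by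
    have h2 : PolyDec ((Γ.loop n).reindex fun q => (⟨q.1, k q⟩ : Σ i, Fin (n i)))
      fun q => c q.1 (k q) := hc.reindex fun q => ⟨q.1, k q⟩
    refine hkk.bind ?_
    exact trans (Δ := (Γ.loop n).reindex fun q => ⟨q.1, k q⟩)
      ((hkk.top hkk.bdd).pair (((inp hn.bdd_inp).inLoop hnb).weaken hkk.bdd)) h2 rfl rfl
  have hkg : PolyTime (Γ.loop n) fun q => g q.1 (k q) := by
    refine hkk.bind ?_
    exact trans (Δ := (Γ.loop n).reindex fun q => ⟨q.1, k q⟩)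
      ((hkk.top hkk.bdd).pair (((inp hn.bdd_inp).inLoop hnb).weaken hkk.bdd))
      (hg.reindex fun q => ⟨q.1, k q⟩) rfl rfl
  have hst := (hn.inLoop hnb).top hz
  refine (PolyTime.ite (hkc.weaken hz) ((hkg.weaken hz).pair hst) hst).congr fun q => ?_
  have hq := q.2.2
  have h1 : (List.finRange (n q.1)).drop (n q.1 - (q.2 + 1)) =
      k q :: (List.finRange (n q.1)).drop (n q.1 - q.2) := by
    rw [List.drop_eq_getElem_cons (by simp; omega)]
    congr 1
    · simp only [List.getElem_finRange, k]
      ext; simp; omega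
    · congr 1; omega
  rw [h1]
  by_cases hcq : c q.1 (k q)
  · rw [List.filter_cons_of_pos hcq, if_pos hcq]; rfl
  · rw [List.filter_cons_of_neg hcq, if_neg hcq]

/-- A table. -/
theorem tabulate {n : ι → ℕ} {g : ∀ i, Fin (n i) → Val}
    (hn : PolyTime Γ fun i => .num (n i)) (hnb : PolyBdd Γ.size n)
    (hg : PolyTime (Γ.loop n) fun q => g q.1 q.2) : PolyTime Γ fun i => encFn (g i) :=
  (collect (c := fun _ _ => true) hn hnb (PolyDec.of_num ((hg.const (.num 1)).congr (by simp)))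
    hg).congr fun i => by simp [encFn, List.ofFn_eq_map]

theorem sum {n : ι → ℕ} {g : ∀ i, Fin (n i) → ℕ}
    (hn : PolyTime Γ fun i => .num (n i)) (hnb : PolyBdd Γ.size n)
    (hg : PolyTime (Γ.loop n) fun q => .num (g q.1 q.2)) :
    PolyTime Γ fun i => .num (∑ k, g i k) := by
  have key := PolyTime.iter (Γ := Γ) (n := n)
    (st := fun i j => .num (∑ k : Fin (n i), if (k : ℕ) < j then g i k else 0))
    hn hnb ((hn.const (.num 0)).congr fun i => by simp) ?_
  · exact key.congr fun i => by simp
  have hz : PolyBdd (Γ.loop n).size fun q =>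
      (Val.num (∑ k : Fin (n q.1), if (k : ℕ) < q.2 then g q.1 k else 0)).size := by
    obtain ⟨p, hp⟩ := hg.bdd
    refine (((hnb.reindex (Sigma.fst : (Σ i, Fin (n i)) → ι)).add
      ⟨p, fun q => le_rfl⟩).add (.const _ 1)).mono fun q => ?_
    simp only [Val.size]
    -- With `n` summands of at most `p` bits the sum is at most `n * 2 ^ p`, so it has at most `n +
    -- p` bits.
    have hle : (∑ k : Fin (n q.1), if (k : ℕ) < q.2 then g q.1 k else 0) ≤
        n q.1 * 2 ^ p.eval (Γ.size q.1) := by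
      calc _ ≤ ∑ k : Fin (n q.1), 2 ^ p.eval (Γ.size q.1) := Finset.sum_le_sum fun k _ => by
            split_ifs
            · have := hp ⟨q.1, k⟩
              simp only [Val.size] at this
              exact (Nat.lt_size_self _).le.trans
                (Nat.pow_le_pow_right (by norm_num) ((Nat.le_add_left _ _).trans this))
            · positivity
        _ = _ := by simp
    have h1 : (∑ k : Fin (n q.1), if (k : ℕ) < q.2 then g q.1 k else 0).size ≤
        n q.1 + p.eval (Γ.size q.1) := by
      rw [Nat.size_le, pow_add]
      exact hle.trans_lt (Nat.mul_lt_mul_of_pos_right Nat.lt_two_pow_self (by positivity))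
    omega
  refine ((hg.top hz).add (hg.weaken hz)).congr fun q => ?_
  have e : ∀ k : Fin (n q.1), (if (k : ℕ) < q.2 + 1 then g q.1 k else 0) =
      (if (k : ℕ) < q.2 then g q.1 k else 0) + if k = q.2 then g q.1 k else 0 := fun k => by
    have : k = q.2 ↔ (k : ℕ) = q.2 := Fin.ext_iff
    split_ifs <;> omega
  simp only [e, Finset.sum_add_distrib]
  simp

/-- Binary lengths add up under multiplication, so a product of polynomially many factors remains of
polynomial length. This makes it feasible to use the product of all denominators as a common
denominator. -/
theorem prod {n : ι → ℕ} {g : ∀ i, Fin (n i) → ℕ}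
    (hn : PolyTime Γ fun i => .num (n i)) (hnb : PolyBdd Γ.size n)
    (hg : PolyTime (Γ.loop n) fun q => .num (g q.1 q.2)) :
    PolyTime Γ fun i => .num (∏ k, g i k) := by
  have key := PolyTime.iter (Γ := Γ) (n := n)
    (st := fun i j => .num (∏ k : Fin (n i), if (k : ℕ) < j then g i k else 1))
    hn hnb ((hn.const (.num 1)).congr fun i => by simp) ?_
  · exact key.congr fun i => by simp
  have hz : PolyBdd (Γ.loop n).size fun q =>
      (Val.num (∏ k : Fin (n q.1), if (k : ℕ) < q.2 then g q.1 k else 1)).size := by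
    obtain ⟨p, hp⟩ := hg.bdd
    refine (((hnb.reindex (Sigma.fst : (Σ i, Fin (n i)) → ι)).mul
      ⟨p, fun q => le_rfl⟩).add (.const _ 2)).mono fun q => ?_
    simp only [Val.size]
    have hle : (∏ k : Fin (n q.1), if (k : ℕ) < q.2 then g q.1 k else 1) ≤
        2 ^ (n q.1 * p.eval (Γ.size q.1)) := by
      calc _ ≤ ∏ k : Fin (n q.1), 2 ^ p.eval (Γ.size q.1) := Finset.prod_le_prod' fun k _ => by
            split_ifs
            · have := hp ⟨q.1, k⟩
              simp only [Val.size] at this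
              exact (Nat.lt_size_self _).le.trans
                (Nat.pow_le_pow_right (by norm_num) ((Nat.le_add_left _ _).trans this))
            · exact Nat.one_le_two_pow
        _ = _ := by simp [mul_comm (n q.1), pow_mul]
    have h1 : (∏ k : Fin (n q.1), if (k : ℕ) < q.2 then g q.1 k else 1).size ≤
        n q.1 * p.eval (Γ.size q.1) + 1 := by
      rw [Nat.size_le, pow_succ]
      have : 0 < 2 ^ (n q.1 * p.eval (Γ.size q.1)) := by positivity
      omega
    omega
  refine ((hg.top hz).mul (hg.weaken hz)).congr fun q => ?_
  have e : ∀ k : Fin (n q.1), (if (k : ℕ) < q.2 + 1 then g q.1 k else 1) =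
      (if (k : ℕ) < q.2 then g q.1 k else 1) * if k = q.2 then g q.1 k else 1 := fun k => by
    have : k = q.2 ↔ (k : ℕ) = q.2 := Fin.ext_iff
    split_ifs <;> omega
  simp only [e, Finset.prod_mul_distrib]
  simp

/-- The binary length of a number and the corresponding power of two. -/
theorem natSize {a : ι → ℕ} (ha : PolyTime Γ fun i => .num (a i)) :
    PolyTime Γ fun i => .pair (.num (a i).size) (.num (2 ^ (a i).size)) := by
  have hb := ha.size_num_le
  have hz : ∀ m : ι → ℕ, (PolyBdd Γ.size m) →
      PolyBdd (Γ.reindex (Sigma.fst : (Σ i, Fin (m i)) → ι)).size fun q =>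
        (Val.pair (.num (a q.1 / 2 ^ (q.2 : ℕ))) (.pair (.num q.2) (.num (2 ^ (q.2 : ℕ))))).size := by
    intro m hm
    refine (((hb.reindex Sigma.fst).add ((hm.mul (.const _ 2)).reindex Sigma.fst)).add
      (.const _ 6)).mono fun q => ?_
    have h1 := Nat.size_le_self (q.2 : ℕ)
    have h2 := q.2.2
    have h3 := Nat.size_mono (Nat.div_le_self (a q.1) (2 ^ (q.2 : ℕ)))
    simp only [Val.size, Nat.size_pow]; omega
  -- Halving until zero is reached takes exactly `Nat.size` passes; a second component doubles
  -- along.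
  refine (PolyTime.whileLoop (n := fun i => (a i).size)
    (st := fun i j => .pair (.num (a i / 2 ^ j)) (.pair (.num j) (.num (2 ^ j))))
    (tst := fun i j => .num (a i / 2 ^ j)) hb
    ((ha.pair ((ha.const (.num 0)).pair (ha.const (.num 1)))).congr fun i => by simp)
    ?_ ?_ ?_ ?_).snd
  · exact ((ha.reindex _).top (hz _ (hb.add (.const _ 1)))).fst
  · have ht := (ha.reindex Sigma.fst).top (hz _ hb)
    refine ((ht.fst.divC 2).pair ((ht.snd.fst.addC 1).pair (ht.snd.snd.mulC 2))).congr fun q => ?_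
    rw [Nat.div_div_eq_div_mul, pow_succ, mul_comm 2]
  · intro i k hk
    simpa [Nat.div_eq_zero_iff] using Nat.lt_size.1 hk
  · intro i
    simpa [Nat.div_eq_zero_iff] using Nat.lt_size_self (a i)

end PolyTime

/-! ## Closed walks as periodic sequences -/

section Walks

variable {V : Type*} {G : SimpleGraph V}

/-- `f` is the periodic sequence of the vertices of a closed walk. -/
structure IsTrace {u : V} (W : G.Walk u u) (f : ℕ → V) : Prop where
  periodic : ∀ i, f (i + W.length) = f i
  getVert : ∀ i ≤ W.length, W.getVert i = f i

/-- Reading the vertices modulo the length turns the cyclic conventions on turns into arithmetic on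
`ℕ`. -/
theorem exists_isTrace {u : V} (W : G.Walk u u) : ∃ f, IsTrace W f := by
  refine ⟨fun i => W.getVert (i % W.length), fun i => by simp, fun i hi => ?_⟩
  rcases hi.lt_or_eq with h | rfl
  · rw [Nat.mod_eq_of_lt h]
  · simp

namespace IsTrace

variable {u : V} {W : G.Walk u u} {f : ℕ → V}

theorem turns_eq (h : IsTrace W f) :
    turns W = (List.range W.length).map fun i => (f i, f (i + 1), f (i + 2)) := by
  apply List.ext_getElem
  · simp [turns]
  intro i h1 h2
  have hi : i < W.length := by simpa using h2
  have hW : W.darts.length = W.length := by simp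
  simp only [turns, List.getElem_zipWith, List.getElem_rotate,
    SimpleGraph.Walk.darts_getElem_eq_getVert, List.getElem_map, List.getElem_range, hW]
  rw [h.getVert i hi.le, h.getVert (i + 1) hi, h.getVert _ (Nat.mod_lt _ (by omega))]
  rcases Nat.lt_or_ge (i + 1) W.length with h3 | h3
  · rw [Nat.mod_eq_of_lt h3]
  · have h4 : i + 1 = W.length := by omega
    rw [h4, Nat.mod_self, ← h.periodic (0 + 1)]
    simp only [Prod.mk.injEq, true_and]
    congr 1
    omega

theorem edges_eq (h : IsTrace W f) :
    W.edges = (List.range W.length).map fun i => s(f i, f (i + 1)) := by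
  apply List.ext_getElem
  · simp
  intro i h1 h2
  have hi : i < W.length := by simpa using h2
  simp only [SimpleGraph.Walk.edges, List.getElem_map,
    SimpleGraph.Walk.darts_getElem_eq_getVert, List.getElem_range]
  rw [← h.getVert i hi.le, ← h.getVert (i + 1) hi]
  rfl

theorem adj (h : IsTrace W f) {i : ℕ} (hi : i < W.length) : G.Adj (f i) (f (i + 1)) := by
  rw [← h.getVert i hi.le, ← h.getVert (i + 1) hi]
  exact W.adj_getVert_succ hi

theorem junction_eq [DecidableEq V] (h : IsTrace W f) (v : V) :
    junction W v = ((Multiset.range W.length).filter fun i => f (i + 1) = v).map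
      fun i => s(f i, f (i + 2)) := by
  rw [junction, h.turns_eq, List.filter_map, List.map_map]
  simp only [Multiset.range, Multiset.filter_coe, Multiset.map_coe]
  rfl

end IsTrace

/-- A sequence of adjacent vertices is the sequence of the vertices of a walk. -/
theorem exists_walk_of_adj {f : ℕ → V} (hf : ∀ i, G.Adj (f i) (f (i + 1))) (m : ℕ) :
    ∃ W : G.Walk (f 0) (f m), W.length = m ∧ ∀ i ≤ m, W.getVert i = f i := by
  induction m with
  | zero => exact ⟨.nil, rfl, fun i hi => by simp [Nat.le_zero.1 hi]⟩
  | succ m ih =>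
    obtain ⟨W, hW, hg⟩ := ih
    refine ⟨W.concat (hf m), by simp [hW], fun i hi => ?_⟩
    rw [SimpleGraph.Walk.concat_eq_append, SimpleGraph.Walk.getVert_append, hW]
    split_ifs with h
    · exact hg i h.le
    · rcases hi.lt_or_eq with h' | rfl
      · obtain rfl : i = m := by omega
        simp
      · simp

theorem exists_closed_walk {f : ℕ → V} (hf : ∀ i, G.Adj (f i) (f (i + 1))) {m : ℕ}
    (hm : ∀ i, f (i + m) = f i) : ∃ W : G.Walk (f 0) (f 0), W.length = m ∧ IsTrace W f := by
  obtain ⟨W, hW, hg⟩ := exists_walk_of_adj hf m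
  refine ⟨W.copy rfl (by simpa using hm 0), by simpa using hW, fun i => ?_, fun i hi => ?_⟩
  · simpa [hW] using hm i
  · simp only [SimpleGraph.Walk.length_copy, hW] at hi
    simpa using hg i hi

end Walks

/-! ## Cycles as multisets of edges -/

section Cycles

variable {X : Type*}

/-- The edges of the path that runs through `l`. -/
def pathEdges (l : List X) : List (Sym2 X) := List.zipWith (fun x y => s(x, y)) l l.tail

theorem zipWith_append_singleton {Y : Type*} (f : X → X → Y) (x b : X) (t : List X) :
    List.zipWith f (x :: t) (t ++ [b]) =
      List.zipWith f (x :: t) t ++ [f ((x :: t).getLast (by simp)) b] := by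
  induction t generalizing x with
  | nil => simp
  | cons y t ih => simp [ih y]

/-- A cycle is a path with a closing edge, so a maximal path can be completed by finding that one
edge. -/
theorem cycleEdges_cons (x : X) (t : List X) : cycleEdges (x :: t) =
    s((x :: t).getLast (by simp), x) ::ₘ (pathEdges (x :: t) : Multiset (Sym2 X)) := by
  rw [cycleEdges, show (x :: t).rotate 1 = t ++ [x] by simp, zipWith_append_singleton, pathEdges]
  simp [← Multiset.coe_add, add_comm, ← Multiset.singleton_add]

variable [DecidableEq X]

/-- The number of ends of `e` at `z`. -/
def endCount (z : X) : Sym2 X → ℕ :=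
  Sym2.lift ⟨fun a b => (if a = z then 1 else 0) + (if b = z then 1 else 0),
    fun _ _ => add_comm _ _⟩

@[simp] theorem endCount_mk (z a b : X) :
    endCount z s(a, b) = (if a = z then 1 else 0) + (if b = z then 1 else 0) := rfl

/-- The degree of `z` in a multigraph. -/
def multiDegree (z : X) (M : Multiset (Sym2 X)) : ℕ := (M.map (endCount z)).sum

theorem multiDegree_add (z : X) (M N : Multiset (Sym2 X)) :
    multiDegree z (M + N) = multiDegree z M + multiDegree z N := by simp [multiDegree]

theorem multiDegree_cons (z : X) (e : Sym2 X) (M : Multiset (Sym2 X)) :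
    multiDegree z (e ::ₘ M) = endCount z e + multiDegree z M := by simp [multiDegree]

theorem multiDegree_le {M N : Multiset (Sym2 X)} (h : M ≤ N) (z : X) :
    multiDegree z M ≤ multiDegree z N := by
  obtain ⟨K, rfl⟩ := Multiset.le_iff_exists_add.1 h
  rw [multiDegree_add]; omega

theorem endCount_pos {z : X} {e : Sym2 X} : 0 < endCount z e ↔ z ∈ e := by
  induction e with
  | h a b =>
    rw [endCount_mk, Sym2.mem_iff]
    by_cases h1 : a = z <;> by_cases h2 : b = z <;> simp [h1, h2]
    exact ⟨fun h => h1 h.symm, fun h => h2 h.symm⟩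

theorem multiDegree_pos {z : X} {M : Multiset (Sym2 X)} :
    0 < multiDegree z M ↔ ∃ e ∈ M, z ∈ e := by
  simp [multiDegree, Nat.pos_iff_ne_zero, Multiset.sum_eq_zero_iff, ← endCount_pos]

theorem multiDegree_zipWith (z : X) (l l' : List X) (h : l.length = l'.length) :
    multiDegree z (List.zipWith (fun x y => s(x, y)) l l' : List (Sym2 X)) =
      l.count z + l'.count z := by
  induction l generalizing l' with
  | nil => obtain rfl := List.length_eq_zero_iff.1 h.symm; simp [multiDegree]
  | cons a l ih =>
    cases l' with
    | nil => simp at h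
    | cons b l' =>
      have := ih l' (by simpa using h)
      rw [List.zipWith_cons_cons, ← Multiset.cons_coe, multiDegree_cons, this, List.count_cons,
        List.count_cons, endCount_mk]
      simp only [beq_iff_eq]
      omega

/-- An occurrence of `z` is once a left end and once a right end, as a rotation permutes the list.
-/
theorem multiDegree_cycleEdges (z : X) (l : List X) :
    multiDegree z (cycleEdges l) = 2 * l.count z := by
  rw [cycleEdges, multiDegree_zipWith _ _ _ (by simp),
    (List.rotate_perm l 1).count_eq]
  omega

/-- A connected multigraph without loops in which every degree is two is a Hamiltonian cycle. -/
theorem exists_tour_of_multiDegree [Fintype X] {S : Set X} {M : Multiset (Sym2 X)}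
    (hS : S.Nonempty) (hloop : ∀ e ∈ M, ¬ e.IsDiag) (hM : ∀ e ∈ M, ∀ x ∈ e, x ∈ S)
    (hdeg : ∀ x ∈ S, multiDegree x M = 2)
    (hconn : ∀ T : Set X, (∃ x ∈ S, x ∈ T) → (∀ a b, a ∈ T → s(a, b) ∈ M → b ∈ T) → S ⊆ T) :
    ∃ l, IsTour S l ∧ M = cycleEdges l := by
  let P : List X → Prop := fun l => l.Nodup ∧ (∀ x ∈ l, x ∈ S) ∧ (pathEdges l : Multiset _) ≤ M
  obtain ⟨x₀, hx₀⟩ := hS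
  have hP₀ : P [x₀] := ⟨by simp, by simpa using hx₀, by simp [pathEdges]⟩
  -- A longest path in `M` exists because a list without repetition is no longer than the number of
  -- elements of `X`.
  obtain ⟨l, ⟨hnd, hlS, hlM⟩, hl1, hmax⟩ :
      ∃ l, P l ∧ 1 ≤ l.length ∧ ∀ l', P l' → l'.length ≤ l.length := by
    have hne : {k | ∃ l, P l ∧ l.length = k}.Nonempty := ⟨1, _, hP₀, rfl⟩
    have hbd : BddAbove {k | ∃ l, P l ∧ l.length = k} :=
      ⟨Fintype.card X, by rintro _ ⟨l, hl, rfl⟩; exact hl.1.length_le_card⟩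
    obtain ⟨l, hl, hk⟩ := Nat.sSup_mem hne hbd
    refine ⟨l, hl, ?_, fun l' hl' => ?_⟩
    · rw [hk]; exact le_csSup hbd ⟨_, hP₀, rfl⟩
    · rw [hk]; exact le_csSup hbd ⟨_, hl', rfl⟩
  obtain ⟨x, t, rfl⟩ : ∃ x t, l = x :: t := by
    cases l with
    | nil => simp at hl1
    | cons x t => exact ⟨x, t, rfl⟩
  have hpath : ∀ z ∈ x :: t, endCount z s((x :: t).getLast (by simp), x) +
      multiDegree z (pathEdges (x :: t) : Multiset _) = 2 := fun z hz => by
    rw [← multiDegree_cons, ← cycleEdges_cons, multiDegree_cycleEdges,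
      List.count_eq_one_of_mem hnd hz]
  have hcyc : cycleEdges (x :: t) ≤ M := by
    have hx := hpath x (by simp)
    obtain ⟨K, hK⟩ := Multiset.le_iff_exists_add.1 hlM
    have hdx := hdeg x (hlS x (by simp))
    rw [hK, multiDegree_add] at hdx
    rw [endCount_mk, if_pos rfl] at hx
    -- The path uses only one of the two ends at its first vertex `x`, or none if it is a single
    -- vertex, so a further edge `xy` is left. It is taken from the complement `K` of the path; on
    -- two vertices this yields the second copy of the doubled edge.
    obtain ⟨e, heK, hxe⟩ := multiDegree_pos.1 (show 0 < multiDegree x K by omega)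
    obtain ⟨y, rfl⟩ := Sym2.mem_iff_exists.1 hxe
    have heM : s(x, y) ∈ M := by rw [hK]; exact Multiset.mem_add.2 (.inr heK)
    have hxy : x ≠ y := by simpa using hloop _ heM
    have hle : s(x, y) ::ₘ (pathEdges (x :: t) : Multiset _) ≤ M := by
      rw [hK, ← Multiset.singleton_add, add_comm]
      gcongr
      simpa using heK
    have hyS : y ∈ S := hM _ heM y (by simp)
    -- If `y` is on the path, then it is the last vertex, since otherwise `xy` would raise its
    -- degree above two. If `y` is not on the path, then the path can be extended.
    by_cases hy : y ∈ x :: t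
    · have h2 := multiDegree_le hle y
      rw [hdeg y hyS, multiDegree_cons, endCount_mk, if_neg hxy, if_pos rfl] at h2
      have h3 := hpath y hy
      rw [endCount_mk, if_neg hxy] at h3
      have h4 : (x :: t).getLast (by simp) = y := by
        by_contra hc
        rw [if_neg hc] at h3
        omega
      rw [cycleEdges_cons, h4, Sym2.eq_swap]
      exact hle
    · have := hmax (y :: x :: t) ⟨List.nodup_cons.2 ⟨hy, hnd⟩, ?_, ?_⟩
      · simp at this
      · intro z hz
        rcases List.mem_cons.1 hz with rfl | hz
        · exact hyS
        · exact hlS z hz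
      · rw [Sym2.eq_swap] at hle
        simpa [pathEdges] using hle
  -- The cycle exhausts the degrees of its vertices, so no other edge meets it. By connectedness it
  -- covers `S`, and then nothing else remains in `M`.
  obtain ⟨K, hK⟩ := Multiset.le_iff_exists_add.1 hcyc
  have hzero : ∀ z ∈ x :: t, multiDegree z K = 0 := fun z hz => by
    have := hdeg z (hlS z hz)
    rw [hK, multiDegree_add, multiDegree_cycleEdges, List.count_eq_one_of_mem hnd hz] at this
    omega
  have hall : S ⊆ {z | z ∈ x :: t} := by
    refine hconn _ ⟨x, hlS x (by simp), by simp⟩ fun a b ha hab => ?_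
    rw [hK, Multiset.mem_add] at hab
    rcases hab with hab | hab
    · have : 0 < multiDegree b (cycleEdges (x :: t)) := multiDegree_pos.2 ⟨_, hab, by simp⟩
      rw [multiDegree_cycleEdges] at this
      exact List.count_pos_iff.1 (by omega)
    · have : 0 < multiDegree a K := multiDegree_pos.2 ⟨_, hab, by simp⟩
      rw [hzero a ha] at this
      omega
  refine ⟨x :: t, ⟨hnd, fun z => ⟨hlS z, fun h => hall h⟩⟩, ?_⟩
  have : K = 0 := by
    refine Multiset.eq_zero_of_forall_notMem fun e he => ?_
    induction e with
    | h a b =>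
      have ha : a ∈ S := hM s(a, b) (by rw [hK]; exact Multiset.mem_add.2 (.inr he)) a (by simp)
      have : 0 < multiDegree a K := multiDegree_pos.2 ⟨_, he, by simp⟩
      rw [hzero a (hall ha)] at this
      omega
  rw [hK, this, add_zero]

end Cycles

/-! ## The decomposition of the turn cost -/

section Cost

variable {V R : Type*} [AddCommMonoid R] {G : SimpleGraph V}

/-- By symmetry of `d`, a tour matters only through its multiset of edges. Its starting point and
direction, which a junction graph does not record, are irrelevant. -/
theorem tourLength_eq_sum_cycleEdges {d : V → V → R} (hd : ∀ x y, d x y = d y x) (l : List V) :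
    tourLength d l = ((cycleEdges l).map (Sym2.lift ⟨d, hd⟩)).sum := by
  simp only [tourLength, cycleEdges, Multiset.map_coe, Multiset.sum_coe, List.map_zipWith]
  rfl

/-- Each turn has exactly one middle vertex, so the sum over the turns can be sorted by it. -/
theorem walkCost_eq_sum [Fintype V] [DecidableEq V] (α : TurnCosts V R) {u : V} (W : G.Walk u u) :
    α.walkCost W = ∑ v, ((junction W v).map
      (Sym2.lift ⟨fun x y => α.cost x v y, fun x y => α.symm x v y⟩)).sum := by
  simp only [TurnCosts.walkCost, junction, Multiset.map_coe, Multiset.sum_coe, List.map_map]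
  induction turns W with
  | nil => simp
  | cons t ts ih =>
    have : ∀ v : V, ((List.filter (fun t => decide (t.2.1 = v)) (t :: ts)).map
        ((Sym2.lift ⟨fun x y => α.cost x v y, fun x y => α.symm x v y⟩) ∘
          fun t => s(t.1, t.2.2))).sum = (if t.2.1 = v then α.cost t.1 v t.2.2 else 0) +
        ((List.filter (fun t => decide (t.2.1 = v)) ts).map
        ((Sym2.lift ⟨fun x y => α.cost x v y, fun x y => α.symm x v y⟩) ∘
          fun t => s(t.1, t.2.2))).sum := fun v => by
      by_cases h : t.2.1 = v
      · rw [List.filter_cons_of_pos (by simpa using h), if_pos h, List.map_cons, List.sum_cons]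
        rfl
      · rw [List.filter_cons_of_neg (by simpa using h), if_neg h, zero_add]
    simp only [this, Finset.sum_add_distrib, Finset.sum_ite_eq, Finset.mem_univ, if_true,
      List.map_cons, List.sum_cons, ih]

/-- The turn cost of a walk whose junction graphs are cycles. -/
theorem walkCost_eq_sum_tourLength [Fintype V] [DecidableEq V] (α : TurnCosts V R) {u : V}
    {W : G.Walk u u} {l : V → List V} (h : ∀ v, junction W v = cycleEdges (l v)) :
    α.walkCost W = ∑ v, tourLength (fun x y => α.cost x v y) (l v) := by
  rw [walkCost_eq_sum]
  refine Finset.sum_congr rfl fun v _ => ?_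
  rw [tourLength_eq_sum_cycleEdges (fun x y => α.symm x v y), h]

end Cost

/-! ## Junction graphs of exactly-double threadings -/

section Junction

variable {V : Type*} [DecidableEq V] {G : SimpleGraph V} {u : V} {W : G.Walk u u}

theorem sum_range_shift {f : ℕ → ℕ} {m : ℕ} (h : f m = f 0) :
    ∑ i ∈ Finset.range m, f (i + 1) = ∑ i ∈ Finset.range m, f i := by
  have h1 := Finset.sum_range_succ f m
  rw [Finset.sum_range_succ' f m] at h1
  omega

/-- A traversal of `xv` towards `v` is the first end of a turn at `v`, and a traversal away from `v`
is the second end of the preceding turn. The shift by one step is harmless by periodicity. For `x =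
v` the two orientations would not be disjoint cases. -/
theorem multiDegree_junction {v x : V} (hx : x ≠ v) :
    multiDegree x (junction W v) = W.edges.count s(v, x) := by
  obtain ⟨f, hf⟩ := exists_isTrace W
  have h0 : multiDegree x (junction W v) = ∑ i ∈ Finset.range W.length,
      if f (i + 1) = v then endCount x s(f i, f (i + 2)) else 0 := by
    rw [hf.junction_eq, multiDegree, Multiset.map_map, ← Finset.sum_filter]
    rfl
  have h1 : W.edges.count s(v, x) = ∑ i ∈ Finset.range W.length,
      if s(f i, f (i + 1)) = s(v, x) then 1 else 0 := by
    rw [hf.edges_eq, List.count, List.countP_map, ← Finset.sum_filter, Finset.sum_const,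
      smul_eq_mul, mul_one, List.countP_eq_length_filter]
    simp only [Finset.card, Finset.filter_val, Finset.range_val, Multiset.range,
      Multiset.filter_coe, Multiset.coe_card]
    congr 2
  rw [h0, h1]
  have h2 : ∀ i, (if f (i + 1) = v then endCount x s(f i, f (i + 2)) else 0) =
      (if f i = x ∧ f (i + 1) = v then 1 else 0) +
      (if f (i + 1) = v ∧ f (i + 2) = x then 1 else 0) := fun i => by
    rw [endCount_mk]
    split_ifs <;> simp_all
  have h3 : ∀ i, (if s(f i, f (i + 1)) = s(v, x) then 1 else 0) =
      (if f i = x ∧ f (i + 1) = v then 1 else 0) +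
      (if f i = v ∧ f (i + 1) = x then 1 else 0) := fun i => by
    simp only [Sym2.eq_iff]
    split_ifs <;> simp_all
  simp only [h2, h3, Finset.sum_add_distrib]
  congr 1
  refine sum_range_shift (f := fun i => if f i = v ∧ f (i + 1) = x then 1 else 0) ?_
  have e0 := hf.periodic 0
  have e1 := hf.periodic 1
  rw [zero_add] at e0
  rw [add_comm] at e1
  simp [e0, e1]

theorem mem_junction_adj {v : V} {e : Sym2 V} (he : e ∈ junction W v) {x : V} (hx : x ∈ e) :
    G.Adj v x := by
  obtain ⟨f, hf⟩ := exists_isTrace W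
  rw [hf.junction_eq] at he
  simp only [Multiset.mem_map, Multiset.mem_filter, Multiset.mem_range] at he
  obtain ⟨i, ⟨hi, rfl⟩, rfl⟩ := he
  rcases Sym2.mem_iff.1 hx with rfl | rfl
  · exact (hf.adj hi).symm
  · rcases Nat.lt_or_ge (i + 1) W.length with h | h
    · exact hf.adj h
    · have : i + 1 = W.length := by omega
      rw [show i + 2 = 1 + W.length by omega, hf.periodic 1, this]
      have h0 := hf.periodic 0
      rw [zero_add] at h0
      rw [h0]
      exact hf.adj (by omega)

/-- The junction graphs of an exactly-double threading are Hamiltonian cycles. -/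
theorem IsExactlyDoubleThreading.exists_tour [Fintype V] (h : IsExactlyDoubleThreading W) (v : V) :
    ∃ l, IsTour (G.neighborSet v) l ∧ junction W v = cycleEdges l := by
  have hc := h.connected v
  obtain ⟨⟨x₀, hx₀⟩⟩ := hc.nonempty
  -- The absence of U-turns means that there are no loops, double traversal means that all degrees
  -- are two, and connectedness is part of being a threading.
  refine exists_tour_of_multiDegree ⟨x₀, hx₀⟩ ?_ (fun e he x hx => mem_junction_adj he hx) ?_ ?_
  · intro e he
    simp only [junction, Multiset.mem_coe, List.mem_map, List.mem_filter] at he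
    obtain ⟨t, ⟨ht, -⟩, rfl⟩ := he
    simpa using h.noUTurn t ht
  · intro x hx
    rw [multiDegree_junction (G.ne_of_adj hx).symm]
    exact h.twice _ hx
  · rintro T ⟨x, hx, hxT⟩ hT y hy
    obtain ⟨p⟩ := hc.preconnected ⟨x, hx⟩ ⟨y, hy⟩
    have : ∀ a b : G.neighborSet v, (junctionGraph W v).Walk a b → (a : V) ∈ T → (b : V) ∈ T := by
      intro a b p
      induction p with
      | nil => exact id
      | cons hab _ ih => exact fun ha => ih (hT _ _ ha hab.2)
    exact this _ _ p hxT

end Junction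

/-! ## Merging the closed walks of a rotation system

A state `(x, v, σ)` stands for the arrival at `v` on the edge `xv`, the next edge being the
successor (`σ = true`) or the predecessor of `xv` in the rotation at `v`. On an edge that is twisted
by `ε` the sense `σ` is reversed. -/

section Rotation

variable {V : Type*}

/-- The neighbour to which a state leads. -/
def turnTo (π : V → Equiv.Perm V) (s : V × V × Bool) : V :=
  if s.2.2 then π s.2.1 s.1 else (π s.2.1).symm s.1

/-- The other end of the turn that begins in a state. -/
def partner (π : V → Equiv.Perm V) (s : V × V × Bool) : V × V × Bool :=
  (turnTo π s, s.2.1, !s.2.2)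

/-- The end of a turn that is joined to `s` along the edge of `s`. -/
def link (ε : V → V → Bool) (s : V × V × Bool) : V × V × Bool :=
  (s.2.1, s.1, !(xor s.2.2 (ε s.1 s.2.1)))

/-- The state after the turn that begins in `s`. -/
def step (π : V → Equiv.Perm V) (ε : V → V → Bool) (s : V × V × Bool) : V × V × Bool :=
  link ε (partner π s)

/-- Twists are given for undirected edges. -/
structure IsTwist (ε : V → V → Bool) : Prop where
  symm : ∀ x y, ε x y = ε y x
  diag : ∀ x, ε x x = false

variable {π : V → Equiv.Perm V} {ε : V → V → Bool}

@[simp] theorem partner_partner (s : V × V × Bool) : partner π (partner π s) = s := by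
  obtain ⟨x, v, σ⟩ := s
  cases σ <;> simp [partner, turnTo]

theorem partner_ne (s : V × V × Bool) : partner π s ≠ s := fun h => by
  simpa [partner] using congrArg (fun s => s.2.2) h

theorem IsTwist.link_link (hε : IsTwist ε) (s : V × V × Bool) : link ε (link ε s) = s := by
  obtain ⟨x, v, σ⟩ := s
  simp only [link, hε.symm v x]
  cases σ <;> cases ε x v <;> rfl

/-- The exchange of the two ends of an edge can fix only a degenerate state with equal ends. There
the twist vanishes by `diag`, so the sense is reversed. -/
theorem IsTwist.link_ne (hε : IsTwist ε) (s : V × V × Bool) : link ε s ≠ s := by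
  obtain ⟨x, v, σ⟩ := s
  intro h
  simp only [link, Prod.mk.injEq] at h
  obtain ⟨rfl, -, h⟩ := h
  rw [hε.diag] at h
  cases σ <;> simp at h

theorem IsTwist.link_step (hε : IsTwist ε) (s : V × V × Bool) :
    link ε (step π ε s) = partner π s := hε.link_link _

/-- A step is the composition of the two involutions `partner` and `link`. -/
theorem IsTwist.step_injective (hε : IsTwist ε) : Function.Injective (step π ε) := fun s t h => by
  have := congrArg (fun s => partner π (link ε s)) h
  simpa only [hε.link_step, partner_partner] using this

/-- No walk of the rotation system contains the reversal of one of its states. -/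
theorem IsTwist.iterate_step_ne_link (hε : IsTwist ε) (j : ℕ) (s : V × V × Bool) :
    (step π ε)^[j] s ≠ link ε s := by
  induction j using Nat.strong_induction_on generalizing s with
  | _ j ih =>
    intro h
    match j with
    | 0 => exact hε.link_ne s h.symm
    | 1 =>
      have := congrArg (link ε) (show step π ε s = link ε s from h)
      rw [hε.link_step, hε.link_link] at this
      exact partner_ne s this
    | j + 2 =>
      -- A walk from `s` to its reversal is shortened by one step at each end, giving such a walk
      -- for `step π ε s`. The descent ends at a fixed point of `link` (zero steps) or of `partner`
      -- (one step), and neither exists.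
      rw [Function.iterate_succ_apply'] at h
      have := congrArg (fun s => partner π (link ε s)) h
      simp only [hε.link_step, partner_partner, hε.link_link] at this
      rw [Function.iterate_succ_apply] at this
      exact ih j (by omega) (step π ε s) (by rw [this, hε.link_step])

/-- The relation generated by turning and by passing along an edge. -/
def Joined (π : V → Equiv.Perm V) (ε : V → V → Bool) : V × V × Bool → V × V × Bool → Prop :=
  Relation.EqvGen fun s t => t = partner π s ∨ t = link ε s

theorem joined_partner (s : V × V × Bool) : Joined π ε s (partner π s) := .rel _ _ (.inl rfl)

theorem joined_link (s : V × V × Bool) : Joined π ε s (link ε s) := .rel _ _ (.inr rfl)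

theorem joined_step (s : V × V × Bool) : Joined π ε s (step π ε s) :=
  .trans _ _ _ (joined_partner s) (joined_link _)

theorem joined_iterate_step (s : V × V × Bool) (j : ℕ) : Joined π ε s ((step π ε)^[j] s) := by
  induction j with
  | zero => exact .refl _
  | succ j ih =>
    rw [Function.iterate_succ_apply']
    exact .trans _ _ _ ih (joined_step _)

/-- The state `s` lies over the edge `ab`. -/
def Over (a b : V) (s : V × V × Bool) : Prop := s.1 = a ∧ s.2.1 = b ∨ s.1 = b ∧ s.2.1 = a

instance [DecidableEq V] (a b : V) (s : V × V × Bool) : Decidable (Over a b s) :=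
  inferInstanceAs (Decidable (_ ∨ _))

variable [DecidableEq V]

/-- One step of the walk that stops when it reaches the edge `ab`. -/
def seek (π : V → Equiv.Perm V) (ε : V → V → Bool) (a b : V) (s : V × V × Bool) : V × V × Bool :=
  if Over a b s then s else step π ε s

/-- The first return to the edge `ab` of the walk that begins in `(a, b, true)`, if it occurs within
`N + 1` steps. -/
def firstReturn (π : V → Equiv.Perm V) (ε : V → V → Bool) (N : ℕ) (a b : V) : V × V × Bool :=
  (seek π ε a b)^[N] (step π ε (a, b, true))

/-- Twist the edge `ab` if it is traversed by different walks. -/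
def twist (π : V → Equiv.Perm V) (N : ℕ) (ε : V → V → Bool) (p : V × V) : V → V → Bool :=
  fun x y => if (p.1 ≠ p.2 ∧ firstReturn π ε N p.1 p.2 = (p.1, p.2, true)) ∧
    ((x = p.1 ∧ y = p.2) ∨ (x = p.2 ∧ y = p.1)) then !ε x y else ε x y

/-- Treat the edges `pr 0, pr 1, …` one after the other. -/
def twists (π : V → Equiv.Perm V) (N : ℕ) (pr : ℕ → V × V) : ℕ → V → V → Bool
  | 0 => fun _ _ => false
  | k + 1 => twist π N (twists π N pr k) (pr k)

/-- An injective map of a finite set is periodic, so the walk comes back at least to `(a, b, true)`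
itself within as many steps as there are states. From the first return on, `seek` stands still, so
any larger number of iterations gives the same state. -/
theorem IsTwist.exists_firstReturn [Fintype V] (hε : IsTwist ε) {N : ℕ}
    (hN : Fintype.card (V × V × Bool) ≤ N) (a b : V) :
    ∃ m, (step π ε)^[m + 1] (a, b, true) = firstReturn π ε N a b ∧
      Over a b (firstReturn π ε N a b) ∧
      ∀ j < m, ¬ Over a b ((step π ε)^[j + 1] (a, b, true)) := by
  classical
  set s : V × V × Bool := (a, b, true)
  have hper : s ∈ Function.periodicPts (step π ε) := hε.step_injective.mem_periodicPts _
  have hpos := Function.minimalPeriod_pos_of_mem_periodicPts hper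
  have hle : Function.minimalPeriod (step π ε) s ≤ Fintype.card (V × V × Bool) :=
    Function.minimalPeriod_le_card
  have hex : ∃ m, Over a b ((step π ε)^[m + 1] s) :=
    ⟨Function.minimalPeriod (step π ε) s - 1, by
      rw [Nat.sub_add_cancel hpos, Function.iterate_minimalPeriod]
      exact .inl ⟨rfl, rfl⟩⟩
  have hm : Nat.find hex ≤ N :=
    (Nat.find_min' hex (m := Function.minimalPeriod (step π ε) s - 1) (by
      rw [Nat.sub_add_cancel hpos, Function.iterate_minimalPeriod]
      exact .inl ⟨rfl, rfl⟩)).trans (by omega)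
  have hO := Nat.find_spec hex
  have hmin : ∀ j < Nat.find hex, ¬ Over a b ((step π ε)^[j + 1] s) := fun j hj =>
    Nat.find_min hex hj
  generalize Nat.find hex = m at hm hO hmin
  have h1 : ∀ j ≤ m, (seek π ε a b)^[j] (step π ε s) = (step π ε)^[j + 1] s := by
    intro j
    induction j with
    | zero => intro _; rfl
    | succ j ih =>
      intro hj
      rw [Function.iterate_succ_apply', ih (by omega), seek, if_neg (hmin j (by omega)),
        Function.iterate_succ_apply' _ (j + 1)]
  have h2 : firstReturn π ε N a b = (step π ε)^[m + 1] s := by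
    obtain ⟨d, rfl⟩ := Nat.exists_eq_add_of_le hm
    rw [firstReturn, add_comm m d, Function.iterate_add_apply, h1 m le_rfl]
    exact Function.iterate_fixed (by rw [seek, if_pos hO]) d
  exact ⟨m, h2.symm, by rwa [h2], hmin⟩

/-- Twisting joins the four states over an edge and separates nothing. -/
theorem IsTwist.twist [Fintype V] (hε : IsTwist ε) {N : ℕ}
    (hN : Fintype.card (V × V × Bool) ≤ N) (p : V × V) :
    IsTwist (twist π N ε p) ∧
      (∀ s t, Joined π ε s t → Joined π (Threading.twist π N ε p) s t) ∧
      (p.1 ≠ p.2 → ∀ s t, Over p.1 p.2 s → Over p.1 p.2 t →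
        Joined π (Threading.twist π N ε p) s t) := by
  obtain ⟨a, b⟩ := p
  by_cases hab : a ≠ b
  swap
  · have : Threading.twist π N ε (a, b) = ε := by
      funext x y
      simp [Threading.twist, hab]
    rw [this]
    exact ⟨hε, fun _ _ h => h, fun h => absurd h hab⟩
  -- Up to `link` only the two states with ends in the order `a`, `b` have to be joined.
  have hover : ∀ ε', IsTwist ε' → Joined π ε' (a, b, true) (a, b, false) →
      ∀ s t, Over a b s → Over a b t → Joined π ε' s t := by
    intro ε' hε' hj
    have h1 : ∀ s, Over a b s → Joined π ε' (a, b, true) s := by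
      have h0 : ∀ σ, Joined π ε' (a, b, true) (a, b, σ) := fun σ => by
        cases σ
        · exact hj
        · exact .refl _
      rintro ⟨x, y, σ⟩ (⟨rfl, rfl⟩ | ⟨rfl, rfl⟩)
      · exact h0 σ
      · refine .trans _ _ _ (h0 (link ε' (x, y, σ)).2.2) (.symm _ _ ?_)
        exact joined_link (x, y, σ)
    exact fun s t hs ht => .trans _ _ _ (.symm _ _ (h1 s hs)) (h1 t ht)
  obtain ⟨m, hm, hO, hmin⟩ := hε.exists_firstReturn (π := π) hN a b
  by_cases ht : firstReturn π ε N a b = (a, b, true)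
  swap
  · have : Threading.twist π N ε (a, b) = ε := by
      funext x y
      simp [Threading.twist, ht]
    rw [this]
    refine ⟨hε, fun _ _ h => h, fun _ => hover ε hε ?_⟩
    -- No twist is needed here. The return is `(a, b, false)` or lies over the reversed edge; in the
    -- latter case it is not the reversal of the start, and the only remaining sense has `(a, b,
    -- false)` as its link.
    have hj : Joined π ε (a, b, true) (firstReturn π ε N a b) := by
      rw [← hm]; exact joined_iterate_step _ _
    have hne : firstReturn π ε N a b ≠ link ε (a, b, true) := by
      rw [← hm]; exact hε.iterate_step_ne_link _ _
    generalize firstReturn π ε N a b = t at hO ht hj hne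
    obtain ⟨x, y, σ⟩ := t
    rcases hO with ⟨rfl, rfl⟩ | ⟨rfl, rfl⟩
    · cases σ
      · exact hj
      · exact absurd rfl ht
    · have : link ε (x, y, σ) = (y, x, false) := by
        simp only [link, hε.symm y x] at hne ⊢
        revert hne
        cases σ <;> cases ε x y <;> simp
      rw [← this]
      exact .trans _ _ _ hj (joined_link _)
  set ε' := Threading.twist π N ε (a, b) with hε'def
  have hε'1 : ∀ x y, (x = a ∧ y = b) ∨ (x = b ∧ y = a) → ε' x y = !ε x y := fun x y h => by
    rw [hε'def, Threading.twist, if_pos ⟨⟨hab, ht⟩, h⟩]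
  have hε'0 : ∀ x y, ¬ ((x = a ∧ y = b) ∨ (x = b ∧ y = a)) → ε' x y = ε x y := fun x y h => by
    rw [hε'def, Threading.twist, if_neg fun h' => h h'.2]
  have hε' : IsTwist ε' := by
    refine ⟨fun x y => ?_, fun x => ?_⟩
    · by_cases h : (x = a ∧ y = b) ∨ (x = b ∧ y = a)
      · rw [hε'1 x y h, hε'1 y x (by tauto), hε.symm]
      · rw [hε'0 x y h, hε'0 y x (by tauto), hε.symm]
    · rw [hε'0 x x (by rintro (⟨rfl, rfl⟩ | ⟨rfl, rfl⟩) <;> exact hab rfl), hε.diag]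
  have hlink : ∀ s, ¬ Over a b s → link ε' s = link ε s := fun s hs => by
    rw [link, link, hε'0 _ _ hs]
  -- The old walk closed up without meeting the other strand of `ab`. Cut open before its last
  -- passage along `ab`, it uses no link of that edge and so survives the twist. It ends in `link ε
  -- (a, b, true)`, from where the twisted link leads to `(a, b, false)`.
  have hs1 : Joined π ε' (a, b, true) (link ε (a, b, true)) := by
    have h1 : ∀ j ≤ m, Joined π ε' (a, b, true) ((step π ε)^[j] (a, b, true)) := by
      intro j
      induction j with
      | zero => intro _; exact .refl _
      | succ j ih =>
        intro hj
        refine .trans _ _ _ (ih (by omega)) (.trans _ _ _ (joined_partner _) ?_)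
        rw [Function.iterate_succ_apply', step, ← hlink]
        · exact joined_link _
        · intro h
          refine hmin j (by omega) ?_
          rw [Function.iterate_succ_apply', step]
          rcases h with ⟨h1, h2⟩ | ⟨h1, h2⟩
          · exact .inr ⟨h2, h1⟩
          · exact .inl ⟨h2, h1⟩
    refine .trans _ _ _ (h1 m le_rfl) ?_
    have h2 : link ε (a, b, true) = partner π ((step π ε)^[m] (a, b, true)) := by
      rw [← hε.link_step, ← Function.iterate_succ_apply' (step π ε), hm, ht]
    rw [h2]
    exact joined_partner _
  have hgood := hover ε' hε' (by
    refine .trans _ _ _ hs1 ?_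
    have : link ε' (link ε (a, b, true)) = (a, b, false) := by
      simp only [link, hε'1 b a (by simp), hε.symm b a]
      cases ε a b <;> rfl
    rw [← this]
    exact joined_link _)
  refine ⟨hε', fun s t h => ?_, fun _ => hgood⟩
  induction h with
  | rel s t h =>
    rcases h with rfl | rfl
    · exact joined_partner _
    · by_cases hs : Over a b s
      · refine hgood _ _ hs ?_
        rcases hs with ⟨h1, h2⟩ | ⟨h1, h2⟩
        · exact .inr ⟨h2, h1⟩
        · exact .inl ⟨h2, h1⟩
      · rw [← hlink s hs]
        exact joined_link _
  | refl s => exact .refl _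
  | symm s t _ ih => exact .symm _ _ ih
  | trans s t r _ _ ih1 ih2 => exact .trans _ _ _ ih1 ih2

/-- An edge that has been treated stays good, because later twists separate nothing. Hence one pass
suffices. -/
theorem twists_spec [Fintype V] {N : ℕ} (hN : Fintype.card (V × V × Bool) ≤ N) (pr : ℕ → V × V)
    (k : ℕ) : IsTwist (twists π N pr k) ∧ ∀ j < k, (pr j).1 ≠ (pr j).2 →
      ∀ s t, Over (pr j).1 (pr j).2 s → Over (pr j).1 (pr j).2 t →
        Joined π (twists π N pr k) s t := by
  induction k with
  | zero => exact ⟨⟨fun _ _ => rfl, fun _ => rfl⟩, fun j hj => absurd hj (by omega)⟩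
  | succ k ih =>
    obtain ⟨h1, h2, h3⟩ := ih.1.twist (π := π) hN (pr k)
    refine ⟨h1, fun j hj hne s t hs ht => ?_⟩
    rcases Nat.lt_succ_iff_lt_or_eq.1 hj with hj | rfl
    · exact h2 s t (ih.2 j hj hne s t hs ht)
    · exact h3 hne s t hs ht

end Rotation

/-! ### Threadings with prescribed junction graphs. -/

section Existence

variable {V : Type*} [DecidableEq V] {G : SimpleGraph V}

theorem sum_map_singleton_eq_map {ι X : Type*} (s : Multiset ι) (g : ι → X) :
    (s.map fun i => ({g i} : Multiset X)).sum = s.map g := by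
  rw [← Multiset.sum_map_singleton (s.map g), Multiset.map_map]
  rfl

theorem length_cycleEdges {X : Type*} (l : List X) :
    Multiset.card (cycleEdges l) = l.length := by
  simp [cycleEdges]

/-- The cycle joins each vertex to its successor. On two vertices both of them contribute the same
edge, which gives the doubled edge. -/
theorem cycleEdges_eq_map_formPerm {l : List V} (hl : l.Nodup) :
    cycleEdges l = (l : Multiset V).map fun x => s(x, l.formPerm x) := by
  rw [cycleEdges, Multiset.map_coe]
  congr 1
  apply List.ext_getElem
  · simp
  intro i h1 h2
  simp only [List.getElem_zipWith, List.getElem_map, List.getElem_rotate]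
  rw [List.formPerm_apply_getElem _ hl]

theorem IsTour.two_le_length {S : Set V} {l : List V} (hl : IsTour S l) (hS : 2 ≤ S.ncard) :
    2 ≤ l.length := by
  have : S = (l.toFinset : Set V) := by ext x; simp [hl.2]
  rw [this, Set.ncard_coe_finset, List.toFinset_card_of_nodup hl.1] at hS
  exact hS

/-- The successor permutation is transitive on the tour, so a property that it preserves spreads
from one vertex to all. -/
theorem formPerm_closed_of_tour [Fintype V] {l : List V} (hl : l.Nodup) {T : V → Prop} {x y : V}
    (hx : x ∈ l) (hy : y ∈ l) (hT : ∀ z ∈ l, T z → T (l.formPerm z)) (h : T x) : T y := by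
  obtain ⟨i, rfl⟩ := (hl.isCycleOn_formPerm.2 hx hy).exists_nat_pow_eq
  have : ∀ i : ℕ, T ((l.formPerm ^ i) x) ∧ (l.formPerm ^ i) x ∈ l := by
    intro i
    induction i with
    | zero => exact ⟨h, hx⟩
    | succ i ih =>
      rw [pow_succ', Equiv.Perm.mul_apply]
      exact ⟨hT _ ih.2 ih.1, List.formPerm_mem_iff_mem.2 ih.2⟩
  exact (this i).1

/-- A closed walk whose junction graphs are Hamiltonian cycles is an exactly-double threading. -/
theorem isExactlyDoubleThreading_of_junction [Fintype V] (hG : Admissible G) {l : V → List V}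
    (hl : ∀ v, IsTour (G.neighborSet v) (l v)) {u : V} {W : G.Walk u u}
    (hW : ∀ v, junction W v = cycleEdges (l v)) : IsExactlyDoubleThreading W := by
  have htwice : ∀ e ∈ G.edgeSet, W.edges.count e = 2 := by
    intro e he
    induction e with
    | h v x =>
      rw [← multiDegree_junction (G.ne_of_adj he).symm, hW, multiDegree_cycleEdges,
        List.count_eq_one_of_mem (hl v).1 (((hl v).2 x).2 he)]
  refine ⟨⟨fun e he => List.count_pos_iff.1 (by rw [htwice e he]; norm_num), fun v => ?_,
    fun t ht hc => ?_⟩, htwice⟩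
  · have hmem : ∀ {x}, G.Adj v x → x ∈ l v := fun h => ((hl v).2 _).2 h
    have hadj : ∀ {x}, x ∈ l v → G.Adj v x := fun h => ((hl v).2 _).1 h
    have h2 := (hl v).two_le_length (hG.two_le_degree v)
    have : Nonempty (G.neighborSet v) := ⟨⟨(l v)[0], hadj (List.getElem_mem _)⟩⟩
    refine ⟨fun x y => ?_⟩
    have := formPerm_closed_of_tour (hl v).1
      (T := fun z => ∀ hz : G.Adj v z, (junctionGraph W v).Reachable x ⟨z, hz⟩)
      (hmem x.2) (hmem y.2) (fun z hz ih hz' => ?_) (fun _ => .refl _)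
    · exact this y.2
    · refine (ih (hadj hz)).trans (SimpleGraph.Adj.reachable ⟨fun h => ?_, ?_⟩)
      · exact (List.formPerm_apply_mem_ne_self_iff _ (hl v).1 z hz).2 h2 (congrArg Subtype.val h).symm
      · rw [hW, cycleEdges_eq_map_formPerm (hl v).1]
        exact Multiset.mem_map.2 ⟨z, hz, rfl⟩
  -- A U-turn would be a loop of the junction graph, hence a fixed point of the successor
  -- permutation of a tour with at least two cities.
  · have hmem : s(t.1, t.2.2) ∈ junction W t.2.1 :=
      Multiset.mem_coe.2 (List.mem_map.2 ⟨t, List.mem_filter.2 ⟨ht, by simp⟩, rfl⟩)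
    rw [hW, cycleEdges_eq_map_formPerm (hl _).1, Multiset.mem_map] at hmem
    obtain ⟨z, hz, he⟩ := hmem
    have hne := (List.formPerm_apply_mem_ne_self_iff _ (hl t.2.1).1 z hz).2
      ((hl _).two_le_length (hG.two_le_degree _))
    rw [hc, Sym2.eq_iff] at he
    rcases he with ⟨h1, h2⟩ | ⟨h1, h2⟩ <;> exact hne (h2.trans h1.symm)

variable {l : V → List V} {ε : V → V → Bool}

theorem adj_turnTo (hl : ∀ v, IsTour (G.neighborSet v) (l v)) {s : V × V × Bool}
    (hs : G.Adj s.2.1 s.1) : G.Adj s.2.1 (turnTo (fun v => (l v).formPerm) s) := by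
  obtain ⟨x, v, σ⟩ := s
  have hx : x ∈ l v := ((hl v).2 x).2 hs
  refine ((hl v).2 _).1 ?_
  cases σ
  · rw [← List.formPerm_mem_iff_mem]
    simpa [turnTo] using hx
  · simpa [turnTo] using hx

variable [Fintype V]

/-- If all edges have been treated, then the rotation system has a single walk. -/
theorem joined_of_adj (hG : Admissible G) (hl : ∀ v, IsTour (G.neighborSet v) (l v))
    (hgood : ∀ a b, G.Adj a b → ∀ s t, Over a b s → Over a b t →
      Joined (fun v => (l v).formPerm) ε s t) {s t : V × V × Bool}
    (hs : G.Adj s.1 s.2.1) (ht : G.Adj t.1 t.2.1) :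
    Joined (fun v => (l v).formPerm) ε s t := by
  set π := fun v => (l v).formPerm with hπ
  -- Around one vertex: `partner` leads from an edge to the next one in the rotation, and goodness
  -- of the edges allows the sense to be changed at will.
  have hv : ∀ v x y σ τ, G.Adj v x → G.Adj v y → Joined π ε (x, v, σ) (y, v, τ) := by
    intro v x y σ τ hx hy
    have h1 := formPerm_closed_of_tour (hl v).1 (T := fun z => Joined π ε (x, v, true) (z, v, true))
      (((hl v).2 x).2 hx) (((hl v).2 y).2 hy) (fun z hz ih => ?_) (.refl _)
    · exact .trans _ _ _ (hgood v x hx _ _ (.inr ⟨rfl, rfl⟩) (.inr ⟨rfl, rfl⟩))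
        (.trans _ _ _ h1 (hgood v y hy _ _ (.inr ⟨rfl, rfl⟩) (.inr ⟨rfl, rfl⟩)))
    · refine .trans _ _ _ ih (.trans _ _ _ (joined_partner _)
        (hgood v ((l v).formPerm z) (((hl v).2 _).1 (List.formPerm_mem_iff_mem.2 hz)) _ _
          (.inr ⟨?_, rfl⟩) (.inr ⟨rfl, rfl⟩)))
      simp [partner, turnTo, hπ]
  have key : ∀ v, ∀ x σ, G.Adj v x → Joined π ε s (x, v, σ) := by
    intro v
    obtain ⟨p⟩ := hG.connected.preconnected s.2.1 v
    have : ∀ a b : V, G.Walk a b → (∀ x σ, G.Adj a x → Joined π ε s (x, a, σ)) →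
        ∀ x σ, G.Adj b x → Joined π ε s (x, b, σ) := by
      intro a b p
      induction p with
      | nil => exact id
      | @cons a b c hab _ ih =>
        refine fun h => ih fun x σ hx => .trans _ _ _ (h b true hab) ?_
        exact .trans _ _ _ (hgood a b hab _ (a, b, true) (.inr ⟨rfl, rfl⟩) (.inl ⟨rfl, rfl⟩))
          (hv b a x true σ hab.symm hx)
    exact this _ _ p fun x σ hx => hv s.2.1 s.1 x s.2.2 σ hs.symm hx
  exact key t.2.1 t.1 t.2.2 ht.symm

/-- The walk of a rotation system with a single walk is an exactly-double threading. -/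
theorem exists_threading_of_good (hG : Admissible G) (hl : ∀ v, IsTour (G.neighborSet v) (l v))
    (hε : IsTwist ε) (hgood : ∀ a b, G.Adj a b → ∀ s t, Over a b s → Over a b t →
      Joined (fun v => (l v).formPerm) ε s t) {s₀ : V × V × Bool} (hs₀ : G.Adj s₀.1 s₀.2.1) :
    ∃ W : G.Walk s₀.1 s₀.1, IsTrace W (fun i => ((step (fun v => (l v).formPerm) ε)^[i] s₀).1) ∧
      ∀ v, junction W v = cycleEdges (l v) := by
  set π := fun v => (l v).formPerm with hπ
  have hadj : ∀ s, G.Adj s.1 s.2.1 → G.Adj (step π ε s).1 (step π ε s).2.1 := fun s hs =>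
    adj_turnTo hl (s := s) hs.symm
  have hadj' : ∀ i, G.Adj ((step π ε)^[i] s₀).1 ((step π ε)^[i] s₀).2.1 := by
    intro i
    induction i with
    | zero => exact hs₀
    | succ i ih => rw [Function.iterate_succ_apply']; exact hadj _ ih
  have hsnd : ∀ i, ((step π ε)^[i + 1] s₀).1 = ((step π ε)^[i] s₀).2.1 := fun i => by
    rw [Function.iterate_succ_apply']; rfl
  have hsnd2 : ∀ i, ((step π ε)^[i + 2] s₀).1 = turnTo π ((step π ε)^[i] s₀) := fun i => by
    rw [hsnd, Function.iterate_succ_apply']; rfl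
  have hper : s₀ ∈ Function.periodicPts (step π ε) := hε.step_injective.mem_periodicPts _
  have hpos := Function.minimalPeriod_pos_of_mem_periodicPts hper
  set m := Function.minimalPeriod (step π ε) s₀ with hm
  have hperiod : ∀ i, (step π ε)^[i + m] s₀ = (step π ε)^[i] s₀ := fun i => by
    rw [Function.iterate_add_apply, Function.iterate_minimalPeriod]
  obtain ⟨W, hWm, hW⟩ := exists_closed_walk (G := G) (f := fun i => ((step π ε)^[i] s₀).1)
    (fun i => by simpa only [hsnd] using hadj' i) (m := m) (fun i => by simp only [hperiod])
  refine ⟨W, hW, fun v => ?_⟩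
  -- the orbit of the initial state
  set Ω : Finset (V × V × Bool) := (Finset.range m).image fun i => (step π ε)^[i] s₀ with hΩ
  have hmem : ∀ i, (step π ε)^[i] s₀ ∈ Ω := fun i => by
    rw [hΩ, Finset.mem_image]
    exact ⟨i % m, Finset.mem_range.2 (Nat.mod_lt _ hpos), Function.iterate_mod_minimalPeriod_eq⟩
  have hmem' : ∀ s ∈ Ω, ∃ i, (step π ε)^[i] s₀ = s := fun s hs => by
    obtain ⟨i, -, hi⟩ := Finset.mem_image.1 hs
    exact ⟨i, hi⟩
  have hΩadj : ∀ s ∈ Ω, G.Adj s.1 s.2.1 := fun s hs => by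
    obtain ⟨i, rfl⟩ := hmem' s hs
    exact hadj' i
  -- The orbit never runs a strand in both directions. The `i` steps to `s` are undone by completing
  -- `i` full periods, which takes `m * i - i` further steps.
  have hexcl : ∀ s ∈ Ω, link ε s ∉ Ω := by
    intro s hs hs'
    obtain ⟨i, rfl⟩ := hmem' s hs
    obtain ⟨j, hj⟩ := hmem' _ hs'
    refine hε.iterate_step_ne_link (π := π) (j + (m * i - i)) ((step π ε)^[i] s₀) ?_
    have h1 : i ≤ m * i := Nat.le_mul_of_pos_left i hpos
    rw [← hj, ← Function.iterate_add_apply, show j + (m * i - i) + i = j + m * i by omega]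
    have h2 : ∀ k, (step π ε)^[j + m * k] s₀ = (step π ε)^[j] s₀ := by
      intro k
      induction k with
      | zero => rfl
      | succ k ih => rw [mul_add, mul_one, ← add_assoc, hperiod, ih]
    exact h2 i
  have hstep : ∀ s ∈ Ω, step π ε s ∈ Ω := fun s hs => by
    obtain ⟨i, rfl⟩ := hmem' s hs
    rw [← Function.iterate_succ_apply' (step π ε)]
    exact hmem _
  have hpred : ∀ s ∈ Ω, partner π (link ε s) ∈ Ω := fun s hs => by
    obtain ⟨i, rfl⟩ := hmem' s hs
    rw [← hperiod, show i + m = (i + m - 1) + 1 by omega, Function.iterate_succ_apply',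
      hε.link_step, partner_partner]
    exact hmem _
  -- The orbit together with its reversal is closed under `partner` and `link`, hence contains
  -- everything joined to `s₀`, that is, all states over edges.
  have hcover : ∀ s, G.Adj s.1 s.2.1 → s ∈ Ω ∨ link ε s ∈ Ω := by
    have hA : ∀ s, (s ∈ Ω ∨ link ε s ∈ Ω) → (partner π s ∈ Ω ∨ link ε (partner π s) ∈ Ω) := by
      rintro s (hs | hs)
      · exact .inr (hstep s hs)
      · have := hpred _ hs
        rw [hε.link_link] at this
        exact .inl this
    have hB : ∀ s, (s ∈ Ω ∨ link ε s ∈ Ω) → (link ε s ∈ Ω ∨ link ε (link ε s) ∈ Ω) := by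
      intro s hs
      rw [hε.link_link]
      exact hs.symm
    have : ∀ s t, Joined π ε s t → ((s ∈ Ω ∨ link ε s ∈ Ω) ↔ (t ∈ Ω ∨ link ε t ∈ Ω)) := by
      intro s t h
      induction h with
      | rel s t h =>
        rcases h with rfl | rfl
        · exact ⟨hA s, fun h => by simpa using hA _ h⟩
        · exact ⟨hB s, fun h => by simpa only [hε.link_link] using hB _ h⟩
      | refl => exact Iff.rfl
      | symm _ _ _ ih => exact ih.symm
      | trans _ _ _ _ _ ih1 ih2 => exact ih1.trans ih2
    exact fun s hs => (this s₀ s (joined_of_adj hG hl hgood hs₀ hs)).1 (.inl (hmem 0))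
  -- The two ends of a turn are `s` and `partner π s`. Exactly one of them is in the orbit, so the
  -- turn is made exactly once, in one of its two directions.
  have hpartner : ∀ s, G.Adj s.1 s.2.1 → (partner π s ∈ Ω ↔ s ∉ Ω) := by
    intro s hs
    constructor
    · intro h h'
      exact hexcl _ (hstep s h') (by rwa [hε.link_step])
    · intro h
      have h1 : step π ε s ∉ Ω := fun h' => h (by
        have := hpred _ h'
        rwa [hε.link_step, partner_partner] at this)
      have := (hcover _ (hadj s hs)).resolve_left h1
      rwa [hε.link_step] at this
  have hsum : junction W v = ∑ s ∈ Ω, if s.2.1 = v then {s(s.1, turnTo π s)} else 0 := by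
    rw [hΩ, Finset.sum_image, hW.junction_eq, hWm, ← Finset.sum_filter]
    · simp only [hsnd2]
      simp only [hsnd, Finset.sum, Finset.filter_val, Finset.range_val]
      rw [sum_map_singleton_eq_map]
    · intro i hi j hj h
      exact (Function.iterate_eq_iterate_iff_of_lt_minimalPeriod (by simpa using hi)
        (by simpa using hj)).1 h
  have hsum2 : junction W v = ∑ x, ((if (x, v, true) ∈ Ω then {s(x, π v x)} else 0) +
      if (x, v, false) ∈ Ω then {s(x, (π v).symm x)} else 0) := by
    rw [hsum, ← Finset.univ_inter Ω, ← Finset.sum_ite_mem, Fintype.sum_prod_type]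
    refine Finset.sum_congr rfl fun x _ => ?_
    rw [Fintype.sum_prod_type, Finset.sum_eq_single v]
    · simp [turnTo]
    · intro y _ hy
      simp [hy]
    · simp
  have hlv : cycleEdges (l v) = ∑ x, if x ∈ l v then {s(x, π v x)} else 0 := by
    rw [cycleEdges_eq_map_formPerm (hl v).1, ← sum_map_singleton_eq_map, ← Finset.sum_filter]
    have : (Finset.univ.filter fun x => x ∈ l v).val = (l v : Multiset V) := by
      have h1 : (Finset.univ.filter fun x => x ∈ l v) = (l v).toFinset := by ext; simp
      rw [h1, List.toFinset_val, (hl v).1.dedup]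
    rw [Finset.sum, this]
  refine hsum2.trans ?_
  -- After reindexing the backward states by `π v`, the turn between `x` and `π v x` occurs in both
  -- sums with index `x`, and one of the two terms vanishes.
  rw [hlv, Finset.sum_add_distrib, ← Equiv.sum_comp (π v) fun x =>
    if (x, v, false) ∈ Ω then {s(x, (π v).symm x)} else 0, ← Finset.sum_add_distrib]
  refine Finset.sum_congr rfl fun x _ => ?_
  have hp : (π v x, v, false) = partner π (x, v, true) := rfl
  by_cases hx : x ∈ l v
  · have hadjx : G.Adj x v := (((hl v).2 x).1 hx).symm
    have := hpartner (x, v, true) hadjx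
    rw [if_pos hx, hp, Equiv.symm_apply_apply, Sym2.eq_swap]
    by_cases h : (x, v, true) ∈ Ω
    · rw [if_pos h, if_neg (fun h' => this.1 h' h), add_zero]
    · rw [if_neg h, if_pos (this.2 h), zero_add]
  · have h1 : ∀ y σ, y ∉ l v → (y, v, σ) ∉ Ω := fun y σ hy h =>
      hy (((hl v).2 y).2 (hΩadj _ h).symm)
    rw [if_neg hx, if_neg (h1 _ _ hx), if_neg (h1 _ _ _), add_zero]
    rwa [List.formPerm_mem_iff_mem]

/-- Every choice of Hamiltonian cycles comes from an exactly-double threading. -/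
theorem exists_threading_of_tours (hG : Admissible G)
    (hl : ∀ v, IsTour (G.neighborSet v) (l v)) :
    ∃ (u : V) (W : G.Walk u u), IsExactlyDoubleThreading W ∧
      ∀ v, junction W v = cycleEdges (l v) := by
  obtain ⟨v⟩ := hG.connected.nonempty
  have h2 := (hl v).two_le_length (hG.two_le_degree v)
  have hadj : G.Adj v (l v)[0] := ((hl v).2 _).1 (List.getElem_mem _)
  let e := Fintype.equivFin (V × V)
  have hcard : 0 < Fintype.card (V × V) := Fintype.card_pos_iff.2 ⟨(v, v)⟩
  -- All ordered pairs of vertices are treated. Pairs that are not edges do no harm, and an edge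
  -- that occurs again is already good.
  obtain ⟨hε, hgood⟩ := twists_spec (π := fun v => (l v).formPerm) le_rfl
    (fun k => e.symm ⟨k % Fintype.card (V × V), Nat.mod_lt _ hcard⟩) (Fintype.card (V × V))
  obtain ⟨W, -, hW⟩ := exists_threading_of_good hG hl hε (fun a b hab s t hs ht => by
    have h1 := hgood (e (a, b)) (e (a, b)).2
    have h2 : (e (a, b) : ℕ) % Fintype.card (V × V) = e (a, b) := Nat.mod_eq_of_lt (e (a, b)).2
    simp only [h2, Fin.eta, Equiv.symm_apply_apply] at h1
    exact h1 hab.ne s t hs ht) (s₀ := (v, (l v)[0], true)) hadj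
  exact ⟨v, W, isExactlyDoubleThreading_of_junction hG hl hW, hW⟩

/-- The length of a walk is the number of its turns. -/
theorem length_eq_sum_length {u : V} {W : G.Walk u u} (hW : ∀ v, junction W v = cycleEdges (l v)) :
    W.length = ∑ v, (l v).length := by
  have h1 : ∑ v, (l v).length = ∑ v, Multiset.card (junction W v) :=
    Finset.sum_congr rfl fun v _ => by rw [hW, length_cycleEdges]
  have h2 : W.length = (turns W).length := by simp [turns]
  rw [h1, h2]
  simp only [junction, Multiset.coe_card, List.length_map]
  induction turns W with
  | nil => simp
  | cons t ts ih =>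
    simp only [List.filter_cons, apply_ite List.length, List.length_cons]
    have : ∀ v : V, (if decide (t.2.1 = v) = true then
        (List.filter (fun t => decide (t.2.1 = v)) ts).length + 1
        else (List.filter (fun t => decide (t.2.1 = v)) ts).length) =
        (List.filter (fun t => decide (t.2.1 = v)) ts).length + if t.2.1 = v then 1 else 0 :=
      fun v => by by_cases h : t.2.1 = v <;> simp [h]
    simp only [this, Finset.sum_add_distrib, ← ih, Finset.sum_ite_eq, Finset.mem_univ, if_true]

end Existence

/-! ## Optimal tours and optimal threadings -/

section Optimal

variable {X Y R : Type*}

theorem tourLength_map [AddCommMonoid R] (d : Y → Y → R) (g : X → Y) (l : List X) :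
    tourLength d (l.map g) = tourLength (fun x y => d (g x) (g y)) l := by
  rw [tourLength, ← List.map_rotate, List.zipWith_map]
  rfl

theorem tourLength_const [AddCommMonoid R] (κ : R) (l : List X) :
    tourLength (fun _ _ => κ) l = l.length • κ := by
  have : List.zipWith (fun _ _ : X => κ) l (l.rotate 1) = List.replicate l.length κ := by
    apply List.ext_getElem <;> simp
  rw [tourLength, this, List.sum_replicate]

theorem IsTour.length_eq_ncard {S : Set X} {l : List X} (h : IsTour S l) :
    l.length = S.ncard := by
  classical
  have : S = (l.toFinset : Set X) := by ext x; simp [h.2]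
  rw [this, Set.ncard_coe_finset, List.toFinset_card_of_nodup h.1]

theorem IsTour.map {S : Set X} {T : Set Y} {g : X → Y} {l : List X} (h : IsTour S l)
    (hg : Set.BijOn g S T) : IsTour T (l.map g) := by
  refine ⟨h.1.map_on fun x hx y hy hxy => hg.injOn ((h.2 x).1 hx) ((h.2 y).1 hy) hxy, fun y => ?_⟩
  rw [List.mem_map, ← hg.image_eq]
  simp only [h.2, Set.mem_image]

/-- The tour is pulled back by the inverse bijection. The empty tour is separate because an inverse
function needs a nonempty source. -/
theorem IsTour.exists_map_eq {S : Set X} {T : Set Y} {g : X → Y} (hg : Set.BijOn g S T)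
    {l : List Y} (h : IsTour T l) : ∃ l', IsTour S l' ∧ l'.map g = l := by
  rcases l with _ | ⟨y, t⟩
  · refine ⟨[], ⟨by simp, fun x => ?_⟩, rfl⟩
    simp only [List.not_mem_nil, false_iff]
    exact fun hx => by simpa using (h.2 _).2 (hg.mapsTo hx)
  obtain ⟨x₀, -, -⟩ := hg.surjOn ((h.2 y).1 (by simp))
  have : Nonempty X := ⟨x₀⟩
  refine ⟨(y :: t).map (Function.invFunOn g S), h.map ?_, ?_⟩
  · exact hg.invOn_invFunOn.symm.bijOn hg.surjOn.mapsTo_invFunOn hg.mapsTo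
  · rw [List.map_map]
    refine (List.map_congr_left fun z hz => ?_).trans (List.map_id _)
    exact hg.invOn_invFunOn.2 ((h.2 z).1 hz)

theorem exists_isTour [Finite X] (S : Set X) : ∃ l, IsTour S l := by
  classical
  have := Fintype.ofFinite X
  exact ⟨(Finset.univ.filter (· ∈ S)).toList, Finset.nodup_toList _, fun x => by simp⟩

theorem exists_minimal_tour [Finite X] [AddCommMonoid R] [LinearOrder R] (S : Set X)
    (d : X → X → R) :
    ∃ l, IsTour S l ∧ ∀ l', IsTour S l' → tourLength d l ≤ tourLength d l' := by
  have := Fintype.ofFinite X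
  have hfin : {l | IsTour S l}.Finite :=
    (List.finite_length_le X (Fintype.card X)).subset fun l hl => hl.1.length_le_card
  obtain ⟨l, hl, hmin⟩ := Set.exists_min_image _ (tourLength d) hfin (exists_isTour S)
  exact ⟨l, hl, hmin⟩

variable {V : Type*} [Fintype V] [DecidableEq V] {G : SimpleGraph V}

/-- The decomposition of the cost of an exactly-double threading. -/
theorem IsExactlyDoubleThreading.exists_tours [AddCommMonoid R] (α : TurnCosts V R) {u : V}
    {W : G.Walk u u} (hW : IsExactlyDoubleThreading W) : ∃ l : V → List V,
      (∀ v, IsTour (G.neighborSet v) (l v) ∧ junction W v = cycleEdges (l v)) ∧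
      α.walkCost W = ∑ v, tourLength (fun x y => α.cost x v y) (l v) := by
  choose l hl using hW.exists_tour
  exact ⟨l, hl, walkCost_eq_sum_tourLength α fun v => (hl v).2⟩

theorem exists_threading_eq_sum [AddCommMonoid R] (hG : Admissible G) (α : TurnCosts V R)
    {l : V → List V} (hl : ∀ v, IsTour (G.neighborSet v) (l v)) :
    ∃ (u : V) (W : G.Walk u u), IsExactlyDoubleThreading W ∧
      (∀ v, junction W v = cycleEdges (l v)) ∧
      α.walkCost W = ∑ v, tourLength (fun x y => α.cost x v y) (l v) := by
  obtain ⟨u, W, hW, hj⟩ := exists_threading_of_tours hG hl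
  exact ⟨u, W, hW, hj, walkCost_eq_sum_tourLength α hj⟩

theorem sum_minimal_le [AddCommMonoid R] [LinearOrder R] [IsOrderedAddMonoid R]
    (α : TurnCosts V R) {l : V → List V}
    (hl : ∀ v l', IsTour (G.neighborSet v) l' →
      tourLength (fun x y => α.cost x v y) (l v) ≤ tourLength (fun x y => α.cost x v y) l')
    {u : V} {W : G.Walk u u} (hW : IsExactlyDoubleThreading W) :
    ∑ v, tourLength (fun x y => α.cost x v y) (l v) ≤ α.walkCost W := by
  obtain ⟨l', hl', h⟩ := hW.exists_tours α
  rw [h]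
  exact Finset.sum_le_sum fun v _ => hl v _ (hl' v).1

/-- The minimum turn cost is the sum of the minimum tour lengths. -/
theorem isLeast_threading [AddCommMonoid R] [LinearOrder R] [IsOrderedAddMonoid R]
    (hG : Admissible G) (α : TurnCosts V R) : ∃ τ : V → R,
      (∀ v, IsLeast {r | ∃ l, IsTour (G.neighborSet v) l ∧
        tourLength (fun x y => α.cost x v y) l = r} (τ v)) ∧
      IsLeast {r | ∃ (u : V) (W : G.Walk u u), IsExactlyDoubleThreading W ∧
        α.walkCost W = r} (∑ v, τ v) := by
  choose l hl hmin using fun v =>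
    exists_minimal_tour (G.neighborSet v) (fun x y => α.cost x v y)
  refine ⟨fun v => tourLength (fun x y => α.cost x v y) (l v), fun v => ⟨⟨l v, hl v, rfl⟩, ?_⟩,
    ?_, ?_⟩
  · rintro _ ⟨l', hl', rfl⟩
    exact hmin v l' hl'
  · obtain ⟨u, W, hW, -, h⟩ := exists_threading_eq_sum hG α hl
    exact ⟨u, W, hW, h⟩
  · rintro _ ⟨u, W, hW, rfl⟩
    exact sum_minimal_le α hmin hW

/-- If all turns outside of `c` have the same cost, then the cost of an exactly-double threading is
determined by the tour at `c`. -/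
theorem exists_threading_le_iff [AddCommMonoid R] [LinearOrder R] [IsOrderedCancelAddMonoid R]
    (hG : Admissible G) {α : TurnCosts V R} {c : V} {r : X → V}
    (hr : Set.BijOn r Set.univ (G.neighborSet c)) {d : X → X → R}
    (hd : ∀ i j, α.cost (r i) c (r j) = d i j) {κ : R}
    (hκ : ∀ v, v ≠ c → ∀ x y, α.cost x v y = κ) (C : R) :
    (∃ l, IsTour Set.univ l ∧ tourLength d l ≤ C) ↔
      ∃ (u : V) (W : G.Walk u u), IsExactlyDoubleThreading W ∧
        α.walkCost W ≤ C + (∑ v ∈ Finset.univ.erase c, (G.neighborSet v).ncard) • κ := by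
  have hd' : (fun i j => α.cost (r i) c (r j)) = d := by ext i j; exact hd i j
  -- At a vertex with constant turn cost every tour costs its degree times `κ`, whichever tour it
  -- is.
  have hsum : ∀ l : V → List V, (∀ v, IsTour (G.neighborSet v) (l v)) →
      ∑ v, tourLength (fun x y => α.cost x v y) (l v) =
        tourLength (fun x y => α.cost x c y) (l c) +
          (∑ v ∈ Finset.univ.erase c, (G.neighborSet v).ncard) • κ := by
    intro l hl
    rw [← Finset.add_sum_erase _ _ (Finset.mem_univ c), Finset.sum_smul]
    congr 1
    refine Finset.sum_congr rfl fun v hv => ?_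
    have : (fun x y => α.cost x v y) = fun _ _ => κ := by
      ext x y; exact hκ v (Finset.ne_of_mem_erase hv) x y
    rw [this, tourLength_const, (hl v).length_eq_ncard]
  constructor
  · rintro ⟨l, hl, hC⟩
    choose t ht using fun v => exists_isTour (G.neighborSet v)
    have hl' : ∀ v, IsTour (G.neighborSet v) (Function.update t c (l.map r) v) := fun v => by
      by_cases hv : v = c
      · subst hv; simpa using hl.map hr
      · simpa [hv] using ht v
    obtain ⟨u, W, hW, -, h⟩ := exists_threading_eq_sum hG α hl'
    refine ⟨u, W, hW, ?_⟩
    rw [h, hsum _ hl', Function.update_self, tourLength_map, hd']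
    gcongr
  · rintro ⟨u, W, hW, hC⟩
    obtain ⟨l, hl, h⟩ := hW.exists_tours α
    rw [h, hsum l fun v => (hl v).1] at hC
    obtain ⟨l', hl', he⟩ := IsTour.exists_map_eq hr (hl c).1
    refine ⟨l', hl', ?_⟩
    rw [← he, tourLength_map, hd'] at hC
    exact le_of_add_le_add_right hC

end Optimal

/-! ## The star of arms -/

theorem two_le_ncard {V : Type*} [Finite V] {S : Set V} {a b : V} (ha : a ∈ S) (hb : b ∈ S)
    (hab : a ≠ b) : 2 ≤ S.ncard :=
  (Set.one_lt_ncard_iff (Set.toFinite _)).2 ⟨a, b, ha, hb, hab⟩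

section Star

variable {n : ℕ}

@[simp] theorem starGraph_adj_none (i : Fin n) (k : Fin 3) :
    (starGraph n).Adj none (some (i, k)) ↔ k = 0 := by
  simp [starGraph]

@[simp] theorem starGraph_adj_none' (i : Fin n) (k : Fin 3) :
    (starGraph n).Adj (some (i, k)) none ↔ k = 0 := by
  simp [starGraph]

@[simp] theorem starGraph_adj_some (i j : Fin n) (k m : Fin 3) :
    (starGraph n).Adj (some (i, k)) (some (j, m)) ↔ i = j ∧ k ≠ m := by
  simp only [starGraph, SimpleGraph.fromRel_adj, ne_eq, Option.some.injEq, Prod.mk.injEq, not_and]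
  constructor
  · rintro ⟨h, rfl | rfl⟩ <;> exact ⟨rfl, h rfl⟩
  · rintro ⟨rfl, h⟩; exact ⟨fun _ => h, .inl rfl⟩

theorem starGraph_admissible (hn : 2 ≤ n) : Admissible (starGraph n) := by
  have hreach : ∀ v, (starGraph n).Reachable none v := by
    rintro (_ | ⟨i, k⟩)
    · exact .refl _
    · have h1 : (starGraph n).Reachable none (some (i, 0)) :=
        SimpleGraph.Adj.reachable (by simp)
      by_cases hk : k = 0
      · rwa [hk]
      · exact h1.trans (SimpleGraph.Adj.reachable (by simpa using Ne.symm hk))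
  refine ⟨⟨fun a b => (hreach a).symm.trans (hreach b)⟩, ?_⟩
  rintro (_ | ⟨i, k⟩)
  · exact two_le_ncard (a := some (⟨0, by omega⟩, 0)) (b := some (⟨1, by omega⟩, 0))
      (by simp) (by simp) (by simp)
  · refine two_le_ncard (a := some (i, k + 1)) (b := some (i, k + 2)) ?_ ?_ ?_
    · simp
    · simp
    · simp

/-- The triangle of an arm has degrees 3, 2, 2, and with cost one per turn this is the summand `7n`.
-/
theorem starGraph_sum_degree : ∑ v ∈ Finset.univ.erase (none : Option (Fin n × Fin 3)),
    ((starGraph n).neighborSet v).ncard = 7 * n := by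
  have h0 : ∀ i : Fin n, ((starGraph n).neighborSet (some (i, 0))).ncard = 3 := fun i => by
    rw [show (starGraph n).neighborSet (some (i, 0)) =
      (({none, some (i, 1), some (i, 2)} : Finset (Option (Fin n × Fin 3))) : Set _) by
        ext (_ | ⟨j, k⟩)
        · simp
        · fin_cases k <;> simp [eq_comm], Set.ncard_coe_finset]
    simp
  have h1 : ∀ i : Fin n, ((starGraph n).neighborSet (some (i, 1))).ncard = 2 := fun i => by
    rw [show (starGraph n).neighborSet (some (i, 1)) =
      (({some (i, 0), some (i, 2)} : Finset (Option (Fin n × Fin 3))) : Set _) by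
        ext (_ | ⟨j, k⟩)
        · simp
        · fin_cases k <;> simp [eq_comm], Set.ncard_coe_finset]
    simp
  have h2 : ∀ i : Fin n, ((starGraph n).neighborSet (some (i, 2))).ncard = 2 := fun i => by
    rw [show (starGraph n).neighborSet (some (i, 2)) =
      (({some (i, 0), some (i, 1)} : Finset (Option (Fin n × Fin 3))) : Set _) by
        ext (_ | ⟨j, k⟩)
        · simp
        · fin_cases k <;> simp [eq_comm], Set.ncard_coe_finset]
    simp
  have := Finset.add_sum_erase Finset.univ
    (fun v => ((starGraph n).neighborSet v).ncard) (Finset.mem_univ none)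
  rw [Fintype.sum_option, Nat.add_left_cancel_iff] at this
  rw [this, Fintype.sum_prod_type]
  simp only [Fin.sum_univ_three, h0, h1, h2, Finset.sum_const, Finset.card_univ, Fintype.card_fin,
    smul_eq_mul]
  ring

theorem exists_tour_iff_starGraph (hn : 2 ≤ n) (d : Fin n → Fin n → ℝ≥0)
    (hd : ∀ i j, d i j = d j i) (C : ℝ≥0) :
    (∃ l, IsTour Set.univ l ∧ tourLength d l ≤ C) ↔
      ∃ (u : Option (Fin n × Fin 3)) (W : (starGraph n).Walk u u),
        IsExactlyDoubleThreading W ∧ (starCosts d hd).walkCost W ≤ C + 7 * n := by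
  have h := exists_threading_le_iff (starGraph_admissible hn) (α := starCosts d hd) (c := none)
    (r := fun i => some (i, 0)) (d := d) (κ := 1) ?_ (fun _ _ => rfl) ?_ C
  · rw [h, starGraph_sum_degree]
    simp
  · refine ⟨fun i _ => by simp, fun i _ j _ h => by simpa using h, ?_⟩
    rintro (_ | ⟨j, k⟩) h
    · simp at h
    · obtain rfl : k = 0 := by simpa using h
      exact ⟨j, trivial, rfl⟩
  · rintro (_ | ⟨i, k⟩) hv x y
    · exact absurd rfl hv
    · rcases x with _ | ⟨a, b⟩ <;> rfl

end Star

/-! ## Reading off a tour at a cut vertex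

If every walk that leaves `c` returns to `c` along the same edge, then the neighbours of `c` in the
order in which a threading enters them form a tour. -/

section Entries

variable {V : Type*} [DecidableEq V] {G : SimpleGraph V}

/-- The vertices that a walk enters from `c`. -/
def entries (c : V) (ds : List G.Dart) : List V := (ds.filter fun d => d.fst = c).map fun d => d.snd

/-- The vertices from which a walk enters `c`. -/
def exits (c : V) (ds : List G.Dart) : List V := (ds.filter fun d => d.snd = c).map fun d => d.fst

theorem entries_cons (c : V) (d : G.Dart) (ds : List G.Dart) :
    entries c (d :: ds) = if d.fst = c then d.snd :: entries c ds else entries c ds := by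
  by_cases h : d.fst = c <;> simp [entries, h]

theorem exits_cons (c : V) (d : G.Dart) (ds : List G.Dart) :
    exits c (d :: ds) = if d.snd = c then d.fst :: exits c ds else exits c ds := by
  by_cases h : d.snd = c <;> simp [exits, h]

theorem isRotated_filter_map {X Y : Type*} {l l' : List X} (h : l ~r l') (p : X → Bool)
    (f : X → Y) : ((l.filter p).map f) ~r ((l'.filter p).map f) := by
  obtain ⟨k, hk, rfl⟩ := List.isRotated_iff_mod.1 h
  rw [List.rotate_eq_drop_append_take hk]
  conv_lhs => rw [← List.take_append_drop k l]
  simp only [List.filter_append, List.map_append]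
  exact List.isRotated_append

theorem cycleEdges_rotate {X : Type*} (l : List X) (k : ℕ) :
    cycleEdges (l.rotate k) = cycleEdges l := by
  rw [cycleEdges, cycleEdges, List.rotate_rotate, add_comm k 1, ← List.rotate_rotate,
    ← List.zipWith_rotate_distrib _ _ _ _ (by simp), Multiset.coe_eq_coe]
  exact List.rotate_perm _ _

theorem cycleEdges_isRotated {X : Type*} {l l' : List X} (h : l ~r l') :
    cycleEdges l = cycleEdges l' := by
  obtain ⟨k, rfl⟩ := h
  rw [cycleEdges_rotate]

theorem junction_isRotated {u u' : V} {W : G.Walk u u} {W' : G.Walk u' u'}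
    (h : W.darts ~r W'.darts) (v : V) : junction W v = junction W' v := by
  obtain ⟨k, hk⟩ := h
  rw [junction, junction, turns, turns, ← hk, List.rotate_rotate, add_comm k 1,
    ← List.rotate_rotate, ← List.zipWith_rotate_distrib _ _ _ _ (by simp), Multiset.coe_eq_coe]
  exact ((List.rotate_perm _ _).symm.filter _).map _

variable {c : V} {r : V → V}

/-- The map `r` sends a vertex to the neighbour of `c` through which its branch hangs. It is
constant while the walk stays away from `c`, so a branch entered at `w` is left at `w`. A walk that
starts inside a branch has one more exit, namely `r a`. -/
theorem exits_eq_entries (h1 : ∀ w, G.Adj c w → r w = w)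
    (h2 : ∀ v w, v ≠ c → w ≠ c → G.Adj v w → r v = r w) {a : V} (p : G.Walk a c) :
    exits c p.darts = if a = c then entries c p.darts else r a :: entries c p.darts := by
  suffices ∀ b (p : G.Walk a b), b = c →
    exits c p.darts = if a = c then entries c p.darts else r a :: entries c p.darts from this _ p rfl
  clear p
  intro b p
  induction p with
  | nil => rintro rfl; simp [exits, entries]
  | @cons a b x hab p ih =>
    intro hx
    rw [SimpleGraph.Walk.darts_cons, exits_cons, entries_cons, ih hx]
    by_cases ha : a = c
    · subst ha
      simp [hab.ne', h1 b hab]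
    · by_cases hb : b = c
      · subst hb
        simp [ha, h1 a hab.symm]
      · simp [ha, hb, h2 a b ha hb hab]

/-- A turn at `c` pairs the neighbour from which `c` is reached with the neighbour entered next. The
dart `e` stands for the first dart of the closed walk, which follows its last one. -/
theorem turns_eq_zipWith_exits {a : V} (p : G.Walk a c) {e : G.Dart} (he : e.fst = c) :
    ((List.zipWith (fun d e : G.Dart => (d.fst, d.snd, e.snd)) p.darts (p.darts.tail ++ [e])).filter
      fun t => t.2.1 = c).map (fun t => s(t.1, t.2.2)) =
      List.zipWith (fun x y => s(x, y)) (exits c p.darts) (entries c p.darts.tail ++ [e.snd]) := by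
  suffices ∀ b (p : G.Walk a b), b = c →
    ((List.zipWith (fun d e : G.Dart => (d.fst, d.snd, e.snd)) p.darts (p.darts.tail ++ [e])).filter
      fun t => t.2.1 = c).map (fun t => s(t.1, t.2.2)) =
      List.zipWith (fun x y => s(x, y)) (exits c p.darts) (entries c p.darts.tail ++ [e.snd]) from
    this _ p rfl
  clear p
  intro b p
  induction p with
  | nil => intro _; simp [exits]
  | @cons a b x hab p ih =>
    intro hx
    have ih := ih hx
    cases p with
    | nil => subst hx; simp [exits, entries]
    | @cons _ b' _ hb p =>
      rw [SimpleGraph.Walk.darts_cons, SimpleGraph.Walk.darts_cons] at *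
      simp only [List.tail_cons, List.cons_append, List.zipWith_cons_cons] at ih ⊢
      rw [List.filter_cons, exits_cons, entries_cons]
      by_cases hbc : b = c
      · simp only [hbc, decide_true, if_true, List.map_cons, List.cons_append,
          List.zipWith_cons_cons]
        simp only [hbc] at ih
        rw [ih]
      · simp only [hbc, decide_false, if_false]
        exact ih

/-- The turns at `c` join the neighbours of `c` in the order in which they are entered. -/
theorem junction_eq_cycleEdges_entries (h1 : ∀ w, G.Adj c w → r w = w)
    (h2 : ∀ v w, v ≠ c → w ≠ c → G.Adj v w → r v = r w) {u : V} {W : G.Walk u u}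
    (hc : c ∈ W.support) : junction W c = cycleEdges (entries c W.darts) := by
  -- Started at `c`, the walk has no half-finished branch, and its first dart is the entry that
  -- completes the last turn.
  have hrot : (W.rotate c hc).darts ~r W.darts := W.rotate_darts c hc
  have he : cycleEdges (entries c (W.rotate c hc).darts) = cycleEdges (entries c W.darts) :=
    cycleEdges_isRotated (isRotated_filter_map hrot _ _)
  rw [← junction_isRotated hrot, ← he]
  generalize W.rotate c hc = W'
  have key := exits_eq_entries h1 h2 W'
  rw [if_pos rfl] at key
  cases W' with
  | nil => simp [junction, turns, entries, cycleEdges]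
  | @cons _ b _ hcb p =>
    have h3 := turns_eq_zipWith_exits (.cons hcb p) (e := ⟨(c, b), hcb⟩) rfl
    rw [junction, turns, SimpleGraph.Walk.darts_cons, List.rotate_cons_succ, List.rotate_zero]
    rw [SimpleGraph.Walk.darts_cons] at h3 key
    rw [List.tail_cons] at h3
    rw [h3, key, cycleEdges, entries_cons, if_pos rfl, List.rotate_cons_succ, List.rotate_zero]

/-- A multiset of edges determines which lists run through it as a cycle on given vertices. -/
theorem isTour_of_cycleEdges_eq {S : Set V} {l l' : List V} (hl : IsTour S l)
    (h : cycleEdges l' = cycleEdges l) : IsTour S l' := by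
  have hc : ∀ z, l'.count z = l.count z := fun z => by
    have := congrArg (multiDegree z) h
    rw [multiDegree_cycleEdges, multiDegree_cycleEdges] at this
    omega
  have := List.perm_iff_count.2 hc
  exact ⟨this.nodup_iff.2 hl.1, fun x => by rw [this.mem_iff, hl.2]⟩

end Entries

/-! ## The star of arms on an initial segment of the natural numbers -/

section Arm

variable {n : ℕ} {R : Type*}

/-- The star of arms with the centre `3n`; the arm `i` is the triangle on `3i`, `3i + 1`, `3i + 2`,
and `3i` is joined to the centre. -/
def armGraph (n : ℕ) : SimpleGraph (Fin (3 * n + 1)) where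
  Adj a b := (a : ℕ) ≠ b ∧ ((a : ℕ) / 3 = b / 3 ∨
    (((a : ℕ) = 3 * n ∨ (b : ℕ) = 3 * n) ∧ (a : ℕ) % 3 = 0 ∧ (b : ℕ) % 3 = 0))
  symm := ⟨fun _ _ h => ⟨h.1.symm, h.2.imp Eq.symm fun h => ⟨h.1.symm, h.2.2, h.2.1⟩⟩⟩
  loopless := ⟨fun _ h => h.1 rfl⟩

theorem armGraph_adj {a b : Fin (3 * n + 1)} : (armGraph n).Adj a b ↔
    (a : ℕ) ≠ b ∧ ((a : ℕ) / 3 = b / 3 ∨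
      (((a : ℕ) = 3 * n ∨ (b : ℕ) = 3 * n) ∧ (a : ℕ) % 3 = 0 ∧ (b : ℕ) % 3 = 0)) := Iff.rfl

theorem armGraph_adj_mk {x y : ℕ} {hx : x < 3 * n + 1} {hy : y < 3 * n + 1}
    (h : x ≠ y ∧ (x / 3 = y / 3 ∨ ((x = 3 * n ∨ y = 3 * n) ∧ x % 3 = 0 ∧ y % 3 = 0))) :
    (armGraph n).Adj ⟨x, hx⟩ ⟨y, hy⟩ := h

/-- The centre of the star. -/
def armCentre (n : ℕ) : Fin (3 * n + 1) := ⟨3 * n, by omega⟩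

/-- The arm of a vertex. -/
def armIndex (hn : 0 < n) (a : Fin (3 * n + 1)) : Fin n := ⟨(a : ℕ) / 3 % n, Nat.mod_lt _ hn⟩

/-- Turning at the centre costs `d`, every other turn is free. -/
def armCosts [Zero R] (hn : 0 < n) (d : Fin n → Fin n → R) (hd : ∀ i j, d i j = d j i) :
    TurnCosts (Fin (3 * n + 1)) R where
  cost u v w := if v = armCentre n then d (armIndex hn u) (armIndex hn w) else 0
  symm u v w := by rw [hd]

theorem armGraph_admissible (hn : 2 ≤ n) : Admissible (armGraph n) := by
  have hreach : ∀ v, (armGraph n).Reachable (armCentre n) v := by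
    intro v
    have hv := v.2
    have h1 : (armGraph n).Reachable (armCentre n) ⟨3 * (v / 3), by omega⟩ := by
      by_cases h : 3 * ((v : ℕ) / 3) = 3 * n
      · have : armCentre n = ⟨3 * (v / 3), by omega⟩ := Fin.ext h.symm
        rw [this]
      · exact SimpleGraph.Adj.reachable (armGraph_adj_mk (by omega))
    by_cases h : (v : ℕ) = 3 * (v / 3)
    · rw [show v = ⟨3 * (v / 3), by omega⟩ from Fin.ext h]
      exact h1
    · exact h1.trans (SimpleGraph.Adj.reachable (armGraph_adj_mk (by omega)))
  refine ⟨⟨fun a b => (hreach a).symm.trans (hreach b)⟩, fun v => ?_⟩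
  have hv := v.2
  by_cases hc : (v : ℕ) = 3 * n
  · exact two_le_ncard (a := ⟨0, by omega⟩) (b := ⟨3, by omega⟩)
      (armGraph_adj_mk (by omega)) (armGraph_adj_mk (by omega)) (by simp)
  · refine two_le_ncard (a := ⟨3 * (v / 3) + (v + 1) % 3, by omega⟩)
      (b := ⟨3 * (v / 3) + (v + 2) % 3, by omega⟩)
      (armGraph_adj_mk (by omega)) (armGraph_adj_mk (by omega)) ?_
    simp only [ne_eq, Fin.mk.injEq]
    omega

theorem armGraph_adj_centre {v : Fin (3 * n + 1)} :
    (armGraph n).Adj (armCentre n) v ↔ (v : ℕ) ≠ 3 * n ∧ (v : ℕ) % 3 = 0 := by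
  rw [armGraph_adj, show ((armCentre n : Fin _) : ℕ) = 3 * n from rfl]
  have := v.2
  omega

theorem armGraph_bijOn : Set.BijOn (fun i : Fin n => (⟨3 * i, by omega⟩ : Fin (3 * n + 1)))
    Set.univ ((armGraph n).neighborSet (armCentre n)) := by
  refine ⟨fun i _ => ?_, fun i _ j _ h => ?_, fun v hv => ?_⟩
  · have := i.2
    exact armGraph_adj_centre.2 (show 3 * (i : ℕ) ≠ 3 * n ∧ 3 * (i : ℕ) % 3 = 0 by omega)
  · simp only [Fin.mk.injEq] at h
    ext; omega
  · have h := armGraph_adj_centre.1 hv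
    have := v.2
    exact ⟨⟨v / 3, by omega⟩, trivial, Fin.ext (by simp only; omega)⟩

/-- The reduction modulo `n` in `armIndex` has an effect only at the centre. -/
theorem armIndex_mul (hn : 0 < n) (i : Fin n) : armIndex hn ⟨3 * i, by omega⟩ = i := by
  have := i.2
  ext
  simp only [armIndex]
  rw [Nat.mul_div_cancel_left _ (by norm_num), Nat.mod_eq_of_lt i.2]

/-- Because the turns inside the arms are free, the bound `C` is not shifted and optimal values
agree. The reductions use this variant of the star. -/
theorem exists_tour_iff_armGraph [AddCommMonoid R] [LinearOrder R] [IsOrderedCancelAddMonoid R]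
    (hn : 2 ≤ n) (d : Fin n → Fin n → R) (hd : ∀ i j, d i j = d j i) (C : R) :
    (∃ l, IsTour Set.univ l ∧ tourLength d l ≤ C) ↔
      ∃ (u : Fin (3 * n + 1)) (W : (armGraph n).Walk u u), IsExactlyDoubleThreading W ∧
        (armCosts (by omega) d hd).walkCost W ≤ C := by
  rw [exists_threading_le_iff (armGraph_admissible hn) (α := armCosts (by omega) d hd)
    armGraph_bijOn (d := d) (κ := 0) (fun i j => ?_) (fun v hv _ _ => if_neg hv) C]
  · simp
  · simp only [armCosts, if_true]
    rw [armIndex_mul, armIndex_mul]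

/-- The tour of an exactly-double threading of the star of arms. -/
theorem IsExactlyDoubleThreading.arm_tour [AddCommMonoid R] (hn : 2 ≤ n) (d : Fin n → Fin n → R)
    (hd : ∀ i j, d i j = d j i) {u : Fin (3 * n + 1)} {W : (armGraph n).Walk u u}
    (hW : IsExactlyDoubleThreading W) :
    IsTour Set.univ ((entries (armCentre n) W.darts).map (armIndex (n := n) (by omega))) ∧
      tourLength d ((entries (armCentre n) W.darts).map (armIndex (n := n) (by omega))) =
        (armCosts (by omega) d hd).walkCost W := by
  obtain ⟨l, hl, hcost⟩ := hW.exists_tours (armCosts (by omega) d hd)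
  have hc : armCentre n ∈ W.support :=
    W.fst_mem_support_of_mem_edges (hW.covers s(armCentre n, ⟨0, by omega⟩)
      (armGraph_adj_centre.2 (show (0 : ℕ) ≠ 3 * n ∧ 0 % 3 = 0 by omega)))
  have hj : junction W (armCentre n) = cycleEdges (entries (armCentre n) W.darts) := by
    -- The foot of the arm of `v` is obtained by rounding down to a multiple of three; apart from
    -- the centre, adjacent vertices lie on the same arm.
    refine junction_eq_cycleEdges_entries (r := fun v => ⟨3 * (v / 3), by have := v.2; omega⟩)
      (fun w hw => ?_) (fun v w hv hw h => ?_) hc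
    · have := armGraph_adj_centre.1 hw
      ext
      simp only
      omega
    · have h := armGraph_adj.1 h
      have hv' : (v : ℕ) ≠ 3 * n := fun h => hv (Fin.ext h)
      have hw' : (w : ℕ) ≠ 3 * n := fun h => hw (Fin.ext h)
      ext
      simp only
      omega
  have htour := isTour_of_cycleEdges_eq (hl (armCentre n)).1 (hj.symm.trans (hl _).2)
  refine ⟨htour.map ?_, ?_⟩
  · refine ⟨fun _ _ => trivial, fun v hv w hw h => ?_, fun i _ => ?_⟩
    · have hv := armGraph_adj_centre.1 hv
      have hw := armGraph_adj_centre.1 hw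
      have h1 := v.2
      have h2 := w.2
      simp only [armIndex, Fin.mk.injEq] at h
      rw [Nat.mod_eq_of_lt (by omega), Nat.mod_eq_of_lt (by omega)] at h
      ext
      omega
    · exact ⟨_, armGraph_bijOn.mapsTo (x := i) trivial, armIndex_mul _ i⟩
  · have h0 : ∀ v, v ≠ armCentre n →
        tourLength (fun x y => (armCosts (by omega) d hd).cost x v y) (l v) = 0 := fun v hv => by
      have : (fun x y => (armCosts (by omega) d hd).cost x v y) = fun _ _ => 0 := by
        ext x y; exact if_neg hv
      rw [this, tourLength_const, smul_zero]
    rw [hcost, Finset.sum_eq_single (armCentre n) (fun v _ hv => h0 v hv) (by simp),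
      tourLength_eq_sum_cycleEdges (fun x y => (armCosts (by omega) d hd).symm x _ y),
      ← (hl _).2, hj, ← tourLength_eq_sum_cycleEdges, tourLength_map]
    congr 1
    ext x y
    simp [armCosts]

end Arm

/-! ## Reductions as computations of families -/

/-- The context of a reduction without oracle. -/
def instCtx {I : Type*} (enc : I → Val) : Ctx I where
  oracle _ _ := .num 0
  size x := (enc x).size
  inp := enc

/-- The context of a reduction with an oracle for `Q`. -/
def oracleCtx (P Q : Problem) :
    Ctx ({O : Val → Val // ∀ q, Q.Sol q (O (Q.enc q))} × P.Inst) where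
  oracle i := i.1.1
  size i := (P.enc i.2).size
  inp i := P.enc i.2

theorem KarpReducible.of_polyTime {P Q : DecisionProblem} (f : P.Inst → Q.Inst)
    (hf : PolyTime (instCtx P.enc) fun x => Q.enc (f x)) (h : ∀ x, P.Yes x ↔ Q.Yes (f x)) :
    KarpReducible P Q := by
  obtain ⟨c, T, ⟨p, hp⟩, hc⟩ := hf
  refine ⟨c, p, fun x => ?_⟩
  obtain ⟨t, ht, hr⟩ := hc x
  exact ⟨f x, t, hr, ht.trans (hp x), h x⟩

/-- The oracle is part of the index of the family, so a single program and a single polynomial serve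
all correct oracles. -/
theorem TuringReducible.of_polyTime {P Q : Problem}
    (h : ∃ y, PolyTime (oracleCtx P Q) y ∧ ∀ i, P.Sol i.2 (y i)) : TuringReducible P Q := by
  obtain ⟨y, ⟨c, T, ⟨p, hp⟩, hc⟩, h⟩ := h
  refine ⟨c, p, fun O hO x => ?_⟩
  obtain ⟨t, ht, hr⟩ := hc (⟨O, hO⟩, x)
  exact ⟨y (⟨O, hO⟩, x), t, hr, ht.trans (hp (⟨O, hO⟩, x)), h (⟨O, hO⟩, x)⟩

theorem encFins_eq {n : ℕ} (l : List (Fin n)) :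
    encFins l = encList (l.map fun i : Fin n => .num i) := by
  simp only [encFins]
  congr 1
  induction l with
  | nil => rfl
  | cons a l ih =>
    rw [List.map_cons, ← ih]
    rfl

namespace PolyTime

variable {ι : Type*} {Γ : Ctx ι}

theorem inp_instCtx {I : Type*} (enc : I → Val) : PolyTime (instCtx enc) enc := inp (.self _)

theorem inp_oracleCtx (P Q : Problem) : PolyTime (oracleCtx P Q) fun i => P.enc i.2 :=
  inp (.self _)

/-- The lookup in a list of numbers. -/
theorem getFins {n : ι → ℕ} {L : ∀ i, List (Fin (n i))} {k : ι → ℕ}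
    (h : PolyTime Γ fun i => encFins (L i)) (hk : PolyTime Γ fun i => .num (k i))
    (hkl : ∀ i, k i < (L i).length) : PolyTime Γ fun i => .num ((L i)[k i]'(hkl i)) :=
  (PolyTime.get (h.congr fun i => encFins_eq (L i)) hk fun i => by simpa using hkl i).congr
    fun i => by simp

theorem lengthFins {n : ι → ℕ} {L : ∀ i, List (Fin (n i))}
    (h : PolyTime Γ fun i => encFins (L i)) : PolyTime Γ fun i => .num (L i).length :=
  (PolyTime.length (h.congr fun i => encFins_eq (L i))).congr fun i => by simp

theorem encFins_length_bdd {n : ι → ℕ} {L : ∀ i, List (Fin (n i))}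
    (h : PolyTime Γ fun i => encFins (L i)) : PolyBdd Γ.size fun i => (L i).length :=
  (length_bdd (h.congr fun i => encFins_eq (L i))).mono fun i => by simp

theorem _root_.Threading.size_encFins_le {n : ℕ} (l : List (Fin n)) :
    (encFins l).size ≤ l.length * (n + 2) + 1 := by
  rw [encFins_eq]
  refine (size_encList_le (B := n + 1) ?_).trans (by simp)
  simp only [List.mem_map]
  rintro v ⟨i, -, rfl⟩
  have := Nat.size_le_self (i : ℕ)
  have := i.2
  simp only [Val.size]
  omega

/-- The collected list of a family of numbers. -/
theorem collectFins {n m : ι → ℕ} {g : ∀ i, Fin (n i) → Fin (m i)} {c : ∀ i, Fin (n i) → Bool}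
    (hn : PolyTime Γ fun i => .num (n i)) (hnb : PolyBdd Γ.size n)
    (hc : PolyDec (Γ.loop n) fun q => c q.1 q.2)
    (hg : PolyTime (Γ.loop n) fun q => .num (g q.1 q.2)) :
    PolyTime Γ fun i => encFins (((List.finRange (n i)).filter (c i)).map (g i)) :=
  (collect hn hnb hc hg).congr fun i => by
    rw [encFins_eq, List.map_map]

/-! ### Reading an encoded distance matrix. -/

section Cities

variable {X : ι → Cities} (h : PolyTime Γ fun i => (X i).enc)
include h

theorem cities_n : PolyTime Γ fun i => .num (X i).n := fst (z := fun i =>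
  encFn fun a => encFn fun b => encRat ((X i).d a b)) h

theorem cities_table : PolyTime Γ fun i => encFn fun a => encFn fun b => encRat ((X i).d a b) :=
  snd (y := fun i => .num (X i).n) h

theorem cities_bdd : PolyBdd Γ.size fun i => (X i).n := encFn_bdd (cities_table h)

theorem cities_d {a b : ∀ i, Fin (X i).n} (ha : PolyTime Γ fun i => .num (a i))
    (hb : PolyTime Γ fun i => .num (b i)) : PolyTime Γ fun i => encRat ((X i).d (a i) (b i)) :=
  app (f := fun i b => encRat ((X i).d (a i) b))
    (app (f := fun i a => encFn fun b => encRat ((X i).d a b)) (cities_table h) ha) hb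

end Cities

/-! ### Writing an encoded graph with turn costs. -/

section CostGraph

open Classical in
/-- The cost of a turn, and `0` where there is no turn. -/
noncomputable def _root_.Threading.CostGraph.turnCost (X : CostGraph) (v u w : Fin X.n) : ℚ≥0 :=
  if X.G.Adj v u ∧ X.G.Adj v w ∧ u ≠ w then X.α.cost u v w else 0

variable {X : ι → CostGraph}

open Classical in
theorem _root_.Threading.CostGraph.enc_eq (X : CostGraph) : X.enc = .pair (.num X.n) (.pair
    (encFn fun u => encFn fun v => .num (if X.G.Adj u v then 1 else 0))
    (encFn fun v => encFn fun u => encFn fun w => encRat (X.turnCost v u w))) := rfl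

theorem costGraph_enc (hn : PolyTime Γ fun i => .num (X i).n)
    (hnb : PolyBdd Γ.size fun i => (X i).n)
    (ha : PolyDec ((Γ.loop fun i => (X i).n).loop fun q => (X q.1).n)
      fun q => (X q.1.1).G.Adj q.1.2 q.2)
    (hc : PolyTime (((Γ.loop fun i => (X i).n).loop fun q => (X q.1).n).loop
      fun q => (X q.1.1).n) fun q => encRat ((X q.1.1.1).turnCost q.1.1.2 q.1.2 q.2)) :
    PolyTime Γ fun i => (X i).enc := by
  have hn1 := hn.inLoop hnb
  have hnb1 : PolyBdd (Γ.loop fun i => (X i).n).size fun q => (X q.1).n := hnb.reindex _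
  have hn2 := hn1.inLoop hnb1
  have hnb2 : PolyBdd ((Γ.loop fun i => (X i).n).loop fun q => (X q.1).n).size
    fun q => (X q.1.1).n := hnb1.reindex _
  simp only [CostGraph.enc_eq]
  classical
  exact hn.pair ((tabulate hn hnb (tabulate hn1 hnb1 (PolyDec.num ha))).pair
    (tabulate hn hnb (tabulate hn1 hnb1 (tabulate hn2 hnb2 hc))))

end CostGraph

end PolyTime

/-! ## From tours to threadings -/

/-- Two cities at distance `0`. -/
def twoCities : Cities where
  n := 2
  pos := by norm_num
  d _ _ := 0
  symm _ _ := rfl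
  diag _ := rfl

/-- A single city is replaced by two. -/
def Cities.pad (X : Cities) : Cities := if 2 ≤ X.n then X else twoCities

theorem Cities.pad_of_le {X : Cities} (h : 2 ≤ X.n) : X.pad = X := if_pos h

theorem Cities.pad_of_not_le {X : Cities} (h : ¬ 2 ≤ X.n) : X.pad = twoCities := if_neg h

theorem Cities.two_le_pad (X : Cities) : 2 ≤ X.pad.n := by
  by_cases h : 2 ≤ X.n
  · rwa [Cities.pad_of_le h]
  · rw [Cities.pad_of_not_le h]
    exact le_rfl

theorem Cities.isTour_singleton {X : Cities} (h : ¬ 2 ≤ X.n) :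
    IsTour Set.univ [(⟨0, X.pos⟩ : Fin X.n)] := by
  refine ⟨by simp, fun x => ?_⟩
  have := x.2
  simp only [List.mem_singleton, Set.mem_univ, iff_true, Fin.ext_iff]
  omega

/-- The centre of the star needs degree two. A single city has a tour of length zero, as do two
cities at distance zero, so both answers are yes for every `C`. -/
theorem Cities.exists_tour_pad_iff (X : Cities) (C : ℚ≥0) :
    (∃ l, IsTour Set.univ l ∧ tourLength X.pad.d l ≤ C) ↔
      ∃ l, IsTour Set.univ l ∧ tourLength X.d l ≤ C := by
  by_cases h : 2 ≤ X.n
  · rw [Cities.pad_of_le h]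
  · rw [Cities.pad_of_not_le h]
    constructor
    · rintro -
      exact ⟨_, Cities.isTour_singleton h, by simp [tourLength, X.diag]⟩
    · rintro -
      refine ⟨[(0 : Fin 2), (1 : Fin 2)], ⟨by decide, fun x => ?_⟩, by simp [tourLength, twoCities]⟩
      have : ∀ x : Fin 2, x ∈ [(0 : Fin 2), 1] := by decide
      exact iff_of_true (this x) trivial

theorem PolyTime.pad {ι : Type*} {Γ : Ctx ι} {X : ι → Cities}
    (h : PolyTime Γ fun i => (X i).enc) : PolyTime Γ fun i => (X i).pad.enc :=
  (PolyTime.ite (PolyDec.le (h.const (.num 2)) h.cities_n) h (h.const twoCities.enc)).congr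
    fun i => by unfold Cities.pad; split_ifs <;> rfl

/-- The star of arms of an instance with at least two cities. -/
def armInstance (X : Cities) (h : 2 ≤ X.n) : CostGraph where
  n := 3 * X.n + 1
  G := armGraph X.n
  admissible := armGraph_admissible h
  α := armCosts X.pos X.d X.symm

theorem PolyDec.armGraph_adj {ι : Type*} {Γ : Ctx ι} {n : ι → ℕ} {a b : ∀ i, Fin (3 * n i + 1)}
    (hn : PolyTime Γ fun i => .num (n i)) (ha : PolyTime Γ fun i => .num (a i))
    (hb : PolyTime Γ fun i => .num (b i)) : PolyDec Γ fun i => (armGraph (n i)).Adj (a i) (b i) :=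
  (PolyDec.eq ha hb).not.and ((PolyDec.eq (ha.divC 3) (hb.divC 3)).or
    (((PolyDec.eq ha (hn.mulC 3)).or (PolyDec.eq hb (hn.mulC 3))).and
      ((PolyDec.eqC (ha.modC 3) 0).and (PolyDec.eqC (hb.modC 3) 0))))

theorem PolyTime.armInstance {ι : Type*} {Γ : Ctx ι} {X : ι → Cities} (h2 : ∀ i, 2 ≤ (X i).n)
    (h : PolyTime Γ fun i => (X i).enc) :
    PolyTime Γ fun i => (armInstance (X i) (h2 i)).enc := by
  have hb : PolyBdd Γ.size fun i => 3 * (X i).n + 1 :=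
    ((PolyBdd.const _ 3).mul h.cities_bdd).add (.const _ 1)
  have hb1 : PolyBdd (Γ.loop fun i => 3 * (X i).n + 1).size fun q => 3 * (X q.1).n + 1 :=
    hb.reindex _
  have hb2 : PolyBdd ((Γ.loop fun i => 3 * (X i).n + 1).loop fun q => 3 * (X q.1).n + 1).size
    fun q => 3 * (X q.1.1).n + 1 := hb1.reindex _
  have h1 := h.inLoop hb
  have h2' := h1.inLoop hb1
  have h3 := h2'.inLoop hb2
  have v1 := loopVar hb h
  have u2 := loopVar hb1 h1
  have w3 := loopVar hb2 h2'
  have v2 := v1.inLoop hb1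
  have v3 := v2.inLoop hb2
  have u3 := u2.inLoop hb2
  have hr : ∀ {κ : Type _} {Δ : Ctx κ} {Y : κ → Cities} {a : ∀ k, Fin (3 * (Y k).n + 1)},
      PolyTime Δ (fun k => (Y k).enc) → PolyTime Δ (fun k => .num (a k)) →
      PolyTime Δ fun k => .num (armIndex (Y k).pos (a k)) :=
    fun hY ha => (ha.divC 3).mod hY.cities_n
  refine costGraph_enc (X := fun i => Threading.armInstance (X i) (h2 i))
    ((h.cities_n.mulC 3).addC 1) hb (PolyDec.armGraph_adj h2'.cities_n v2 u2) ?_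
  classical
  refine (PolyTime.ite (((PolyDec.armGraph_adj h3.cities_n v3 u3).and
    ((PolyDec.armGraph_adj h3.cities_n v3 w3).and (PolyDec.eq u3 w3).not)).and
    (PolyDec.eq v3 (h3.cities_n.mulC 3))) (h3.cities_d (hr h3 u3) (hr h3 w3))
    (h3.const (encRat 0))).congr fun q => ?_
  obtain ⟨⟨⟨i, v⟩, u⟩, w⟩ := q
  simp only [CostGraph.turnCost, Threading.armInstance, armCosts, armCentre, Fin.ext_iff, ne_eq]
  split_ifs <;> first | rfl | tauto

theorem karpReducible_tspDecision_edtDecision : KarpReducible tspDecision edtDecision := by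
  have h : PolyTime (instCtx tspDecision.enc) fun x => .pair x.1.enc (encRat x.2) :=
    PolyTime.inp_instCtx tspDecision.enc
  refine .of_polyTime (fun x => (armInstance x.1.pad x.1.two_le_pad, x.2))
    ((h.fst.pad.armInstance fun x => x.1.two_le_pad).pair h.snd) fun x => ?_
  exact (x.1.exists_tour_pad_iff x.2).symm.trans
    (exists_tour_iff_armGraph x.1.two_le_pad x.1.pad.d x.1.pad.symm x.2)

/-- The length is the sum of the degrees. This bounds the size of an oracle answer polynomially. -/
theorem IsExactlyDoubleThreading.length_le {n : ℕ} {G : SimpleGraph (Fin n)} {u : Fin n}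
    {W : G.Walk u u} (hW : IsExactlyDoubleThreading W) : W.length ≤ n * n := by
  choose l hl using hW.exists_tour
  rw [length_eq_sum_length fun v => (hl v).2]
  calc ∑ v, (l v).length ≤ ∑ v : Fin n, n := Finset.sum_le_sum fun v _ => by
        simpa using (hl v).1.1.length_le_card
    _ = n * n := by simp

/-- The vertices that a closed walk enters from `c`, in terms of the list of its vertices. -/
theorem entries_eq_filter {V : Type*} [DecidableEq V] {G : SimpleGraph V} {u : V}
    (W : G.Walk u u) (c : V) : entries c W.darts =
      ((List.finRange W.support.tail.length).filter fun j : Fin W.support.tail.length =>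
        decide (W.support.tail[((j : ℕ) + W.support.tail.length - 1) % W.support.tail.length]'
          (Nat.mod_lt _ j.pos) = c)).map fun j : Fin _ => W.support.tail[(j : ℕ)] := by
  have hlen : W.support.tail.length = W.length := by simp
  -- The tail omits the starting vertex, so its entry `j` is vertex `j + 1` of the walk. The vertex
  -- before entry `0` is the last entry of the tail, hence the cyclic predecessor in the statement.
  have hget : ∀ j (h : j < W.support.tail.length), W.support.tail[j] = W.getVert (j + 1) :=
    fun j h => by
      rw [List.getElem_tail, W.support_getElem_eq_getVert]
  have hd : W.darts = (List.finRange W.support.tail.length).map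
      fun j : Fin W.support.tail.length => W.darts[(j : ℕ)]'(by
        have := j.2; simp only [SimpleGraph.Walk.length_darts]; omega) := by
    apply List.ext_getElem
    · simp
    · intro i h1 h2; simp
  rw [entries, hd, List.filter_map, List.map_map]
  simp only [Function.comp_def, SimpleGraph.Walk.darts_getElem_eq_getVert, hget]
  congr 2
  funext j
  congr 2
  have hj := j.2
  rcases Nat.eq_zero_or_pos (j : ℕ) with h0 | h0
  · rw [h0, zero_add, Nat.mod_eq_of_lt (by omega), Nat.sub_add_cancel (by omega), hlen]
    simp
  · rw [show (j : ℕ) + W.support.tail.length - 1 = (j - 1) + W.support.tail.length by omega,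
      Nat.add_mod_right, Nat.mod_eq_of_lt (by omega), Nat.sub_add_cancel h0]

theorem PolyTime.arm_entries {ι : Type*} {Γ : Ctx ι} {n : ι → ℕ} (hpos : ∀ i, 0 < n i)
    {u : ∀ i, Fin (3 * n i + 1)} {W : ∀ i, (armGraph (n i)).Walk (u i) (u i)}
    (hn : PolyTime Γ fun i => .num (n i)) (hO : PolyTime Γ fun i => encFins (W i).support.tail) :
    PolyTime Γ fun i =>
      encFins ((entries (armCentre (n i)) (W i).darts).map (armIndex (hpos i))) := by
  have hmb := hO.encFins_length_bdd
  have hO1 := hO.inLoop hmb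
  have hm1 := hO.lengthFins.inLoop hmb
  have hj := PolyTime.loopVar hmb hO
  have hn1 := hn.inLoop hmb
  refine (PolyTime.collectFins (m := n)
    (g := fun i j => armIndex (hpos i) ((W i).support.tail[(j : ℕ)]))
    (c := fun i j => decide ((W i).support.tail[((j : ℕ) + (W i).support.tail.length - 1) %
      (W i).support.tail.length]'(Nat.mod_lt _ j.pos) = armCentre (n i)))
    hO.lengthFins hmb ?_ ?_).congr fun i => ?_
  · refine (PolyDec.eq (hO1.getFins (((hj.add hm1).subC 1).mod hm1)
      fun q => Nat.mod_lt _ q.2.pos) (hn1.mulC 3)).congr fun q => ?_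
    rw [decide_eq_true_iff, Fin.ext_iff]
    rfl
  · exact ((hO1.getFins hj fun q => q.2.2).divC 3).mod hn1
  · rw [entries_eq_filter, List.map_map]
    rfl

/-- The tour read off at the centre is as long as the threading is expensive. A shorter tour would
give a cheaper threading, so it is optimal. -/
theorem exists_optimal_tour_of_oracle {ι : Type*} {Γ : Ctx ι} {X : ι → Cities}
    (hO : ∀ i (q : CostGraph), edtOptimization.Sol q (Γ.oracle i q.enc))
    (hX : PolyTime Γ fun i => (X i).enc) :
    ∃ y, PolyTime Γ y ∧ ∀ i, tspOptimization.Sol (X i) (y i) := by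
  have hsol : ∀ i, ∃ (u : Fin (3 * (X i).pad.n + 1)) (W : (armGraph (X i).pad.n).Walk u u),
      (armInstance (X i).pad (X i).two_le_pad).IsOptimal W ∧
      Γ.oracle i (armInstance (X i).pad (X i).two_le_pad).enc = encFins W.support.tail :=
    fun i => hO i (armInstance (X i).pad (X i).two_le_pad)
  choose u W hW hans using hsol
  have hN : PolyBdd Γ.size fun i => 3 * (X i).pad.n + 1 :=
    ((PolyBdd.const _ 3).mul hX.pad.cities_bdd).add (.const _ 1)
  have hA : PolyTime Γ fun i => encFins (W i).support.tail := by
    refine ((hX.pad.armInstance fun i => (X i).two_le_pad).oracle ?_).congr hans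
    refine (((hN.mul hN).mul (hN.add (.const _ 2))).add (.const _ 1)).mono fun i => ?_
    rw [hans]
    refine (size_encFins_le _).trans ?_
    gcongr
    rw [List.length_tail, SimpleGraph.Walk.length_support, Nat.add_sub_cancel]
    exact (hW i).1.length_le
  refine ⟨_, PolyTime.ite (c := fun i => 2 ≤ (X i).n) (PolyDec.le (hX.const (.num 2)) hX.cities_n)
    (hX.pad.cities_n.arm_entries (fun i => (X i).pad.pos) hA)
    (hX.const (encFins [(0 : Fin 1)])), fun i => ?_⟩
  have hopt : (X i).pad.IsOptimal
      ((entries (armCentre (X i).pad.n) (W i).darts).map (armIndex (X i).pad.pos)) := by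
    obtain ⟨h1, h2⟩ := (hW i).1.arm_tour (X i).two_le_pad (X i).pad.d (X i).pad.symm
    refine ⟨h1, fun l' hl' => ?_⟩
    obtain ⟨u', W', hW', hle⟩ := (exists_tour_iff_armGraph (X i).two_le_pad (X i).pad.d
      (X i).pad.symm (tourLength (X i).pad.d l')).1 ⟨l', hl', le_rfl⟩
    exact h2.trans_le (((hW i).2 u' W' hW').trans hle)
  by_cases h : 2 ≤ (X i).n
  · simp only [h, if_true]
    have : ∃ l, (X i).pad.IsOptimal l ∧ encFins ((entries (armCentre (X i).pad.n)
      (W i).darts).map (armIndex (X i).pad.pos)) = encFins l := ⟨_, hopt, rfl⟩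
    generalize encFins ((entries (armCentre (X i).pad.n) (W i).darts).map
      (armIndex (X i).pad.pos)) = y at this
    rwa [Cities.pad_of_le h] at this
  · simp only [h, if_false]
    refine ⟨_, ⟨Cities.isTour_singleton h, fun l' _ => ?_⟩, ?_⟩
    · simp [tourLength, (X i).diag]
    · rw [encFins_eq, encFins_eq]
      rfl

theorem turingReducible_tspOptimization_edtOptimization :
    TuringReducible tspOptimization edtOptimization :=
  .of_polyTime (exists_optimal_tour_of_oracle
    (Γ := oracleCtx tspOptimization edtOptimization) (X := fun i => i.2) (fun i => i.1.2)
    (PolyTime.inp_oracleCtx _ _))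

/-! ## The instance of the travelling salesperson problem at a vertex -/

open Classical in
/-- The neighbours of a vertex. -/
noncomputable def CostGraph.nbrs (X : CostGraph) (v : Fin X.n) : List (Fin X.n) :=
  (List.finRange X.n).filter fun u => decide (X.G.Adj v u)

namespace CostGraph

variable (X : CostGraph)

theorem isTour_nbrs (v : Fin X.n) : IsTour (X.G.neighborSet v) (X.nbrs v) :=
  ⟨(List.nodup_finRange _).filter _, fun x => by simp [nbrs]⟩

theorem two_le_length_nbrs (v : Fin X.n) : 2 ≤ (X.nbrs v).length :=
  (X.isTour_nbrs v).two_le_length (X.admissible.two_le_degree v)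

theorem turnCost_symm (v u w : Fin X.n) : X.turnCost v u w = X.turnCost v w u := by
  unfold turnCost
  rw [X.α.symm]
  congr 1
  exact propext ⟨fun h => ⟨h.2.1, h.1, h.2.2.symm⟩, fun h => ⟨h.2.1, h.1, h.2.2.symm⟩⟩

/-- The cities are the edges incident to `v`. -/
noncomputable def junctionCities (v : Fin X.n) : Cities where
  n := (X.nbrs v).length
  pos := by have := X.two_le_length_nbrs v; omega
  d a b := X.turnCost v (X.nbrs v)[(a : ℕ)] (X.nbrs v)[(b : ℕ)]
  symm _ _ := X.turnCost_symm _ _ _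
  diag _ := if_neg fun h => h.2.2 rfl

/-- The neighbour of `v` that is named by a city. -/
noncomputable def nbrAt (v : Fin X.n) (a : Fin (X.junctionCities v).n) : Fin X.n :=
  (X.nbrs v)[(a : ℕ)]'a.2

theorem bijOn_nbrAt (v : Fin X.n) :
    Set.BijOn (X.nbrAt v) Set.univ (X.G.neighborSet v) := by
  refine ⟨fun a _ => ((X.isTour_nbrs v).2 _).1 (List.getElem_mem _), fun a _ b _ h => ?_,
    fun x hx => ?_⟩
  · exact Fin.ext ((X.isTour_nbrs v).1.getElem_inj_iff.1 h)
  · obtain ⟨i, hi, rfl⟩ := List.getElem_of_mem (((X.isTour_nbrs v).2 x).2 hx)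
    exact ⟨⟨i, hi⟩, trivial, rfl⟩

/-- The turn costs with the irrelevant values set to `0`. -/
noncomputable def turnCosts : TurnCosts (Fin X.n) ℚ≥0 where
  cost u v w := X.turnCost v u w
  symm u v w := X.turnCost_symm v u w

/-- Only genuine turns occur in a threading: consecutive edges exist and are distinct. So nothing is
lost by encoding only their costs. -/
theorem walkCost_turnCosts {u : Fin X.n} {W : X.G.Walk u u} (hW : IsExactlyDoubleThreading W) :
    X.turnCosts.walkCost W = X.α.walkCost W := by
  unfold TurnCosts.walkCost
  congr 1
  refine List.map_congr_left fun t ht => ?_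
  have hmem : s(t.1, t.2.2) ∈ junction W t.2.1 :=
    Multiset.mem_coe.2 (List.mem_map.2 ⟨t, List.mem_filter.2 ⟨ht, by simp⟩, rfl⟩)
  exact if_pos ⟨mem_junction_adj hmem (by simp), mem_junction_adj hmem (by simp), hW.noUTurn t ht⟩

theorem tourLength_junctionCities (v : Fin X.n) (l : List (Fin (X.junctionCities v).n)) :
    tourLength (fun x y => X.turnCosts.cost x v y)
      (l.map (X.nbrAt v)) = tourLength (X.junctionCities v).d l :=
  tourLength_map _ _ _

theorem minimal_of_isOptimal {v : Fin X.n} {l : List (Fin (X.junctionCities v).n)}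
    (hl : (X.junctionCities v).IsOptimal l) (l' : List (Fin X.n))
    (hl' : IsTour (X.G.neighborSet v) l') :
    tourLength (fun x y => X.turnCosts.cost x v y)
      (l.map (X.nbrAt v)) ≤
        tourLength (fun x y => X.turnCosts.cost x v y) l' := by
  obtain ⟨t, ht, rfl⟩ := IsTour.exists_map_eq (X.bijOn_nbrAt v) hl'
  rw [tourLength_junctionCities, tourLength_junctionCities]
  exact hl.2 t ht

theorem isTour_of_isOptimal {v : Fin X.n} {l : List (Fin (X.junctionCities v).n)}
    (hl : (X.junctionCities v).IsOptimal l) :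
    IsTour (X.G.neighborSet v) (l.map (X.nbrAt v)) :=
  hl.1.map (X.bijOn_nbrAt v)

theorem exists_threading_le_iff_sum {l : ∀ v, List (Fin (X.junctionCities v).n)}
    (hl : ∀ v, (X.junctionCities v).IsOptimal (l v)) (c : ℚ≥0) :
    (∃ (u : Fin X.n) (W : X.G.Walk u u), IsExactlyDoubleThreading W ∧ X.α.walkCost W ≤ c) ↔
      ∑ v, tourLength (X.junctionCities v).d (l v) ≤ c := by
  simp only [← tourLength_junctionCities]
  constructor
  · rintro ⟨u, W, hW, hc⟩
    rw [← X.walkCost_turnCosts hW] at hc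
    exact (sum_minimal_le X.turnCosts (fun v => X.minimal_of_isOptimal (hl v)) hW).trans hc
  · intro h
    obtain ⟨u, W, hW, -, hc⟩ := exists_threading_eq_sum X.admissible X.turnCosts
      fun v => X.isTour_of_isOptimal (hl v)
    exact ⟨u, W, hW, by rw [← X.walkCost_turnCosts hW, hc]; exact h⟩

end CostGraph

theorem Cities.exists_isOptimal (X : Cities) : ∃ l, X.IsOptimal l :=
  exists_minimal_tour Set.univ X.d

/-! ### Reading an encoded graph and producing its instances at the vertices. -/

namespace PolyTime

variable {ι : Type*} {Γ : Ctx ι}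

section CostGraph

variable {X : ι → CostGraph} (h : PolyTime Γ fun i => (X i).enc)
include h

theorem costGraph_n : PolyTime Γ fun i => .num (X i).n := by
  simp only [CostGraph.enc_eq] at h
  exact h.fst

theorem costGraph_bdd : PolyBdd Γ.size fun i => (X i).n := by
  simp only [CostGraph.enc_eq] at h
  exact h.snd.fst.encFn_bdd

theorem costGraph_adj {u v : ∀ i, Fin (X i).n} (hu : PolyTime Γ fun i => .num (u i))
    (hv : PolyTime Γ fun i => .num (v i)) : PolyDec Γ fun i => (X i).G.Adj (u i) (v i) := by
  classical
  simp only [CostGraph.enc_eq] at h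
  refine PolyDec.of_num ((app (f := fun i v => .num (if (X i).G.Adj (u i) v then 1 else 0))
    (app (f := fun i u => encFn fun v => .num (if (X i).G.Adj u v then 1 else 0))
      (h.snd.fst.congr fun i => ?_) hu) hv).congr fun i => ?_)
  · congr! 4
  · congr

theorem costGraph_turnCost {u v w : ∀ i, Fin (X i).n} (hv : PolyTime Γ fun i => .num (v i))
    (hu : PolyTime Γ fun i => .num (u i)) (hw : PolyTime Γ fun i => .num (w i)) :
    PolyTime Γ fun i => encRat ((X i).turnCost (v i) (u i) (w i)) := by
  simp only [CostGraph.enc_eq] at h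
  exact app (f := fun i w => encRat ((X i).turnCost (v i) (u i) w))
    (app (f := fun i u => encFn fun w => encRat ((X i).turnCost (v i) u w))
      (app (f := fun i v => encFn fun u => encFn fun w => encRat ((X i).turnCost v u w))
        h.snd.snd hv) hu) hw

theorem nbrs {v : ∀ i, Fin (X i).n} (hv : PolyTime Γ fun i => .num (v i)) :
    PolyTime Γ fun i => encFins ((X i).nbrs (v i)) := by
  have hb := h.costGraph_bdd
  refine (collectFins (g := fun _ => id)
    (c := fun i u => @decide ((X i).G.Adj (v i) u) (Classical.propDecidable _)) h.costGraph_n hb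
    (((h.inLoop hb).costGraph_adj (hv.inLoop hb) (loopVar hb h)).congr fun q => ?_)
    (loopVar hb h)).congr fun i => ?_
  · simp
  · rw [List.map_id]
    rfl

theorem junctionCities {v : ∀ i, Fin (X i).n} (hv : PolyTime Γ fun i => .num (v i)) :
    PolyTime Γ fun i => ((X i).junctionCities (v i)).enc := by
  have hL := h.nbrs hv
  have hk : PolyTime Γ fun i => .num ((X i).junctionCities (v i)).n := hL.lengthFins
  have hkb : PolyBdd Γ.size fun i => ((X i).junctionCities (v i)).n := hL.encFins_length_bdd
  have hL1 := hL.inLoop hkb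
  have hkb1 : PolyBdd (Γ.loop fun i => ((X i).junctionCities (v i)).n).size
    fun q => ((X q.1).junctionCities (v q.1)).n := hkb.reindex _
  have hk1 := hk.inLoop hkb
  have hv2 := (hv.inLoop hkb).inLoop hkb1
  have hX2 := (h.inLoop hkb).inLoop hkb1
  have hL2 := hL1.inLoop hkb1
  exact hk.pair (tabulate hk hkb (tabulate hk1 hkb1 (hX2.costGraph_turnCost hv2
    (hL2.getFins ((loopVar hkb h).inLoop hkb1) fun q => q.1.2.2)
    (hL2.getFins (loopVar hkb1 (h.inLoop hkb)) fun q => q.2.2))))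

end CostGraph

theorem encRat_num {r : ι → ℚ≥0} (h : PolyTime Γ fun i => encRat (r i)) :
    PolyTime Γ fun i => .num (r i).num := fst (z := fun i => .num (r i).den) h

theorem encRat_den {r : ι → ℚ≥0} (h : PolyTime Γ fun i => encRat (r i)) :
    PolyTime Γ fun i => .num (r i).den := snd (y := fun i => .num (r i).num) h

end PolyTime

/-! ## The optimal length from the decision problem -/

/-- Encoded rationals are in lowest terms. Queries are chosen with coprime numerator and
denominator, which avoids computing greatest common divisors. -/
theorem encRat_div {a b : ℕ} (hb : 0 < b) (h : a.Coprime b) :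
    encRat ((a : ℚ≥0) / b) = .pair (.num a) (.num b) := by
  have h1 : (((a : ℚ≥0) / b : ℚ≥0) : ℚ) = ((a : ℤ) : ℚ) / ((b : ℤ) : ℚ) := by push_cast; rfl
  have hb' : (0 : ℤ) < b := by exact_mod_cast hb
  have hn := Rat.num_div_eq_of_coprime hb' (a := a) (by simpa using h)
  have hd := Rat.den_div_eq_of_coprime hb' (a := a) (by simpa using h)
  rw [← h1] at hn hd
  have e1 : ((a : ℚ≥0) / b).num = a := by
    rw [NNRat.num, hn]; rfl
  have e2 : ((a : ℚ≥0) / b).den = b := by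
    have : (((a : ℚ≥0) / b).den : ℤ) = b := hd
    exact_mod_cast this
  rw [encRat, e1, e2]

/-- A common multiple of the denominators makes tour lengths integral, so that bisection ends at the
exact value. -/
theorem exists_nat_mul_tourLength {X : Type*} {d : X → X → ℚ≥0} {D : ℕ}
    (hD : ∀ x y, (d x y).den ∣ D) (l : List X) : ∃ T : ℕ, (T : ℚ≥0) = D * tourLength d l := by
  have hr : ∀ r : ℚ≥0, r.den ∣ D → ∃ T : ℕ, (T : ℚ≥0) = D * r := by
    rintro r ⟨k, hk⟩
    refine ⟨k * r.num, ?_⟩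
    rw [hk]
    push_cast
    rw [← NNRat.den_mul_eq_num]
    ring
  have hs : ∀ L : List ℚ≥0, (∀ r ∈ L, r.den ∣ D) → ∃ T : ℕ, (T : ℚ≥0) = D * L.sum := by
    intro L
    induction L with
    | nil => exact fun _ => ⟨0, by simp⟩
    | cons r L ih =>
      intro hL
      obtain ⟨a, ha⟩ := hr r (hL r (by simp))
      obtain ⟨b, hb⟩ := ih fun r hr => hL r (by simp [hr])
      exact ⟨a + b, by push_cast; rw [ha, hb, List.sum_cons, mul_add]⟩
  refine hs _ fun r hr => ?_
  obtain ⟨i, hi, rfl⟩ := List.getElem_of_mem hr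
  rw [List.getElem_zipWith]
  exact hD _ _

/-- A crude integer bound from which bisection can start: a distance is at most its numerator, and a
tour has at most `n` legs. -/
theorem tourLength_le {n : ℕ} (d : Fin n → Fin n → ℚ≥0) {l : List (Fin n)} (hl : l.Nodup) :
    tourLength d l ≤ (n * ∑ a, ∑ b, (d a b).num : ℕ) := by
  have h1 : ∀ r ∈ List.zipWith d l (l.rotate 1), r ≤ ((∑ a, ∑ b, (d a b).num : ℕ) : ℚ≥0) := by
    intro r hr
    obtain ⟨i, hi, rfl⟩ := List.getElem_of_mem hr
    rw [List.getElem_zipWith]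
    generalize l[i]'_ = a
    generalize (l.rotate 1)[i]'_ = b
    calc d a b ≤ ((d a b).num : ℚ≥0) := by
          rw [← NNRat.den_mul_eq_num]
          exact le_mul_of_one_le_left (zero_le) (by exact_mod_cast (d a b).den_pos)
      _ ≤ _ := by
        gcongr
        exact (Finset.single_le_sum (f := fun b => (d a b).num) (fun _ _ => Nat.zero_le _)
          (Finset.mem_univ b)).trans (Finset.single_le_sum (f := fun a => ∑ b, (d a b).num)
          (fun _ _ => Nat.zero_le _) (Finset.mem_univ a))
  refine (List.sum_le_card_nsmul _ _ h1).trans ?_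
  rw [nsmul_eq_mul]
  push_cast
  gcongr
  simpa using hl.length_le_card

/-- One step of the bisection: if `T` is known down to multiples of `2w`, a single comparison yields
the next binary digit. -/
theorem div_mul_half {T w lo : ℕ} (hw : 0 < w) (hlo : lo = T / (w * 2) * (w * 2)) :
    T / w * w = if T ≤ lo + w - 1 then lo else lo + w := by
  have h1 := Nat.div_add_mod T (w * 2)
  have h2 := Nat.mod_lt T (show 0 < w * 2 by omega)
  rw [mul_comm, ← hlo] at h1
  have h3 : lo = 2 * (T / (w * 2)) * w := by rw [hlo]; ring
  split_ifs with h
  · have : T / w = 2 * (T / (w * 2)) := by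
      refine Nat.div_eq_of_lt_le ?_ ?_
      · omega
      · rw [add_mul]; omega
    rw [this, h3]
  · have : T / w = 2 * (T / (w * 2)) + 1 := by
      refine Nat.div_eq_of_lt_le ?_ ?_
      · rw [add_mul]; omega
      · rw [add_mul, add_mul]; omega
    rw [this, add_mul, ← h3, one_mul]

/-- A number can be computed from comparisons by bisection. -/
theorem PolyTime.bisect {ι : Type*} {Γ : Ctx ι} {T S : ι → ℕ} (hS : PolyTime Γ fun i => .num (S i))
    (hTS : ∀ i, T i ≤ S i)
    (hT : ∀ (m : ι → ℕ) (e : ∀ i, Fin (m i) → ℕ) (Δ : Ctx (Σ i, Fin (m i))),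
      (∀ q, Δ.oracle q = Γ.oracle q.1) → (∀ y, PolyTime Γ y → PolyTime Δ fun q => y q.1) →
      PolyTime Δ (fun q => .num (e q.1 q.2)) → PolyDec Δ fun q => T q.1 ≤ e q.1 q.2) :
    PolyTime Γ fun i => .num (T i) := by
  have hB := hS.natSize
  have hb := hS.size_num_le
  set B : ι → ℕ := fun i => (S i).size
  have hlt : ∀ i, T i < 2 ^ B i := fun i => (hTS i).trans_lt (Nat.lt_size_self _)
  -- After `j` passes the state holds `T` with its lowest `B - j` bits cleared, and the place value
  -- `2 ^ (B - j)`.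
  refine (PolyTime.iter (n := B) (st := fun i j => .pair
    (.num (T i / 2 ^ (B i - j) * 2 ^ (B i - j))) (.num (2 ^ (B i - j)))) hB.fst hb
    (((hS.const (.num 0)).pair hB.snd).congr fun i => ?_) ?_).fst.congr fun i => ?_
  · simp [Nat.div_eq_of_lt (hlt i), B]
  swap
  · simp
  have hz : PolyBdd (Γ.loop B).size fun q => (Val.pair
      (.num (T q.1 / 2 ^ (B q.1 - q.2) * 2 ^ (B q.1 - q.2))) (.num (2 ^ (B q.1 - q.2)))).size := by
    refine (((hb.mul (.const _ 2)).add (.const _ 4)).reindex Sigma.fst).mono fun q => ?_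
    have h1 := Nat.size_mono (Nat.div_mul_le_self (T q.1) (2 ^ (B q.1 - q.2)))
    have h2 := Nat.size_mono (hTS q.1)
    have h3 : (S q.1).size = B q.1 := rfl
    simp only [Val.size, Nat.size_pow]
    omega
  have ht := (hS.inLoop hb).top hz
  have hw := ht.snd.divC 2
  have hlo := ht.fst
  -- The comparison takes place inside the loop, at a threshold that depends on the state; this is
  -- why `hT` ranges over extended contexts.
  have hdec := hT B (fun i j => T i / 2 ^ (B i - j) * 2 ^ (B i - j) + 2 ^ (B i - j) / 2 - 1)
    ((Γ.loop B).push _) (fun _ => rfl) (fun y hy => (hy.inLoop hb).weaken hz)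
    ((hlo.add hw).subC 1)
  refine ((PolyTime.ite_num hdec hlo (hlo.add hw)).pair hw).congr fun q => ?_
  have hq := q.2.2
  have he : B q.1 - q.2 = (B q.1 - (q.2 + 1)) + 1 := by omega
  have hpow : 2 ^ (B q.1 - q.2) = 2 ^ (B q.1 - (q.2 + 1)) * 2 := by rw [he, pow_succ]
  have h := div_mul_half (T := T q.1) (w := 2 ^ (B q.1 - (q.2 + 1))) (by positivity) rfl
  simp only [hpow, Nat.mul_div_cancel _ (show 0 < 2 by norm_num)]
  rw [h]

/-- The scaled optimal length can be computed with an oracle for the decision problem. -/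
theorem exists_optimal_length_of_oracle {ι : Type*} {Γ : Ctx ι} {Y : ι → Cities} {D : ι → ℕ}
    (hO : ∀ i (q : Cities × ℚ≥0), tspDecision.toProblem.Sol q (Γ.oracle i (tspDecision.enc q)))
    (hY : PolyTime Γ fun i => (Y i).enc) (hD : PolyTime Γ fun i => .num (D i))
    (hD2 : ∀ i, 2 ≤ D i) (hden : ∀ i a b, ((Y i).d a b).den ∣ D i)
    {l : ∀ i, List (Fin (Y i).n)} (hl : ∀ i, (Y i).IsOptimal (l i)) :
    ∃ T : ι → ℕ, (∀ i, (T i : ℚ≥0) = D i * tourLength (Y i).d (l i)) ∧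
      PolyTime Γ fun i => .num (T i) := by
  choose T hT using fun i => exists_nat_mul_tourLength (hden i) (l i)
  refine ⟨T, hT, ?_⟩
  have hb := hY.cities_bdd
  have hb1 : PolyBdd (Γ.loop fun i => (Y i).n).size fun q => (Y q.1).n := hb.reindex _
  have hY1 := hY.inLoop hb
  have hS : PolyTime Γ fun i => .num (D i * ((Y i).n * ∑ a, ∑ b, ((Y i).d a b).num)) :=
    hD.mul (hY.cities_n.mul (PolyTime.sum hY.cities_n hb (PolyTime.sum hY1.cities_n hb1
      ((hY1.inLoop hb1).cities_d ((PolyTime.loopVar hb hY).inLoop hb1)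
        (PolyTime.loopVar hb1 hY1)).encRat_num)))
  refine PolyTime.bisect hS (fun i => ?_) ?_
  · have h := mul_le_mul_of_nonneg_left (tourLength_le (Y i).d (hl i).1.1)
      (zero_le : (0 : ℚ≥0) ≤ D i)
    rw [← hT i] at h
    exact_mod_cast h
  · intro m e Δ hΔ hw he
    classical
    have hDΔ := hw _ hD
    -- The threshold `e / D` need not be in lowest terms, so `(e * D + 1) / D²` is used: its
    -- numerator is coprime to `D`. As `T` is an integer and `D ≥ 2`, the inequality `T * D ≤ e * D
    -- + 1` still means `T ≤ e`.
    have hans : ∀ q : Σ i, Fin (m i), Δ.oracle q (.pair (Y q.1).enc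
        (.pair (.num (e q.1 q.2 * D q.1 + 1)) (.num (D q.1 * D q.1)))) =
        .num (if T q.1 ≤ e q.1 q.2 then 1 else 0) := by
      rintro ⟨i, k⟩
      have h2 := hD2 i
      have hDpos : (0 : ℚ≥0) < D i := by exact_mod_cast (show 0 < D i by omega)
      rw [← encRat_div (by positivity) (Nat.Coprime.mul_right (by simp) (by simp)), hΔ]
      have key : tspDecision.Yes (Y i, ((e i k * D i + 1 : ℕ) : ℚ≥0) / (D i * D i : ℕ)) ↔
          T i ≤ e i k := by
        have h1 : tspDecision.Yes (Y i, ((e i k * D i + 1 : ℕ) : ℚ≥0) / (D i * D i : ℕ)) ↔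
            tourLength (Y i).d (l i) ≤ ((e i k * D i + 1 : ℕ) : ℚ≥0) / (D i * D i : ℕ) :=
          ⟨fun ⟨l', hl', h⟩ => ((hl i).2 l' hl').trans h, fun h => ⟨l i, (hl i).1, h⟩⟩
        rw [h1, le_div_iff₀ (by positivity)]
        have h3 : tourLength (Y i).d (l i) * ((D i * D i : ℕ) : ℚ≥0) = ((T i * D i : ℕ) : ℚ≥0) := by
          push_cast; rw [hT i]; ring
        rw [h3, Nat.cast_le]
        constructor
        · intro h
          by_contra hc
          have := Nat.mul_le_mul_right (D i) (show e i k + 1 ≤ T i by omega)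
          rw [add_mul] at this
          omega
        · intro h
          exact (Nat.mul_le_mul_right (D i) h).trans (Nat.le_succ _)
      have := hO i (Y i, ((e i k * D i + 1 : ℕ) : ℚ≥0) / (D i * D i : ℕ))
      simp only [DecisionProblem.toProblem] at this
      rw [key] at this
      rcases this with ⟨h, h'⟩ | ⟨h, h'⟩
      · rw [if_pos h]; exact h'
      · rw [if_neg h]; exact h'
    refine PolyDec.of_num ((PolyTime.oracle ((hw _ hY).pair
      (((he.mul hDΔ).addC 1).pair (hDΔ.mul hDΔ))) ?_).congr hans)
    refine PolyBdd.mono (.const _ 2) fun q => ?_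
    rw [hans]
    split_ifs <;> simp [Val.size]

theorem exists_edtDecision_of_oracle {ι : Type*} {Γ : Ctx ι} {X : ι → CostGraph × ℚ≥0}
    (hO : ∀ i (q : Cities × ℚ≥0), tspDecision.toProblem.Sol q (Γ.oracle i (tspDecision.enc q)))
    (hX : PolyTime Γ fun i => edtDecision.enc (X i)) :
    ∃ y, PolyTime Γ y ∧ ∀ i, edtDecision.toProblem.Sol (X i) (y i) := by
  classical
  have hG : PolyTime Γ fun i => (X i).1.enc := .fst (z := fun i => encRat (X i).2) hX
  have hC : PolyTime Γ fun i => encRat (X i).2 := .snd (y := fun i => (X i).1.enc) hX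
  have hn := hG.costGraph_n
  have hb := hG.costGraph_bdd
  have hb1 : PolyBdd (Γ.loop fun i => (X i).1.n).size fun q => (X q.1).1.n := hb.reindex _
  have hb2 : PolyBdd ((Γ.loop fun i => (X i).1.n).loop fun q => (X q.1).1.n).size
    fun q => (X q.1.1).1.n := hb1.reindex _
  have hG1 := hG.inLoop hb
  have hG2 := hG1.inLoop hb1
  have hG3 := hG2.inLoop hb2
  have hv1 := PolyTime.loopVar hb hG
  have hv3 := (hv1.inLoop hb1).inLoop hb2
  have hu3 := (PolyTime.loopVar hb1 hG1).inLoop hb2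
  have hw3 := PolyTime.loopVar hb2 hG2
  -- A common denominator of all turn costs. The factor 2 guarantees `D ≥ 2`, as the choice of
  -- queries demands.
  have hD : PolyTime Γ fun i =>
      .num (2 * ∏ v, ∏ u, ∏ w, ((X i).1.turnCost v u w).den) :=
    (PolyTime.prod hn hb (PolyTime.prod hG1.costGraph_n hb1 (PolyTime.prod hG2.costGraph_n hb2
      (hG3.costGraph_turnCost hv3 hu3 hw3).encRat_den))).mulC 2
  obtain ⟨D, hDdef⟩ : ∃ D : ι → ℕ, ∀ i, D i =
    2 * ∏ v, ∏ u, ∏ w, ((X i).1.turnCost v u w).den := ⟨_, fun _ => rfl⟩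
  simp only [← hDdef] at hD
  have hD2 : ∀ i, 2 ≤ D i := fun i => by
    have : 0 < ∏ v, ∏ u, ∏ w, ((X i).1.turnCost v u w).den :=
      Finset.prod_pos fun v _ => Finset.prod_pos fun u _ => Finset.prod_pos fun w _ =>
        NNRat.den_pos _
    rw [hDdef]
    omega
  have hden : ∀ i v u w, ((X i).1.turnCost v u w).den ∣ D i := fun i v u w =>
    hDdef i ▸ Dvd.dvd.mul_left ((Finset.dvd_prod_of_mem _ (Finset.mem_univ w)).trans
      ((Finset.dvd_prod_of_mem (fun u => ∏ w, ((X i).1.turnCost v u w).den)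
        (Finset.mem_univ u)).trans
        (Finset.dvd_prod_of_mem (fun v => ∏ u, ∏ w, ((X i).1.turnCost v u w).den)
          (Finset.mem_univ v)))) 2
  choose l hl using fun i v => ((X i).1.junctionCities v).exists_isOptimal
  obtain ⟨T, hT, hTP⟩ := exists_optimal_length_of_oracle (Γ := Γ.loop fun i => (X i).1.n)
    (Y := fun q => (X q.1).1.junctionCities q.2) (D := fun q => D q.1) (fun q => hO q.1)
    (hG1.junctionCities hv1) (hD.inLoop hb) (fun q => hD2 q.1) (fun q a b => hden _ _ _ _)
    (l := fun q => l q.1 q.2) (fun q => hl _ _)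
  refine ⟨_, (PolyDec.le ((PolyTime.sum (g := fun i v => T ⟨i, v⟩) hn hb hTP).mul hC.encRat_den)
    (hC.encRat_num.mul hD)).num, fun i => ?_⟩
  -- The sum of the minimal tour lengths is compared with the bound after clearing denominators.
  have key : edtDecision.Yes (X i) ↔
      (∑ v, T ⟨i, v⟩) * (X i).2.den ≤ (X i).2.num * D i := by
    have h1 := (X i).1.exists_threading_le_iff_sum (hl i) (X i).2
    refine h1.trans ?_
    have hDpos : (0 : ℚ≥0) < D i := by exact_mod_cast (show 0 < D i by have := hD2 i; omega)
    have hdpos : (0 : ℚ≥0) < (X i).2.den := by exact_mod_cast (X i).2.den_pos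
    have h2 : ((∑ v, T ⟨i, v⟩ : ℕ) : ℚ≥0) =
        D i * ∑ v, tourLength ((X i).1.junctionCities v).d (l i v) := by
      rw [Finset.mul_sum]
      push_cast
      exact Finset.sum_congr rfl fun v _ => hT ⟨i, v⟩
    have h3 : (((∑ v, T ⟨i, v⟩) * (X i).2.den : ℕ) : ℚ≥0) =
        (∑ v, tourLength ((X i).1.junctionCities v).d (l i v)) * (D i * (X i).2.den) := by
      rw [Nat.cast_mul, h2]
      ring
    have h4 : (((X i).2.num * D i : ℕ) : ℚ≥0) = (X i).2 * (D i * (X i).2.den) := by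
      rw [Nat.cast_mul, ← NNRat.den_mul_eq_num]
      ring
    rw [← Nat.cast_le (α := ℚ≥0), h3, h4]
    exact (mul_le_mul_iff_left₀ (by positivity)).symm
  by_cases h : edtDecision.Yes (X i)
  · exact .inl ⟨h, by rw [if_pos (key.1 h)]⟩
  · exact .inr ⟨h, by rw [if_neg fun h' => h (key.2 h')]⟩

theorem turingReducible_edtDecision_tspDecision :
    TuringReducible edtDecision.toProblem tspDecision.toProblem :=
  .of_polyTime (exists_edtDecision_of_oracle
    (Γ := oracleCtx edtDecision.toProblem tspDecision.toProblem) (X := fun i => i.2)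
    (fun i => i.1.2) (PolyTime.inp_oracleCtx _ _))

/-! ## The computation of a threading from its junction graphs -/

/-- A state of a rotation system as a datum. -/
def encState {n : ℕ} (s : Fin n × Fin n × Bool) : Val :=
  .pair (.num s.1) (.pair (.num s.2.1) (.num s.2.2.toNat))

/-- The table of the twists. -/
def encTwist {n : ℕ} (ε : Fin n → Fin n → Bool) : Val :=
  encFn fun x => encFn fun y => .num (ε x y).toNat

/-- The tables of the rotations. -/
def encLists {n : ℕ} (l : Fin n → List (Fin n)) : Val := encFn fun v => encFins (l v)

theorem size_encFn_le {n : ℕ} {f : Fin n → Val} {B : ℕ} (h : ∀ j, (f j).size ≤ B) :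
    (encFn f).size ≤ n * (B + 1) + 1 := by
  refine (size_encList_le (B := B) ?_).trans (by simp)
  intro v hv
  obtain ⟨j, rfl⟩ := (List.mem_ofFn' _ _).1 hv
  exact h j

theorem size_encTwist_le {n : ℕ} (ε : Fin n → Fin n → Bool) :
    (encTwist ε).size ≤ n * (n * 3 + 1 + 1) + 1 :=
  size_encFn_le fun x => size_encFn_le fun y => by cases ε x y <;> simp [Val.size]

theorem size_encState_le {n : ℕ} (s : Fin n × Fin n × Bool) :
    (encState s).size ≤ n + n + 6 := by
  obtain ⟨x, v, σ⟩ := s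
  have h1 := Nat.size_le_self (x : ℕ)
  have h2 := Nat.size_le_self (v : ℕ)
  have h3 := x.2
  have h4 := v.2
  have h5 : Nat.size σ.toNat ≤ 1 := by cases σ <;> simp
  simp only [encState, Val.size]
  omega

/-- The value of a map that is given by a table and is the identity elsewhere. -/
theorem eq_sum_of_table {m n : ℕ} {a b : Fin m → Fin n} {f : Fin n → Fin n}
    (ha : Function.Injective a) (hf : ∀ j, f (a j) = b j) (hf0 : ∀ x, (∀ j, a j ≠ x) → f x = x)
    (x : Fin n) : (f x : ℕ) = (∑ j, if (a j : ℕ) = x then (b j : ℕ) else 0) +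
      x * (1 - ∑ j, if (a j : ℕ) = x then 1 else 0) := by
  simp only [← Fin.ext_iff]
  by_cases h : ∃ j, a j = x
  · obtain ⟨j, rfl⟩ := h
    simp only [ha.eq_iff, Finset.sum_ite_eq', Finset.mem_univ, if_true, hf]
    simp
  · push Not at h
    simp [h, hf0 x h]

theorem formPerm_getElem_eq {n : ℕ} {l : List (Fin n)} (hl : l.Nodup) (j : Fin l.length) :
    l.formPerm l[(j : ℕ)] = l[((j : ℕ) + 1) % l.length]'(Nat.mod_lt _ j.pos) :=
  List.formPerm_apply_getElem _ hl _ _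

/-! ### Computing rotations, walks and twists. -/

namespace PolyTime

variable {ι : Type*} {Γ : Ctx ι} {n : ι → ℕ}

theorem encState_bdd (hn : PolyBdd Γ.size n) (s : ∀ i, Fin (n i) × Fin (n i) × Bool) :
    PolyBdd Γ.size fun i => (encState (s i)).size :=
  ((hn.add hn).add (.const _ 6)).mono fun _ => size_encState_le _

theorem encTwist_bdd (hn : PolyBdd Γ.size n) (ε : ∀ i, Fin (n i) → Fin (n i) → Bool) :
    PolyBdd Γ.size fun i => (encTwist (ε i)).size :=
  ((hn.mul (((hn.mul (.const _ 3)).add (.const _ 1)).add (.const _ 1))).add (.const _ 1)).mono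
    fun _ => size_encTwist_le _

theorem mapFins {k : ι → ℕ} {L : ∀ i, List (Fin (k i))} {g : ∀ i, Fin (k i) → Fin (n i)}
    (hL : PolyTime Γ fun i => encFins (L i))
    (hg : PolyTime (Γ.loop fun i => (L i).length) fun q => .num (g q.1 ((L q.1)[(q.2 : ℕ)]))) :
    PolyTime Γ fun i => encFins ((L i).map (g i)) :=
  (collectFins (g := fun i (j : Fin (L i).length) => g i ((L i)[(j : ℕ)])) (c := fun _ _ => true)
    hL.lengthFins hL.encFins_length_bdd
    (PolyDec.of_num ((hg.const (.num 1)).congr (by simp))) hg).congr fun i => by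
      congr 1
      apply List.ext_getElem <;> simp

/-- The lookup is written as a sum of indicators, plus `x` itself when no entry matches. Exchanging
the two columns of a table for a permutation computes its inverse. -/
theorem ofTable {m : ι → ℕ} {a b : ∀ i, Fin (m i) → Fin (n i)} {f : ∀ i, Fin (n i) → Fin (n i)}
    {x : ∀ i, Fin (n i)} (hm : PolyTime Γ fun i => .num (m i)) (hmb : PolyBdd Γ.size m)
    (ha : PolyTime (Γ.loop m) fun q => .num (a q.1 q.2))
    (hb : PolyTime (Γ.loop m) fun q => .num (b q.1 q.2)) (hx : PolyTime Γ fun i => .num (x i))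
    (hinj : ∀ i, Function.Injective (a i)) (hf : ∀ i j, f i (a i j) = b i j)
    (hf0 : ∀ i x, (∀ j, a i j ≠ x) → f i x = x) : PolyTime Γ fun i => .num (f i (x i)) := by
  have hd := PolyDec.eq ha (hx.inLoop hmb)
  refine ((sum (g := fun i j => if (a i j : ℕ) = x i then (b i j : ℕ) else 0) hm hmb
    (ite_num hd hb (hb.const (.num 0)))).add (hx.mul ((hx.const (.num 1)).sub
      (sum (g := fun i j => if (a i j : ℕ) = x i then 1 else 0) hm hmb hd.num)))).congr fun i => ?_
  rw [eq_sum_of_table (hinj i) (hf i) (hf0 i)]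

section FormPerm

variable {L : ∀ i, List (Fin (n i))} (hL : PolyTime Γ fun i => encFins (L i))
  (hnd : ∀ i, (L i).Nodup) {x : ∀ i, Fin (n i)} (hx : PolyTime Γ fun i => .num (x i))
include hL hnd hx

theorem formPerm : PolyTime Γ fun i => .num ((L i).formPerm (x i)) := by
  have hb := hL.encFins_length_bdd
  have hL1 := hL.inLoop hb
  have hj := loopVar hb hL
  exact ofTable (f := fun i => (L i).formPerm) (a := fun i j => (L i)[(j : ℕ)])
    (b := fun i j => (L i)[((j : ℕ) + 1) % (L i).length]'(Nat.mod_lt _ j.pos))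
    hL.lengthFins hb (hL1.getFins hj fun q => q.2.2)
    (hL1.getFins ((hj.addC 1).mod hL1.lengthFins) fun q => Nat.mod_lt _ q.2.pos) hx
    (fun i j k h => Fin.ext ((hnd i).getElem_inj_iff.1 h))
    (fun i j => formPerm_getElem_eq (hnd i) j) fun i x h => by
      refine List.formPerm_apply_of_notMem fun hx => ?_
      obtain ⟨j, hj, rfl⟩ := List.getElem_of_mem hx
      exact h ⟨j, hj⟩ rfl

theorem formPerm_symm : PolyTime Γ fun i => .num ((L i).formPerm.symm (x i)) := by
  have hb := hL.encFins_length_bdd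
  have hL1 := hL.inLoop hb
  have hj := loopVar hb hL
  refine ofTable (f := fun i => (L i).formPerm.symm)
    (a := fun i j => (L i)[((j : ℕ) + 1) % (L i).length]'(Nat.mod_lt _ j.pos))
    (b := fun i j => (L i)[(j : ℕ)]) hL.lengthFins hb
    (hL1.getFins ((hj.addC 1).mod hL1.lengthFins) fun q => Nat.mod_lt _ q.2.pos)
    (hL1.getFins hj fun q => q.2.2) hx (fun i j k h => ?_) (fun i j => ?_) fun i x h => ?_
  · simp only [← formPerm_getElem_eq (hnd i)] at h
    exact Fin.ext ((hnd i).getElem_inj_iff.1 ((L i).formPerm.injective h))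
  · rw [← formPerm_getElem_eq (hnd i), Equiv.symm_apply_apply]
  · rw [Equiv.symm_apply_eq]
    refine (List.formPerm_apply_of_notMem fun hx => ?_).symm
    have hmem : (L i).formPerm.symm x ∈ L i := by
      rw [← List.formPerm_mem_iff_mem, Equiv.apply_symm_apply]
      exact hx
    obtain ⟨j, hj, hjx⟩ := List.getElem_of_mem hmem
    refine h ⟨j, hj⟩ ?_
    rw [← formPerm_getElem_eq (hnd i) ⟨j, hj⟩, hjx, Equiv.apply_symm_apply]

end FormPerm

section Step

variable {l : ∀ i, Fin (n i) → List (Fin (n i))} {ε : ∀ i, Fin (n i) → Fin (n i) → Bool}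
  {s : ∀ i, Fin (n i) × Fin (n i) × Bool} {a b : ∀ i, Fin (n i)}

theorem step (hL : PolyTime Γ fun i => encLists (l i)) (hnd : ∀ i v, (l i v).Nodup)
    (hε : PolyTime Γ fun i => encTwist (ε i)) (hs : PolyTime Γ fun i => encState (s i)) :
    PolyTime Γ fun i => encState (Threading.step (fun v => (l i v).formPerm) (ε i) (s i)) := by
  have hx : PolyTime Γ fun i => .num (s i).1 := hs.fst
  have hv : PolyTime Γ fun i => .num (s i).2.1 := hs.snd.fst
  have hσ : PolyTime Γ fun i => .num (s i).2.2.toNat := hs.snd.snd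
  have hLv : PolyTime Γ fun i => encFins (l i (s i).2.1) :=
    app (f := fun i v => encFins (l i v)) hL hv
  have ht : PolyTime Γ fun i =>
      .num ((turnTo (fun v => (l i v).formPerm) (s i) : Fin (n i)) : ℕ) :=
    (ite (PolyDec.eqC hσ 1) (hLv.formPerm (fun i => hnd i _) hx)
      (hLv.formPerm_symm (fun i => hnd i _) hx)).congr fun i => by
        rw [turnTo]
        cases (s i).2.2 <;> simp
  have he : PolyTime Γ fun i =>
      .num (ε i (turnTo (fun v => (l i v).formPerm) (s i)) (s i).2.1).toNat :=
    app (f := fun i y => .num (ε i (turnTo (fun v => (l i v).formPerm) (s i)) y).toNat)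
      (app (f := fun i x => encFn fun y => .num (ε i x y).toNat) hε ht) hv
  -- The negations in `partner` and `link` cancel, so the new sense is the exclusive or of the old
  -- sense and the twist, computed as a sum modulo two.
  refine (hv.pair (ht.pair ((hσ.add he).modC 2))).congr fun i => ?_
  simp only [encState, Threading.step, link, partner]
  cases (s i).2.2 <;> cases ε i (turnTo (fun v => (l i v).formPerm) (s i)) (s i).2.1 <;> rfl

theorem _root_.Threading.PolyDec.over (hs : PolyTime Γ fun i => encState (s i))
    (ha : PolyTime Γ fun i => .num (a i)) (hb : PolyTime Γ fun i => .num (b i)) :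
    PolyDec Γ fun i => Over (a i) (b i) (s i) := by
  have hx : PolyTime Γ fun i => .num (s i).1 := hs.fst
  have hv : PolyTime Γ fun i => .num (s i).2.1 := hs.snd.fst
  refine (((PolyDec.eq hx ha).and (PolyDec.eq hv hb)).or
    ((PolyDec.eq hx hb).and (PolyDec.eq hv ha))).congr fun i => ?_
  simp only [Over, Fin.ext_iff]

theorem iterate_step {m : ι → ℕ} (hn : PolyBdd Γ.size n) (hm : PolyTime Γ fun i => .num (m i))
    (hmb : PolyBdd Γ.size m) (hL : PolyTime Γ fun i => encLists (l i))
    (hnd : ∀ i v, (l i v).Nodup) (hε : PolyTime Γ fun i => encTwist (ε i))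
    (hs : PolyTime Γ fun i => encState (s i)) : PolyTime Γ fun i =>
      encState ((Threading.step (fun v => (l i v).formPerm) (ε i))^[m i] (s i)) := by
  have hz := encState_bdd (Γ := Γ.loop m) (hn.reindex Sigma.fst) fun q =>
    (Threading.step (fun v => (l q.1 v).formPerm) (ε q.1))^[q.2] (s q.1)
  refine iter (st := fun i j =>
    encState ((Threading.step (fun v => (l i v).formPerm) (ε i))^[j] (s i))) hm hmb hs
    ((step ((hL.inLoop hmb).weaken hz) (fun q => hnd q.1) ((hε.inLoop hmb).weaken hz)
      (((hs.inLoop hmb)).top hz)).congr fun q => ?_)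
  rw [Function.iterate_succ_apply']

theorem firstReturn {N : ι → ℕ} (hn : PolyBdd Γ.size n) (hN : PolyTime Γ fun i => .num (N i))
    (hNb : PolyBdd Γ.size N) (hL : PolyTime Γ fun i => encLists (l i))
    (hnd : ∀ i v, (l i v).Nodup) (hε : PolyTime Γ fun i => encTwist (ε i))
    (ha : PolyTime Γ fun i => .num (a i)) (hb : PolyTime Γ fun i => .num (b i)) :
    PolyTime Γ fun i =>
      encState (Threading.firstReturn (fun v => (l i v).formPerm) (ε i) (N i) (a i) (b i)) := by
  have hs : PolyTime Γ fun i => encState (a i, b i, true) := ha.pair (hb.pair (ha.const (.num 1)))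
  have hz := encState_bdd (Γ := Γ.loop N) (hn.reindex Sigma.fst) fun q =>
    (seek (fun v => (l q.1 v).formPerm) (ε q.1) (a q.1) (b q.1))^[q.2]
      (Threading.step (fun v => (l q.1 v).formPerm) (ε q.1) (a q.1, b q.1, true))
  have ht := (hs.inLoop hNb).top hz
  refine iter (st := fun i j => encState
    ((seek (fun v => (l i v).formPerm) (ε i) (a i) (b i))^[j]
      (Threading.step (fun v => (l i v).formPerm) (ε i) (a i, b i, true)))) hN hNb
    (step hL hnd hε hs) ((ite (PolyDec.over ht ((ha.inLoop hNb).weaken hz)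
      ((hb.inLoop hNb).weaken hz)) ht (step ((hL.inLoop hNb).weaken hz) (fun q => hnd q.1)
        ((hε.inLoop hNb).weaken hz) ht)).congr fun q => ?_)
  rw [Function.iterate_succ_apply', seek]
  split_ifs <;> rfl

theorem twist {N : ι → ℕ} (hn : PolyTime Γ fun i => .num (n i)) (hnb : PolyBdd Γ.size n)
    (hN : PolyTime Γ fun i => .num (N i))
    (hNb : PolyBdd Γ.size N) (hL : PolyTime Γ fun i => encLists (l i))
    (hnd : ∀ i v, (l i v).Nodup) (hε : PolyTime Γ fun i => encTwist (ε i))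
    (ha : PolyTime Γ fun i => .num (a i)) (hb : PolyTime Γ fun i => .num (b i)) :
    PolyTime Γ fun i =>
      encTwist (Threading.twist (fun v => (l i v).formPerm) (N i) (ε i) (a i, b i)) := by
  have hr := firstReturn hnb hN hNb hL hnd hε ha hb
  have hf : PolyDec Γ fun i => a i ≠ b i ∧
      Threading.firstReturn (fun v => (l i v).formPerm) (ε i) (N i) (a i) (b i) =
        (a i, b i, true) := by
    refine ((PolyDec.eq ha hb).not.and ((PolyDec.eq hr.fst ha).and ((PolyDec.eq hr.snd.fst hb).and
      (PolyDec.eqC hr.snd.snd 1)))).congr fun i => ?_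
    simp only [Prod.ext_iff, Fin.ext_iff, ne_eq]
    cases (Threading.firstReturn (fun v => (l i v).formPerm) (ε i) (N i) (a i) (b i)).2.2 <;> simp
  have hnb1 : PolyBdd (Γ.loop n).size fun q => n q.1 := hnb.reindex _
  have hx := (loopVar hnb hn).inLoop hnb1
  have hy := loopVar hnb1 (hn.inLoop hnb)
  have ha2 := (ha.inLoop hnb).inLoop hnb1
  have hb2 := (hb.inLoop hnb).inLoop hnb1
  have he : PolyTime ((Γ.loop n).loop fun q => n q.1) fun q =>
      .num (ε q.1.1 q.1.2 q.2).toNat :=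
    app (f := fun q y => .num (ε q.1.1 q.1.2 y).toNat)
      (app (f := fun q x => encFn fun y => .num (ε q.1.1 x y).toNat)
        ((hε.inLoop hnb).inLoop hnb1) hx) hy
  have hf2 : PolyDec ((Γ.loop n).loop fun q => n q.1) _ := (PolyTime.inLoop hnb hf).inLoop hnb1
  classical
  refine tabulate hn hnb (tabulate (hn.inLoop hnb) hnb1 ((ite (hf2.and
    (((PolyDec.eq hx ha2).and (PolyDec.eq hy hb2)).or ((PolyDec.eq hx hb2).and
      (PolyDec.eq hy ha2)))) ((he.const (.num 1)).sub he) he).congr fun q => ?_))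
  simp only [Threading.twist, Fin.ext_iff]
  split_ifs <;> cases ε q.1.1 q.1.2 q.2 <;> rfl

theorem twists {N m : ι → ℕ} {pr : ∀ i, ℕ → Fin (n i) × Fin (n i)}
    (hn : PolyTime Γ fun i => .num (n i)) (hnb : PolyBdd Γ.size n)
    (hN : PolyTime Γ fun i => .num (N i)) (hNb : PolyBdd Γ.size N)
    (hm : PolyTime Γ fun i => .num (m i)) (hmb : PolyBdd Γ.size m)
    (hL : PolyTime Γ fun i => encLists (l i)) (hnd : ∀ i v, (l i v).Nodup)
    (ha : PolyTime (Γ.loop m) fun q => .num (pr q.1 q.2).1)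
    (hb : PolyTime (Γ.loop m) fun q => .num (pr q.1 q.2).2) :
    PolyTime Γ fun i =>
      encTwist (Threading.twists (fun v => (l i v).formPerm) (N i) (pr i) (m i)) := by
  have hz := encTwist_bdd (Γ := Γ.loop m) (hnb.reindex Sigma.fst) fun q =>
    Threading.twists (fun v => (l q.1 v).formPerm) (N q.1) (pr q.1) q.2
  have hnb1 : PolyBdd (Γ.loop n).size fun q => n q.1 := hnb.reindex _
  have w : ∀ {y : ι → Val}, PolyTime Γ y → PolyTime ((Γ.loop m).push fun q =>
      encTwist (Threading.twists (fun v => (l q.1 v).formPerm) (N q.1) (pr q.1) q.2))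
      fun q => y q.1 := fun h => (h.inLoop hmb).weaken hz
  refine iter (st := fun i j =>
    encTwist (Threading.twists (fun v => (l i v).formPerm) (N i) (pr i) j)) hm hmb
    (tabulate hn hnb (tabulate (hn.inLoop hnb) hnb1
      (((hn.inLoop hnb).inLoop hnb1).const (.num 0))))
    (twist (w hn) (hnb.reindex Sigma.fst) (w hN) (hNb.reindex Sigma.fst) (w hL)
      (fun q => hnd q.1) ((hm.inLoop hmb).top hz) (ha.weaken hz) (hb.weaken hz))

end Step

end PolyTime

/-- A threading with given junction graphs can be computed in polynomial time. -/
theorem exists_threading_of_tables {ι : Type*} {Γ : Ctx ι} {X : ι → CostGraph}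
    {l : ∀ i, Fin (X i).n → List (Fin (X i).n)} (hX : PolyTime Γ fun i => (X i).enc)
    (hl : ∀ i v, IsTour ((X i).G.neighborSet v) (l i v))
    (hL : PolyTime Γ fun i => encLists (l i)) :
    ∃ y, PolyTime Γ y ∧ ∀ i, ∃ (u : Fin (X i).n) (W : (X i).G.Walk u u),
      (∀ v, junction W v = cycleEdges (l i v)) ∧ y i = encFins W.support.tail := by
  have hn := hX.costGraph_n
  have hb := hX.costGraph_bdd
  have hpos : ∀ i, 0 < (X i).n := fun i => by
    obtain ⟨v⟩ := (X i).admissible.connected.nonempty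
    exact v.pos
  have hnd : ∀ i v, (l i v).Nodup := fun i v => (hl i v).1
  have h0 : ∀ i, 0 < (l i ⟨0, hpos i⟩).length := fun i => by
    have := (hl i ⟨0, hpos i⟩).two_le_length ((X i).admissible.two_le_degree _)
    omega
  -- Quotient and remainder by the number of vertices enumerate all ordered pairs.
  let pr : ∀ i, ℕ → Fin (X i).n × Fin (X i).n := fun i k =>
    (⟨k / (X i).n % (X i).n, Nat.mod_lt _ (hpos i)⟩, ⟨k % (X i).n, Nat.mod_lt _ (hpos i)⟩)
  let ε : ∀ i, Fin (X i).n → Fin (X i).n → Bool := fun i =>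
    twists (fun v => (l i v).formPerm) ((X i).n * ((X i).n * 2)) (pr i) ((X i).n * (X i).n)
  let s : ∀ i, Fin (X i).n × Fin (X i).n × Bool := fun i =>
    (⟨0, hpos i⟩, (l i ⟨0, hpos i⟩)[0]'(h0 i), true)
  -- The length of the threading is the sum of the degrees, so the output length is known before the
  -- walk is followed.
  let m : ι → ℕ := fun i => ∑ v, (l i v).length
  have hnn := hb.mul hb
  have hk := PolyTime.loopVar hnn hX
  have hε : PolyTime Γ fun i => encTwist (ε i) :=
    PolyTime.twists hn hb (hn.mul (hn.mul (hn.const (.num 2)))) (hb.mul (hb.mul (.const _ 2)))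
      (hn.mul hn) hnn hL hnd ((hk.div (hn.inLoop hnn)).mod (hn.inLoop hnn))
      (hk.mod (hn.inLoop hnn))
  have hl0 : PolyTime Γ fun i => encFins (l i ⟨0, hpos i⟩) :=
    PolyTime.app (f := fun i v => encFins (l i v)) hL (hn.const (.num 0))
  have hs : PolyTime Γ fun i => encState (s i) :=
    (hn.const (.num 0)).pair ((hl0.getFins (hn.const (.num 0)) h0).pair (hn.const (.num 1)))
  have hm : PolyTime Γ fun i => .num (m i) :=
    PolyTime.sum hn hb (PolyTime.lengthFins (PolyTime.app (f := fun q v => encFins (l q.1 v))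
      (hL.inLoop hb) (PolyTime.loopVar hb hn)))
  have hmb : PolyBdd Γ.size m := (hb.mul hb).mono fun i => by
    calc ∑ v, (l i v).length ≤ ∑ v : Fin (X i).n, (X i).n := Finset.sum_le_sum fun v _ => by
          simpa using (hnd i v).length_le_card
      _ = _ := by simp
  have hit : PolyTime (Γ.loop m) fun q => encState
      ((step (fun v => (l q.1 v).formPerm) (ε q.1))^[q.2] (s q.1)) :=
    PolyTime.iterate_step (hb.reindex Sigma.fst) (PolyTime.loopVar hmb hn)
      ((hmb.reindex Sigma.fst).mono fun q => q.2.2.le) (hL.inLoop hmb) (fun q => hnd q.1)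
      (hε.inLoop hmb) (hs.inLoop hmb)
  -- The second component of state `j` is vertex `j + 1` of the walk, in agreement with an output
  -- that omits the starting vertex.
  refine ⟨_, PolyTime.collectFins (c := fun _ _ => true) (g := fun i (j : Fin (m i)) =>
    ((step (fun v => (l i v).formPerm) (ε i))^[j] (s i)).2.1) hm hmb
    (PolyDec.of_num ((hit.const (.num 1)).congr (by simp))) hit.snd.fst, fun i => ?_⟩
  obtain ⟨hε', hgood⟩ := twists_spec (π := fun v => (l i v).formPerm)
    (N := (X i).n * ((X i).n * 2)) (by simp) (pr i) ((X i).n * (X i).n)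
  have hadj : ∀ a b, (X i).G.Adj a b → ∀ s t, Over a b s → Over a b t →
      Joined (fun v => (l i v).formPerm) (ε i) s t := by
    intro a b hab s t hs ht
    have hlt : (a : ℕ) * (X i).n + b < (X i).n * (X i).n := by
      have h1 := a.2
      have h2 := b.2
      calc (a : ℕ) * (X i).n + b < a * (X i).n + (X i).n := by omega
        _ = (a + 1) * (X i).n := by ring
        _ ≤ _ := Nat.mul_le_mul_right _ h1
    have hpr : pr i (a * (X i).n + b) = (a, b) := by
      simp only [pr, Prod.mk.injEq, Fin.ext_iff]
      rw [mul_comm, Nat.mul_add_div (hpos i), Nat.div_eq_of_lt b.2, add_zero,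
        Nat.mod_eq_of_lt a.2, Nat.mul_add_mod, Nat.mod_eq_of_lt b.2]
      exact ⟨rfl, rfl⟩
    have := hgood _ hlt
    rw [hpr] at this
    exact this hab.ne s t hs ht
  obtain ⟨W, hW, hj⟩ := exists_threading_of_good (X i).admissible (hl i) hε' hadj
    (s₀ := s i) (((hl i ⟨0, hpos i⟩).2 _).1 (List.getElem_mem (h0 i)))
  refine ⟨_, W, hj, ?_⟩
  have hlen : W.length = m i := length_eq_sum_length hj
  congr 1
  apply List.ext_getElem
  · simp [hlen]
  · intro j h1 h2
    have hj' : j < W.length := by simpa using h2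
    rw [List.getElem_tail, W.support_getElem_eq_getVert, hW.getVert _ hj',
      Function.iterate_succ_apply']
    simp
    rfl

/-- One query per vertex gives optimal tours, and gluing them costs nothing extra, since the turn
cost is the sum of their lengths. -/
theorem exists_optimal_threading_of_oracle {ι : Type*} {Γ : Ctx ι} {X : ι → CostGraph}
    (hO : ∀ i (q : Cities), tspOptimization.Sol q (Γ.oracle i q.enc))
    (hX : PolyTime Γ fun i => (X i).enc) :
    ∃ y, PolyTime Γ y ∧ ∀ i, edtOptimization.Sol (X i) (y i) := by
  have hn := hX.costGraph_n
  have hb := hX.costGraph_bdd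
  have hX1 := hX.inLoop hb
  have hv := PolyTime.loopVar hb hX
  choose t ht hans using fun i v => hO i ((X i).junctionCities v)
  have hJ := hX1.junctionCities hv
  have hT : PolyTime (Γ.loop fun i => (X i).n) fun q => encFins (t q.1 q.2) := by
    refine (hJ.oracle ?_).congr fun q => hans q.1 q.2
    refine (((hJ.cities_bdd.mul (hJ.cities_bdd.add (.const _ 2))).add (.const _ 1))).mono
      fun q => ?_
    -- An answer is a list of cities without repetition, so reading it is cheap.
    refine (congrArg Val.size (hans q.1 q.2)).trans_le ((size_encFins_le _).trans ?_)
    gcongr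
    simpa using (ht q.1 q.2).1.1.length_le_card
  have hTb := hT.encFins_length_bdd
  have hL : PolyTime Γ fun i => encLists fun v => (t i v).map ((X i).nbrAt v) :=
    PolyTime.tabulate hn hb (PolyTime.mapFins (n := fun q => (X q.1).n)
      (g := fun q => (X q.1).nbrAt q.2) hT
      (((hX1.nbrs hv).inLoop hTb).getFins ((hT.inLoop hTb).getFins (PolyTime.loopVar hTb hX1)
        fun q => q.2.2) fun q => ((t q.1.1 q.1.2)[(q.2 : ℕ)]).2))
  obtain ⟨y, hy, hyW⟩ := exists_threading_of_tables hX
    (fun i v => (X i).isTour_of_isOptimal (ht i v)) hL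
  refine ⟨y, hy, fun i => ?_⟩
  obtain ⟨u, W, hW, hyi⟩ := hyW i
  have hWE := isExactlyDoubleThreading_of_junction (X i).admissible
    (fun v => (X i).isTour_of_isOptimal (ht i v)) hW
  refine ⟨u, W, ⟨hWE, fun u' W' hW' => ?_⟩, hyi⟩
  rw [← (X i).walkCost_turnCosts hWE, ← (X i).walkCost_turnCosts hW',
    walkCost_eq_sum_tourLength _ hW]
  exact sum_minimal_le _ (fun v => (X i).minimal_of_isOptimal (ht i v)) hW'

theorem turingReducible_edtOptimization_tspOptimization :
    TuringReducible edtOptimization tspOptimization :=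
  .of_polyTime (exists_optimal_threading_of_oracle
    (Γ := oracleCtx edtOptimization tspOptimization) (X := fun i => i.2)
    (fun i => i.1.2) (PolyTime.inp_oracleCtx _ _))

end Threading
open Threading in
theorem mainTheorem6 :
    -- junction graphs are Hamiltonian cycles, and the problem splits into one TSP per vertex
    (∀ (V : Type*) [Fintype V] [DecidableEq V] (G : SimpleGraph V) (α : TurnCosts V ℝ≥0),
      Admissible G →
        (∀ (u : V) (W : G.Walk u u), IsExactlyDoubleThreading W →
          ∃ l : V → List V,
            (∀ v, IsTour (G.neighborSet v) (l v) ∧ junction W v = cycleEdges (l v)) ∧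
            α.walkCost W = ∑ v, tourLength (fun x y => α.cost x v y) (l v)) ∧
        (∀ l : V → List V, (∀ v, IsTour (G.neighborSet v) (l v)) →
          ∃ (u : V) (W : G.Walk u u), IsExactlyDoubleThreading W ∧
            (∀ v, junction W v = cycleEdges (l v)) ∧
            α.walkCost W = ∑ v, tourLength (fun x y => α.cost x v y) (l v)) ∧
        ∃ τ : V → ℝ≥0,
          (∀ v, IsLeast {r | ∃ l, IsTour (G.neighborSet v) l ∧
            tourLength (fun x y => α.cost x v y) l = r} (τ v)) ∧
          IsLeast {r | ∃ (u : V) (W : G.Walk u u), IsExactlyDoubleThreading W ∧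
            α.walkCost W = r} (∑ v, τ v)) ∧
    -- TSP embeds by the star of arms
    (∀ (n : ℕ), 2 ≤ n → Admissible (starGraph n) ∧
      ∀ (d : Fin n → Fin n → ℝ≥0) (hd : ∀ i j, d i j = d j i) (C : ℝ≥0),
        (∃ l, IsTour Set.univ l ∧ tourLength d l ≤ C) ↔
          ∃ (u : Option (Fin n × Fin 3)) (W : (starGraph n).Walk u u),
            IsExactlyDoubleThreading W ∧ (starCosts d hd).walkCost W ≤ C + 7 * n) ∧
    -- polynomial-time equivalence of the decision versions
    (KarpReducible tspDecision edtDecision ∧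
      TuringReducible edtDecision.toProblem tspDecision.toProblem) ∧
    -- polynomial-time equivalence of the optimization versions
    (TuringReducible tspOptimization edtOptimization ∧
      TuringReducible edtOptimization tspOptimization) := by

  exact ⟨fun V _ _ G α hG => ⟨fun u W hW => hW.exists_tours α, fun l hl =>
    exists_threading_eq_sum hG α hl, isLeast_threading hG α⟩, fun n hn =>
    ⟨starGraph_admissible hn, fun d hd C => exists_tour_iff_starGraph hn d hd C⟩,
    ⟨karpReducible_tspDecision_edtDecision, turingReducible_edtDecision_tspDecision⟩,
    turingReducible_tspOptimization_edtOptimization,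
    turingReducible_edtOptimization_tspOptimization⟩
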